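/- Let $H$ be a definite quaternion algebra over $\mathbb{Q}$, with reduced norm $N$ and reduced trace $\operatorname{tr}$, and let $\mathcal{O}\subset H$ be an order. The norm $N(L)$ of a lattice $L\subset H$ is the (positive) gcd of the rational numbers $N(x)$, $x\in L$. Put $\mathcal{O}^\sharp=\{x\in H:\operatorname{tr}(x\mathcal{O})\subseteq\mathbb{Z}\}$ and $N(\mathcal{O}):=N(\mathcal{O}^\sharp)^{-1}$ (the level), and let $\operatorname{disc}(\mathcal{O})$ be the reduced discriminant of $\mathcal{O}$, i.e. the positive square root of the determinant of the quadratic form $N$ on $\mathcal{O}$ (the Gram determinant of $(x,y)\mapsto \operatorname{tr}(x\bar y)$ in a $\mathbb{Z}$-basis). A left $\mathcal{O}$-ideal is a lattice $\mathfrak{a}\subset H$ such that for every prime $p$ one has $\mathfrak{a}_p=\mathcal{O}_p x_p$ for some $x_p\in H_p^\times$; two left ideals $\mathfrak a,\mathfrak b$ are in the same class if $\mathfrak{b}=\mathfrak{a}x$ for some $x\in H^\times$. Let $M(\mathcal{O})$ be the free $\mathbb{Z}$-module on the set of classes $[\mathfrak{a}]$, and $M_{\mathbb{R}}(\mathcal{O})=M(\mathcal{O})\otimes\mathbb{R}$,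 with the bilinear height pairing $\langle[\mathfrak{a}],[\mathfrak{b}]\rangle=\tfrac12\#\{x\in H^\times:\mathfrak{a}x=\mathfrak{b}\}$ and the linear map $\deg$ with $\deg[\mathfrak{a}]=1$; let $M^\vee(\mathcal{O})=\{v\in M_{\mathbb{R}}(\mathcal{O}):\langle v,M(\mathcal{O})\rangle\subseteq\mathbb{Z}\}$. For $m\ge1$ the Hecke operator $t_m$ is the linear map with $t_m[\mathfrak{a}]=\sum_{\mathfrak{b}}[\mathfrak{b}]$, the sum over the left $\mathcal{O}$-ideals $\mathfrak{b}\subseteq\mathfrak{a}$ with $N(\mathfrak{b})=m\,N(\mathfrak{a})$. For $v\in M^\vee(\mathcal{O})$ and $w\in M(\mathcal{O})$ put, with $q=e^{2\pi i\tau}$, $\operatorname{Im}\tau>0$, $$\phi(v,w)=\frac{\deg v\cdot\deg w}{2}+\sum_{m\ge1}\langle v,t_m w\rangle q^m .$$ Then $N(\mathcal{O})$ and $\operatorname{disc}(\mathcal{O})$ are positive integers, and: 1. For all $v\in M^\vee(\mathcal{O})$ and $w\in M(\mathcal{O})$ the series $\phi(v,w)$ converges on the upper half plane and is a modular form of weight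 $2$, level $N(\mathcal{O})$ and trivial character, i.e. for $\Gamma_0(N(\mathcal{O}))$. 2. $\phi(v,w)$ is a linear combination of theta series of quaternary lattices. Precisely, for left $\mathcal{O}$-ideals $\mathfrak{a},\mathfrak{b}$, with $\mathfrak{c}=\mathfrak{a}^{-1}\mathfrak{b}$ where $\mathfrak{a}^{-1}=\{x\in H:\mathfrak{a}x\mathfrak{a}\subseteq\mathfrak{a}\}$, one has $$\phi([\mathfrak{a}],[\mathfrak{b}])=\tfrac12\,\theta_{\mathfrak{c}},\qquad \theta_{\mathfrak{c}}=\sum_{x\in\mathfrak{c}}q^{N(x)/N(\mathfrak{c})},$$ with $\theta_{\mathfrak c}$ absolutely convergent, and if $(\mathfrak{a}_i)$ represents the ideal classes, $v=\sum_i v_i[\mathfrak{a}_i]$ and $w=\sum_j w_j[\mathfrak{a}_j]$, then $\phi(v,w)=\sum_{i,j}v_iw_j\cdot\tfrac12\theta_{\mathfrak{a}_i^{-1}\mathfrak{a}_j}$. 3. For every $n\ge1$ with $(n,\operatorname{disc}(\mathcal{O}))=1$ one has $t_nv\in M^\vee(\mathcal{O})$ and $$\phi(v,w)|T(n)=\phi(t_nv,w)=\phi(v,t_nw),$$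 where $T(n)$ is the Hecke operator on forms of weight $2$ and level $N=N(\mathcal{O})$ with trivial character, $(f|T(n))(\tau)=n\sum_{ad=n,\,(a,N)=1}d^{-2}\sum_{0\le j<d}f\bigl(\tfrac{a\tau+j}{d}\bigr)$. 4. $M(\mathcal{O})\subseteq M^\vee(\mathcal{O})$, and if $0\ne v\in M(\mathcal{O})$ satisfies $t_nv=\lambda_nv$ for all $n\ge1$ with $(n,\operatorname{disc}(\mathcal{O}))=1$, then $\phi(v,v)\ne0$ and $\phi(v,v)|T(n)=\lambda_n\,\phi(v,v)$ for all these $n$. -/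

import Mathlib

namespace QuatTheta

open scoped TensorProduct

noncomputable section

/-- The quaternion algebra `(a, b / ℚ)`: `i ^ 2 = a`, `j ^ 2 = b`, `i j = - j i`.
It is definite exactly when `a < 0` and `b < 0`. -/
abbrev Quat (a b : ℚ) : Type := QuaternionAlgebra ℚ a 0 b

/-- Reduced norm `x x̄`. -/
def nrd {a b : ℚ} (x : Quat a b) : ℚ := (x * star x).re

/-- Reduced trace `x + x̄`. -/
def trd {a b : ℚ} (x : Quat a b) : ℚ := (x + star x).re

theorem nrd_mul {a b : ℚ} (x y : Quat a b) : nrd (x * y) = nrd x * nrd y := by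
  simp [nrd]; ring

theorem nrd_unit_ne_zero {a b : ℚ} (x : (Quat a b)ˣ) : nrd (x : Quat a b) ≠ 0 := by
  intro h
  have h1 : nrd ((x : Quat a b) * ((x⁻¹ : (Quat a b)ˣ) : Quat a b)) = 1 := by
    rw [Units.mul_inv]; simp [nrd]
  rw [nrd_mul, h, zero_mul] at h1
  exact zero_ne_one h1

/-- The greatest common divisor of a set `S` of rational numbers: the nonnegative generator of the
subgroup of `ℚ` generated by `S` (set to `0` if that subgroup is not cyclic). -/
def ratGcd (S : Set ℚ) : ℚ :=
  open Classical in
  if h : ∃ r : ℚ, 0 ≤ r ∧ Submodule.span ℤ S = Submodule.span ℤ {r} then h.choose else 0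

theorem ratGcd_eq {S : Set ℚ} {r : ℚ} (hr : 0 ≤ r)
    (h : Submodule.span ℤ S = Submodule.span ℤ {r}) : ratGcd S = r := by
  have hex : ∃ r : ℚ, 0 ≤ r ∧ Submodule.span ℤ S = Submodule.span ℤ {r} := ⟨r, hr, h⟩
  have hs := hex.choose_spec
  rw [ratGcd, dif_pos hex]
  generalize hex.choose = s at hs
  obtain ⟨h0, h1⟩ := hs
  obtain ⟨z, hz⟩ := Submodule.span_singleton_eq_span_singleton.1 (h1.symm.trans h)
  rcases Int.units_eq_one_or z with rfl | rfl
  · simpa using hz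
  · simp at hz; linarith

theorem span_image_mul (c : ℚ) (S : Set ℚ) :
    Submodule.span ℤ ((fun y => c * y) '' S)
      = (Submodule.span ℤ S).map (LinearMap.mulLeft ℤ c) := by
  rw [Submodule.map_span]; rfl

theorem ratGcd_image_mul {c : ℚ} (hc : c ≠ 0) (S : Set ℚ) :
    ratGcd ((fun y => c * y) '' S) = |c| * ratGcd S := by
  have key : ∀ (c : ℚ) (S : Set ℚ) (r : ℚ), 0 ≤ r →
      Submodule.span ℤ S = Submodule.span ℤ {r} →
      Submodule.span ℤ ((fun y => c * y) '' S) = Submodule.span ℤ {|c| * r} := by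
    intro c S r hr h
    rw [span_image_mul, h, Submodule.map_span]
    rcases abs_choice c with h' | h' <;> simp [h', ← Set.neg_singleton, Submodule.span_neg]
  by_cases h : ∃ r : ℚ, 0 ≤ r ∧ Submodule.span ℤ S = Submodule.span ℤ {r}
  · obtain ⟨r, hr, h⟩ := h
    rw [ratGcd_eq hr h, ratGcd_eq (by positivity) (key c S r hr h)]
  · have h2 : ¬ ∃ r : ℚ, 0 ≤ r ∧
        Submodule.span ℤ ((fun y => c * y) '' S) = Submodule.span ℤ {r} := by
      rintro ⟨r, hr, h3⟩
      refine h ⟨|c⁻¹| * r, by positivity, ?_⟩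
      have := key c⁻¹ _ r hr h3
      simpa [Set.image_image, hc] using this
    rw [ratGcd, ratGcd, dif_neg h, dif_neg h2, mul_zero]

/-- The norm of a lattice: the gcd of the reduced norms of its elements. -/
def latticeNorm {a b : ℚ} (L : Submodule ℤ (Quat a b)) : ℚ :=
  ratGcd (nrd '' (L : Set (Quat a b)))

/-- The lattice `L x`. -/
def rmul {a b : ℚ} (L : Submodule ℤ (Quat a b)) (x : (Quat a b)ˣ) : Submodule ℤ (Quat a b) :=
  L.map (LinearMap.mulRight ℤ (x : Quat a b))

theorem rmul_rmul {a b : ℚ} (L : Submodule ℤ (Quat a b)) (x y : (Quat a b)ˣ) :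
    rmul (rmul L x) y = rmul L (x * y) := by
  rw [rmul, rmul, rmul, ← Submodule.map_comp]
  congr 1
  ext1 z
  simp [mul_assoc]

theorem rmul_one {a b : ℚ} (L : Submodule ℤ (Quat a b)) : rmul L 1 = L := by
  simp [rmul]

theorem rmul_mono {a b : ℚ} {L M : Submodule ℤ (Quat a b)} (h : L ≤ M) (x : (Quat a b)ˣ) :
    rmul L x ≤ rmul M x := Submodule.map_mono h

theorem latticeNorm_rmul {a b : ℚ} (L : Submodule ℤ (Quat a b)) (x : (Quat a b)ˣ) :
    latticeNorm (rmul L x) = |nrd (x : Quat a b)| * latticeNorm L := by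
  rw [latticeNorm, latticeNorm, ← ratGcd_image_mul (nrd_unit_ne_zero x)]
  congr 1
  simp only [rmul, Submodule.map_coe, Set.image_image]
  refine Set.image_congr' fun z => ?_
  simp [nrd_mul, mul_comm]

/-- The localization `L_p = L ⊗ ℤ_p`, as a `ℤ_p`-submodule of `H_p = ℚ_p ⊗ H`. -/
def localize {a b : ℚ} (p : ℕ) [Fact p.Prime] (L : Submodule ℤ (Quat a b)) :
    Submodule ℤ_[p] (ℚ_[p] ⊗[ℚ] Quat a b) :=
  Submodule.span ℤ_[p] ((fun y : Quat a b => (1 : ℚ_[p]) ⊗ₜ[ℚ] y) '' (L : Set (Quat a b)))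

/-- `L` is a left `O`-ideal: a lattice in `H` such that for every prime `p` one has
`L_p = O_p x_p` for some `x_p` in `H_pˣ`. -/
def IsLeftIdeal {a b : ℚ} (O : Subalgebra ℤ (Quat a b)) (L : Submodule ℤ (Quat a b)) : Prop :=
  L.IsLattice ℚ ∧
    ∀ (p : ℕ) [Fact p.Prime], ∃ x : (ℚ_[p] ⊗[ℚ] Quat a b)ˣ,
      (localize p L : Set (ℚ_[p] ⊗[ℚ] Quat a b)) =
        (fun z => z * (x : ℚ_[p] ⊗[ℚ] Quat a b)) '' (localize p (Subalgebra.toSubmodule O))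

theorem localize_rmul {a b : ℚ} (p : ℕ) [Fact p.Prime] (L : Submodule ℤ (Quat a b))
    (x : (Quat a b)ˣ) :
    (localize p (rmul L x) : Set (ℚ_[p] ⊗[ℚ] Quat a b)) =
      (fun z => z * ((1 : ℚ_[p]) ⊗ₜ[ℚ] (x : Quat a b))) '' (localize p L) := by
  let f : (ℚ_[p] ⊗[ℚ] Quat a b) →ₗ[ℤ_[p]] (ℚ_[p] ⊗[ℚ] Quat a b) :=
    (LinearMap.mulRight ℚ_[p] ((1 : ℚ_[p]) ⊗ₜ[ℚ] (x : Quat a b))).restrictScalars ℤ_[p]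
  have : localize p (rmul L x) = (localize p L).map f := by
    rw [localize, localize, Submodule.map_span, rmul, Submodule.map_coe, Set.image_image,
      Set.image_image]
    congr 1
    refine Set.image_congr' fun z => ?_
    simp [f]
  rw [this]; rfl

theorem IsLeftIdeal.rmul {a b : ℚ} {O : Subalgebra ℤ (Quat a b)} {L : Submodule ℤ (Quat a b)}
    (h : IsLeftIdeal O L) (x : (Quat a b)ˣ) : IsLeftIdeal O (rmul L x) := by
  refine ⟨⟨h.1.fg.map _, ?_⟩, fun p _ => ?_⟩
  · have h1 : Submodule.span ℚ ((QuatTheta.rmul L x : Submodule ℤ (Quat a b)) : Set (Quat a b))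
        = (Submodule.span ℚ (L : Set (Quat a b))).map (LinearMap.mulRight ℚ (x : Quat a b)) := by
      rw [Submodule.map_span]; rfl
    rw [h1, h.1.span_eq_top, Submodule.map_top, LinearMap.range_eq_top]
    intro y
    exact ⟨y * (x⁻¹ : (Quat a b)ˣ), by simp [mul_assoc]⟩
  · obtain ⟨y, hy⟩ := h.2 p
    refine ⟨y * Units.map (Algebra.TensorProduct.includeRight :
      Quat a b →ₐ[ℚ] ℚ_[p] ⊗[ℚ] Quat a b).toMonoidHom x, ?_⟩
    rw [localize_rmul, hy, Set.image_image]
    refine Set.image_congr' fun z => ?_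
    simp [mul_assoc]

/-- The set of left `O`-ideals. -/
def LeftIdeal {a b : ℚ} (O : Subalgebra ℤ (Quat a b)) : Type :=
  {L : Submodule ℤ (Quat a b) // IsLeftIdeal O L}

/-- The ideal `𝔞 x`. -/
def LeftIdeal.rmul {a b : ℚ} {O : Subalgebra ℤ (Quat a b)} (𝔞 : LeftIdeal O) (x : (Quat a b)ˣ) :
    LeftIdeal O := ⟨QuatTheta.rmul 𝔞.1 x, 𝔞.2.rmul x⟩

theorem LeftIdeal.rmul_rmul {a b : ℚ} {O : Subalgebra ℤ (Quat a b)} (𝔞 : LeftIdeal O)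
    (x y : (Quat a b)ˣ) : (𝔞.rmul x).rmul y = 𝔞.rmul (x * y) :=
  Subtype.ext (QuatTheta.rmul_rmul _ _ _)

theorem LeftIdeal.rmul_one {a b : ℚ} {O : Subalgebra ℤ (Quat a b)} (𝔞 : LeftIdeal O) :
    𝔞.rmul 1 = 𝔞 := Subtype.ext (QuatTheta.rmul_one _)

/-- Two left ideals are in the same class if they differ by right multiplication by a unit
of `H`. -/
instance idealSetoid {a b : ℚ} (O : Subalgebra ℤ (Quat a b)) : Setoid (LeftIdeal O) where
  r 𝔞 𝔟 := ∃ x : (Quat a b)ˣ, 𝔞.rmul x = 𝔟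
  iseqv :=
    { refl := fun 𝔞 => ⟨1, 𝔞.rmul_one⟩
      symm := by
        rintro 𝔞 _ ⟨x, rfl⟩
        exact ⟨x⁻¹, by rw [LeftIdeal.rmul_rmul, mul_inv_cancel, LeftIdeal.rmul_one]⟩
      trans := by
        rintro 𝔞 _ _ ⟨x, rfl⟩ ⟨y, rfl⟩
        exact ⟨x * y, by rw [LeftIdeal.rmul_rmul]⟩ }

/-- The set of left `O`-ideal classes. -/
def ClassSet {a b : ℚ} (O : Subalgebra ℤ (Quat a b)) : Type := Quotient (idealSetoid O)

/-- The class `[𝔞]`. -/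
def cls {a b : ℚ} {O : Subalgebra ℤ (Quat a b)} (𝔞 : LeftIdeal O) : ClassSet O :=
  Quotient.mk (idealSetoid O) 𝔞

/-- `½ #{x ∈ Hˣ : 𝔞 x = 𝔟}`. -/
def idealPairing {a b : ℚ} {O : Subalgebra ℤ (Quat a b)} (𝔞 𝔟 : LeftIdeal O) : ℝ :=
  (Nat.card {x : (Quat a b)ˣ // 𝔞.rmul x = 𝔟} : ℝ) / 2

/-- The height pairing `⟨[𝔞], [𝔟]⟩ = ½ #{x ∈ Hˣ : 𝔞 x = 𝔟}` of two classes. -/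
def classPairing {a b : ℚ} {O : Subalgebra ℤ (Quat a b)} (c d : ClassSet O) : ℝ :=
  Quotient.liftOn₂ c d idealPairing (by
    rintro 𝔞 𝔟 _ _ ⟨u, rfl⟩ ⟨v, rfl⟩
    refine congrArg (fun n : ℕ => (n : ℝ) / 2) (Nat.card_congr ?_)
    refine
      { toFun := fun x => ⟨u⁻¹ * x.1 * v, ?_⟩
        invFun := fun x => ⟨u * x.1 * v⁻¹, ?_⟩
        left_inv := fun x => Subtype.ext (by group)
        right_inv := fun x => Subtype.ext (by group) }
    · have h := congrArg (fun 𝔠 => LeftIdeal.rmul 𝔠 v) x.2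
      simp only [LeftIdeal.rmul_rmul] at h ⊢
      rw [← h]
      congr 1
      group
    · have h := congrArg (fun 𝔠 => LeftIdeal.rmul 𝔠 v⁻¹) x.2
      simp only [LeftIdeal.rmul_rmul, mul_inv_cancel, LeftIdeal.rmul_one] at h
      exact h)

/-- `M(O)`, the free `ℤ`-module on the set of left ideal classes. -/
abbrev M {a b : ℚ} (O : Subalgebra ℤ (Quat a b)) : Type := ClassSet O →₀ ℤ

/-- `M_ℝ(O) = M(O) ⊗ ℝ`. -/
abbrev MR {a b : ℚ} (O : Subalgebra ℤ (Quat a b)) : Type := ClassSet O →₀ ℝ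

/-- The inclusion of `M(O)` in `M_ℝ(O)`. -/
def toMR {a b : ℚ} {O : Subalgebra ℤ (Quat a b)} (w : M O) : MR O :=
  w.mapRange (fun k : ℤ => (k : ℝ)) Int.cast_zero

/-- The height pairing, extended bilinearly to `M_ℝ(O)`. -/
def pairing {a b : ℚ} {O : Subalgebra ℤ (Quat a b)} (v w : MR O) : ℝ :=
  v.sum fun c r => w.sum fun d s => r * s * classPairing c d

/-- The dual lattice `M^∨(O) = {v ∈ M_ℝ(O) : ⟨v, M(O)⟩ ⊆ ℤ}`. -/
def Mdual {a b : ℚ} (O : Subalgebra ℤ (Quat a b)) : Set (MR O) :=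
  {v | ∀ w : M O, ∃ k : ℤ, pairing v (toMR w) = k}

/-- The linear map `deg : M_ℝ(O) → ℝ` with `deg [𝔞] = 1`. -/
def deg {a b : ℚ} {O : Subalgebra ℤ (Quat a b)} (v : MR O) : ℝ := v.sum fun _ r => r

/-- `T_m(𝔞) = {𝔟 ∈ I(O) : 𝔟 ⊆ 𝔞, N 𝔟 = m N 𝔞}`. -/
def heckeSet {a b : ℚ} {O : Subalgebra ℤ (Quat a b)} (m : ℕ) (𝔞 : LeftIdeal O) :
    Set (LeftIdeal O) :=
  {𝔟 | 𝔟.1 ≤ 𝔞.1 ∧ latticeNorm 𝔟.1 = m * latticeNorm 𝔞.1}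

theorem rmul_mem_heckeSet {a b : ℚ} {O : Subalgebra ℤ (Quat a b)} {m : ℕ} {𝔞 𝔟 : LeftIdeal O}
    (h : 𝔟 ∈ heckeSet m 𝔞) (x : (Quat a b)ˣ) : 𝔟.rmul x ∈ heckeSet m (𝔞.rmul x) := by
  refine ⟨rmul_mono h.1 x, ?_⟩
  simp only [LeftIdeal.rmul, latticeNorm_rmul, h.2]
  ring

/-- `t_m [𝔞] = ∑_{𝔟 ∈ T_m(𝔞)} [𝔟]`, with coefficients in `R` (`R = ℤ` for `M(O)` and `R = ℝ` for
`M_ℝ(O)`). In a definite algebra `T_m(𝔞)` is a finite set for `m ≥ 1`. -/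
def heckeClass {a b : ℚ} {O : Subalgebra ℤ (Quat a b)} (R : Type) [CommRing R] (m : ℕ)
    (c : ClassSet O) : ClassSet O →₀ R :=
  Quotient.liftOn c
    (fun 𝔞 => ∑ᶠ 𝔟 ∈ heckeSet m 𝔞, (Finsupp.single (cls 𝔟) 1 : ClassSet O →₀ R)) (by
    rintro 𝔞 _ ⟨u, rfl⟩
    refine finsum_mem_eq_of_bijOn (fun 𝔟 => 𝔟.rmul u) ⟨?_, ?_, ?_⟩ ?_
    · exact fun 𝔟 h => rmul_mem_heckeSet h u
    · intro 𝔟 _ 𝔠 _ h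
      have h := congrArg (fun 𝔡 => LeftIdeal.rmul 𝔡 u⁻¹) h
      simpa only [LeftIdeal.rmul_rmul, mul_inv_cancel, LeftIdeal.rmul_one] using h
    · intro 𝔟 h
      refine ⟨𝔟.rmul u⁻¹, ?_, ?_⟩
      · have := rmul_mem_heckeSet h u⁻¹
        simpa only [LeftIdeal.rmul_rmul, mul_inv_cancel, LeftIdeal.rmul_one] using this
      · simp only [LeftIdeal.rmul_rmul, inv_mul_cancel, LeftIdeal.rmul_one]
    · intro 𝔟 _
      have : cls 𝔟 = cls (𝔟.rmul u) := Quotient.sound ⟨u, rfl⟩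
      rw [this])

/-- The Hecke operator `t_m` (`m ≥ 1`) on `M(O)` (`R = ℤ`) and on `M_ℝ(O)` (`R = ℝ`). -/
def hecke {a b : ℚ} {O : Subalgebra ℤ (Quat a b)} (R : Type) [CommRing R] (m : ℕ) :
    (ClassSet O →₀ R) →ₗ[R] (ClassSet O →₀ R) :=
  Finsupp.linearCombination R (heckeClass R m)

/-- The `m`-th coefficient of `φ(v, w)`: it is `⟨v, t_m w⟩` for `m ≥ 1`, and `deg v · deg w / 2`
for `m = 0`. -/
def phiCoeff {a b : ℚ} {O : Subalgebra ℤ (Quat a b)} (v : MR O) (w : M O) (m : ℕ) : ℝ :=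
  if m = 0 then deg v * deg (toMR w) / 2 else pairing v (toMR (hecke ℤ m w))

/-- `q ^ r = exp (2 π i r τ)`. -/
def qPow (r : ℚ) (τ : UpperHalfPlane) : ℂ :=
  Complex.exp (2 * Real.pi * Complex.I * (r : ℂ) * (τ : ℂ))

/-- `φ(v, w) = ∑_{m ≥ 0} ⟨v, t_m w⟩ q ^ m`, as a function on the upper half plane. -/
def phi {a b : ℚ} {O : Subalgebra ℤ (Quat a b)} (v : MR O) (w : M O) (τ : UpperHalfPlane) : ℂ :=
  ∑' m : ℕ, (phiCoeff v w m : ℂ) * qPow m τ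

/-- The inverse lattice `L⁻¹ = {x ∈ H : L x L ⊆ L}`. -/
def invLattice {a b : ℚ} (L : Submodule ℤ (Quat a b)) : Submodule ℤ (Quat a b) where
  carrier := {x | ∀ y ∈ L, ∀ z ∈ L, y * x * z ∈ L}
  add_mem' := by
    intro x x' h h' y hy z hz
    have := L.add_mem (h y hy z hz) (h' y hy z hz)
    simpa only [mul_add, add_mul] using this
  zero_mem' := by intro y _ z _; simp
  smul_mem' := by
    intro n x h y hy z hz
    have := L.smul_mem n (h y hy z hz)
    simpa only [mul_smul_comm, smul_mul_assoc] using this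

/-- The theta series `∑_{x ∈ L} q ^ (N x / N L)` of a lattice `L`. -/
def theta {a b : ℚ} (L : Submodule ℤ (Quat a b)) (τ : UpperHalfPlane) : ℂ :=
  ∑' x : L, qPow (nrd (x : Quat a b) / latticeNorm L) τ

/-- The dual `O^♯ = {x ∈ H : tr (x O) ⊆ ℤ}` of a lattice for the trace form. -/
def dualLattice {a b : ℚ} (L : Submodule ℤ (Quat a b)) : Submodule ℤ (Quat a b) where
  carrier := {x | ∀ y ∈ L, ∃ k : ℤ, trd (x * y) = k}
  add_mem' := by
    intro x x' h h' y hy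
    obtain ⟨k, hk⟩ := h y hy
    obtain ⟨k', hk'⟩ := h' y hy
    refine ⟨k + k', ?_⟩
    rw [Int.cast_add, ← hk, ← hk']
    simp [trd, add_mul]; ring
  zero_mem' := fun y _ => ⟨0, by simp [trd]⟩
  smul_mem' := by
    intro n x h y hy
    obtain ⟨k, hk⟩ := h y hy
    refine ⟨n * k, ?_⟩
    rw [Int.cast_mul, ← hk]
    simp [trd]; ring

/-- The level `N(O) = N(O^♯)⁻¹`. -/
def level {a b : ℚ} (O : Subalgebra ℤ (Quat a b)) : ℚ :=
  (latticeNorm (dualLattice (Subalgebra.toSubmodule O)))⁻¹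

/-- `e` is a `ℤ`-basis of the lattice `L`. -/
def IsLatticeBasis {a b : ℚ} (L : Submodule ℤ (Quat a b)) (e : Fin 4 → Quat a b) : Prop :=
  LinearIndependent ℤ e ∧ Submodule.span ℤ (Set.range e) = L

/-- The determinant of the quadratic form `x ↦ N x / N L` on `L`, that is the Gram determinant, in
any `ℤ`-basis of `L`, of the polar form `(x, y) ↦ tr (x ȳ) / N L`. -/
def latticeDet {a b : ℚ} (L : Submodule ℤ (Quat a b)) : ℚ :=
  open Classical in
  if h : ∃ e : Fin 4 → Quat a b, IsLatticeBasis L e then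
    (Matrix.of fun i j => trd (h.choose i * star (h.choose j)) / latticeNorm L).det
  else 0

/-- `disc L`, the positive square root of the determinant; for an order it is the reduced
discriminant. -/
def disc {a b : ℚ} (L : Submodule ℤ (Quat a b)) : ℝ := Real.sqrt (latticeDet L)

/-- The Hecke operator `T(n)` on weight `2` forms of level `N` with trivial character:
`f|T(n) (τ) = n ∑_{a d = n, (a, N) = 1} d⁻² ∑_{0 ≤ j < d} f ((a τ + j) / d)`. -/
def heckeT (N n : ℕ) (f : UpperHalfPlane → ℂ) (τ : UpperHalfPlane) : ℂ :=
  ∑ d ∈ n.divisors with (n / d).Coprime N, ((n : ℂ) / (d : ℂ) ^ 2) *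
    ∑ j ∈ Finset.range d, f (UpperHalfPlane.ofComplex ((((n / d : ℕ) : ℂ) * (τ : ℂ) + j) / d))

/-- The congruence subgroup `Γ₀(N)` of `SL(2, ℤ)`, inside `GL(2, ℝ)`. -/
abbrev Gamma0GL (N : ℕ) : Subgroup (GL (Fin 2) ℝ) :=
  (CongruenceSubgroup.Gamma0 N).map (Matrix.SpecialLinearGroup.mapGL ℝ)

end

end QuatTheta

open QuatTheta

/-!
For left ideals `𝔞` and `𝔟`, an ideal of the form `𝔞 x` lies in `T_m(𝔟)` exactly when `x` is an
element of norm `m` (relative to the norm of the lattice) of `𝔞⁻¹ 𝔟 = {x | 𝔞 x ⊆ 𝔟}`. Hence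
`⟨[𝔞], t_m [𝔟]⟩` is half the number of such elements (`pairingL_hecke_single`), and
`φ([𝔞], [𝔟])` is half the theta series of `𝔞⁻¹ 𝔟` (`phi_single`). Three facts remain: theta series
of this kind are modular, the operators `t_n` multiply like the classical Hecke operators, and a
`q`-expansion determines its coefficients.

*Modularity.* Poisson summation expresses a quaternary theta series near a cusp `a / c` through the
dual form, with coefficients that are sums over `(ℤ/c)⁴` (`thetaSeries_smul`); in particular it is
bounded at every cusp. If `c = p` is a prime not dividing the level, completing the square
reduces these sums to the Gauss sum of the form modulo `p` (`cuspGauss_eq`). This Gauss sum is `p ^ 2`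
because the form has an isotropic plane modulo `p` (`gaussSum_of_isotropic`): Chevalley–Warning gives
an isotropic vector `x`, and `R x` is an isotropic plane when `R` is the right order of `𝔞`
(`exists_isotropic_plane`). Comparing the expansions at two cusps yields the transformation law for
the matrices of `Γ₀(N)` whose lower right entry is prime, and translations together with Dirichlet's
theorem reach all of `Γ₀(N)` (`thetaSeries_smul_Gamma0`).

*Local structure.* A left ideal is given over `ℚ_p`, but only finitely many digits of its local
generators matter, so that they can be taken in `H` and `ℤ_p`-lattices can be replaced by lattices over
the rationals that are integral at `p` (`isLeftIdeal_iff`). Every `𝔞⁻¹ 𝔟` is then locally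
`y⁻¹ O_p z`, which determines its norm and shows that its level divides that of `O` (`hasLevel`).

*Hecke relations.* Let `p` be a prime not dividing the level. For `x ∈ 𝔞` outside `p 𝔞` with norm
divisible by `p`, the ideal `O x + p 𝔞` is the only member of `T_p(𝔞)` containing `x`
(`neighbor_spec`, `eq_neighbor`). Counting isotropic vectors modulo `p` gives `p + 1` members
(`card_heckeFinset_prime`), and splitting the ideals of `T_{p^(k+2)}(𝔞)` according to whether they are
contained in `p 𝔞` gives the recursion for `t_{p^k}` (`hecke_prime_pow`). With multiplicativity for
coprime indices, `t_m t_n = ∑ d t_{mn/d²}`, the sum over `d ∣ (m, n)`, whenever `n` is prime to the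
level (`hecke_mul`); this is the rule by which `T(n)` acts on coefficients (`hasSum_heckeT`).
The numbers prime to the discriminant are prime to the level because every prime factor of the level
divides the discriminant (`exists_level_disc`).

*Eigenvectors.* The height pairing is positive definite, so the coefficient `⟨v, v⟩` of `q` in
`φ(v, v)` is positive (`phi_ne_zero`).
-/

namespace QuatTheta

/-! ### Poisson summation for Gaussians in several variables -/

section Poisson

open MeasureTheory Topology

variable {ι : Type*}

variable [Fintype ι] in
/-- A product of one-variable summable bounds is summable over `ι → ℤ`. -/
theorem summable_prod_comp {u : ℤ → ℝ} (hu : Summable u) (h0 : ∀ n, 0 ≤ u n) :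
    Summable fun n : ι → ℤ => ∏ i, u (n i) := by
  classical
  refine summable_of_sum_le (c := ∏ _i : ι, ∑' n, u n)
    (fun n => Finset.prod_nonneg fun i _ => h0 _) fun s => ?_
  let t : ι → Finset ℤ := fun i => s.image fun n => n i
  have hst : s ⊆ Fintype.piFinset t := fun n hn =>
    Fintype.mem_piFinset.2 fun i => Finset.mem_image_of_mem _ hn
  calc ∑ n ∈ s, ∏ i, u (n i) ≤ ∑ n ∈ Fintype.piFinset t, ∏ i, u (n i) :=
        Finset.sum_le_sum_of_subset_of_nonneg hst fun n _ _ =>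
          Finset.prod_nonneg fun i _ => h0 _
    _ = ∏ i, ∑ n ∈ t i, u n := (Finset.prod_univ_sum t fun _ n => u n).symm
    _ ≤ ∏ _i : ι, ∑' n, u n := Finset.prod_le_prod
        (fun i _ => Finset.sum_nonneg fun n _ => h0 n)
        (fun i _ => hu.sum_le_tsum _ fun n _ => h0 n)

variable [Fintype ι] in
theorem summable_exp_neg_sq {c : ℝ} (hc : 0 < c) :
    Summable fun n : ι → ℤ => Real.exp (-c * ∑ i, (n i : ℝ) ^ 2) := by
  have h1 : Summable fun n : ℤ => Real.exp (-c * (n : ℝ) ^ 2) := by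
    have h2 : Summable fun n : ℕ => Real.exp (-c * (n : ℝ) ^ 2) := by
      refine Summable.of_nonneg_of_le (fun n => (Real.exp_pos _).le) (fun n => ?_)
        (Real.summable_exp_nat_mul_iff.2 (neg_lt_zero.2 hc))
      apply Real.exp_le_exp.2
      have : (n : ℝ) ≤ (n : ℝ) ^ 2 := by exact_mod_cast Nat.le_self_pow two_ne_zero n
      nlinarith
    refine Summable.of_nat_of_neg (by simpa using h2) (by simpa using h2)
  refine (summable_prod_comp h1 fun n => (Real.exp_pos _).le).congr fun n => ?_
  rw [← Real.exp_sum, Finset.mul_sum]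

/-- The projection `ℝ^ι → (ℝ/ℤ)^ι`. -/
def torusProj (ι : Type*) (x : ι → ℝ) : UnitAddTorus ι := fun i => (x i : UnitAddCircle)

theorem isOpenQuotientMap_torusProj : IsOpenQuotientMap (torusProj ι) :=
  IsOpenQuotientMap.piMap (f := fun _ (x : ℝ) => (x : UnitAddCircle))
    fun _ => QuotientAddGroup.isOpenQuotientMap_mk

theorem torusProj_eq_iff {x y : ι → ℝ} :
    torusProj ι x = torusProj ι y ↔ ∃ n : ι → ℤ, y = x + fun i => (n i : ℝ) := by
  constructor
  · intro h
    have h1 : ∀ i, ∃ n : ℤ, y i = x i + n := fun i => by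
      have := congrFun h i
      simp only [torusProj] at this
      rw [QuotientAddGroup.eq, AddSubgroup.mem_zmultiples_iff] at this
      obtain ⟨k, hk⟩ := this
      exact ⟨k, by simp at hk; linarith⟩
    choose n hn using h1
    exact ⟨n, funext hn⟩
  · rintro ⟨n, rfl⟩
    funext i
    simp only [torusProj, Pi.add_apply]
    rw [QuotientAddGroup.eq, AddSubgroup.mem_zmultiples_iff]
    exact ⟨n i, by simp⟩

variable [Fintype ι]

theorem mFourier_torusProj (k : ι → ℤ) (x : ι → ℝ) :
    UnitAddTorus.mFourier k (torusProj ι x) =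
      Complex.exp (2 * Real.pi * Complex.I * ∑ i, (k i : ℂ) * x i) := by
  simp only [UnitAddTorus.mFourier, torusProj, ContinuousMap.coe_mk, fourier_coe_apply]
  rw [← Complex.exp_sum, Finset.mul_sum]
  congr 1
  refine Finset.sum_congr rfl fun i _ => ?_
  push_cast
  ring

/-- An integral over the space is the sum of the integrals over the translates of the unit box. -/
theorem integral_eq_tsum_box {f : (ι → ℝ) → ℂ} (hf : Integrable f) :
    ∫ x, f x = ∑' n : ι → ℤ, ∫ x in {x : ι → ℝ | ∀ i, x i ∈ Set.Ioc (0 : ℝ) (0 + 1)},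
      f (x + fun i => (n i : ℝ)) := by
  classical
  let b := Pi.basisFun ℝ ι
  have h := ZSpan.isAddFundamentalDomain b (volume : Measure (ι → ℝ))
  have : Countable (Submodule.span ℤ (Set.range b)) := inferInstance
  have hv : VAddInvariantMeasure (Submodule.span ℤ (Set.range b)) (ι → ℝ) volume :=
    inferInstanceAs (VAddInvariantMeasure (Submodule.span ℤ (Set.range b)).toAddSubgroup _ _)
  have hm : MeasurableConstVAdd (Submodule.span ℤ (Set.range b)) (ι → ℝ) :=
    inferInstanceAs (MeasurableConstVAdd (Submodule.span ℤ (Set.range b)).toAddSubgroup _)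
  rw [h.integral_eq_tsum'' f hf]
  let e := (b.restrictScalars ℤ).equivFun.symm.toEquiv
  rw [← e.tsum_eq]
  have hset : (ZSpan.fundamentalDomain b : Set (ι → ℝ)) =ᵐ[volume]
      {x : ι → ℝ | ∀ i, x i ∈ Set.Ioc (0 : ℝ) (0 + 1)} := by
    have h1 : (ZSpan.fundamentalDomain b : Set (ι → ℝ)) =
        Set.univ.pi fun i => Set.Ico ((0 : ι → ℝ) i) ((1 : ι → ℝ) i) := by
      ext x; simp [ZSpan.mem_fundamentalDomain, b, Set.mem_pi]
    have h2 : {x : ι → ℝ | ∀ i, x i ∈ Set.Ioc (0 : ℝ) (0 + 1)} =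
        Set.univ.pi fun i => Set.Ioc ((0 : ι → ℝ) i) ((1 : ι → ℝ) i) := by
      ext x; simp [Set.mem_pi]
    rw [h1, h2]
    exact Measure.univ_pi_Ico_ae_eq_Icc.trans Measure.univ_pi_Ioc_ae_eq_Icc.symm
  refine tsum_congr fun n => ?_
  rw [setIntegral_congr_set hset]
  congr 1 with x
  congr 1
  have : ((e n : Submodule.span ℤ (Set.range b)) : ι → ℝ) = fun i => (n i : ℝ) := by
    have : e n = ∑ i, n i • b.restrictScalars ℤ i := Module.Basis.equivFun_symm_apply _ _
    rw [this]
    funext j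
    simp [b, Pi.single_apply]
  rw [Submodule.vadd_def, this, vadd_eq_add, add_comm]

/-- The Poisson summation formula on `ℤ^ι`, for a continuous integrable function whose translates
are dominated, uniformly on bounded sets, by a summable family. -/
theorem tsum_eq_tsum_fourier {f : (ι → ℝ) → ℂ} (hc : Continuous f) (hi : Integrable f)
    (hu : ∀ R : ℝ, ∃ u : (ι → ℤ) → ℝ, Summable u ∧
      ∀ x : ι → ℝ, (∀ i, |x i| ≤ R) → ∀ n : ι → ℤ, ‖f (x + fun i => (n i : ℝ))‖ ≤ u n)
    (hF : Summable fun k : ι → ℤ =>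
      ∫ x, Complex.exp (-(2 * Real.pi * Complex.I * ∑ i, (k i : ℂ) * x i)) * f x)
    (h : ι → ℝ) :
    ∑' n : ι → ℤ, f (h + fun i => (n i : ℝ)) =
      ∑' k : ι → ℤ, (∫ x, Complex.exp (-(2 * Real.pi * Complex.I * ∑ i, (k i : ℂ) * x i)) * f x)
        * Complex.exp (2 * Real.pi * Complex.I * ∑ i, (k i : ℂ) * h i) := by
  classical
  -- the periodization of `f`, which descends to a continuous function `F` on the torus
  let g : (ι → ℝ) → ℂ := fun x => ∑' n : ι → ℤ, f (x + fun i => (n i : ℝ))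
  have hg : Continuous g := by
    rw [continuous_iff_continuousAt]
    intro x
    obtain ⟨u, hus, hu⟩ := hu (‖x‖ + 1)
    have hon : ContinuousOn g (Metric.ball x 1) := by
      refine continuousOn_tsum (fun n => (hc.comp (by fun_prop)).continuousOn) hus ?_
      intro n y hy
      refine hu y (fun i => ?_) n
      have h1 : ‖y‖ ≤ ‖x‖ + 1 := by
        have := norm_le_norm_add_norm_sub' y x
        rw [Metric.mem_ball, dist_eq_norm] at hy
        linarith
      exact (norm_le_pi_norm y i).trans h1
    exact hon.continuousAt (Metric.ball_mem_nhds x one_pos)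
  have hper : ∀ x y, torusProj ι x = torusProj ι y → g x = g y := by
    intro x y hxy
    obtain ⟨m, rfl⟩ := torusProj_eq_iff.1 hxy
    simp only [g]
    rw [← (Equiv.addLeft m).tsum_eq]
    refine tsum_congr fun n => congrArg f ?_
    funext i
    simp [add_assoc]
  let pr : C(ι → ℝ, UnitAddTorus ι) := ⟨torusProj ι, isOpenQuotientMap_torusProj.continuous⟩
  have hpr : IsQuotientMap pr := isOpenQuotientMap_torusProj.isQuotientMap
  let G : C(ι → ℝ, ℂ) := ⟨g, hg⟩
  have hG : Function.FactorsThrough G pr := fun x y hxy => hper x y hxy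
  let F : C(UnitAddTorus ι, ℂ) := hpr.lift G hG
  have hFg : ∀ x, F (torusProj ι x) = g x := fun x =>
    congrFun (congrArg DFunLike.coe (hpr.lift_comp G hG)) x
  -- unfolding: the Fourier coefficients of `F` are integrals of `f` over the whole space
  have hcoef : UnitAddTorus.mFourierCoeff F = fun k : ι → ℤ =>
      ∫ x, Complex.exp (-(2 * Real.pi * Complex.I * ∑ i, (k i : ℂ) * x i)) * f x := by
    funext k
    have hexp : ∀ x : ι → ℝ, UnitAddTorus.mFourier (-k) (torusProj ι x) =
        Complex.exp (-(2 * Real.pi * Complex.I * ∑ i, (k i : ℂ) * x i)) := by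
      intro x
      rw [mFourier_torusProj]
      simp [Finset.mul_sum, Finset.sum_neg_distrib]
    have hn1 : ∀ x : ι → ℝ,
        ‖Complex.exp (-(2 * Real.pi * Complex.I * ∑ i, (k i : ℂ) * x i))‖ = 1 := by
      intro x
      rw [← hexp]
      simp only [UnitAddTorus.mFourier, ContinuousMap.coe_mk, norm_prod, fourier_apply,
        Circle.norm_coe, Finset.prod_const_one]
    have hce : Continuous fun x : ι → ℝ =>
        Complex.exp (-(2 * Real.pi * Complex.I * ∑ i, (k i : ℂ) * x i)) := by fun_prop
    have hint : Integrable fun x : ι → ℝ =>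
        Complex.exp (-(2 * Real.pi * Complex.I * ∑ i, (k i : ℂ) * x i)) * f x :=
      hi.bdd_mul (c := 1) hce.aestronglyMeasurable (Filter.Eventually.of_forall fun x => (hn1 x).le)
    rw [UnitAddTorus.mFourierCoeff_eq_integral _ _ (0 : ι → ℝ), integral_eq_tsum_box hint]
    obtain ⟨u, hus, hu⟩ := hu 1
    set S : Set (ι → ℝ) := {x | ∀ i, x i ∈ Set.Ioc (0 : ℝ) (0 + 1)} with hS
    have hSm : MeasurableSet S := by
      have : S = Set.univ.pi fun _ => Set.Ioc (0 : ℝ) (0 + 1) := by ext; simp [hS, Set.mem_pi]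
      rw [this]
      exact MeasurableSet.univ_pi fun _ => measurableSet_Ioc
    have hSv : volume S = 1 := by
      have : S = Set.univ.pi fun _ => Set.Ioc (0 : ℝ) (0 + 1) := by ext; simp [hS, Set.mem_pi]
      rw [this, Real.volume_pi_Ioc]
      simp
    have hSb : ∀ x ∈ S, ∀ n : ι → ℤ, ‖f (x + fun i => (n i : ℝ))‖ ≤ u n := by
      intro x hx n
      refine hu x (fun i => ?_) n
      have := hx i
      rw [abs_le]
      exact ⟨by linarith [this.1], by linarith [this.2]⟩
    have hstep : ∀ x : ι → ℝ, ∀ n : ι → ℤ,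
        Complex.exp (-(2 * Real.pi * Complex.I *
          ∑ i, (k i : ℂ) * ((x + fun i => (n i : ℝ)) i : ℝ))) =
        Complex.exp (-(2 * Real.pi * Complex.I * ∑ i, (k i : ℂ) * x i)) := by
      intro x n
      exact (hexp _).symm.trans
        ((congrArg _ (torusProj_eq_iff.2 ⟨n, rfl⟩).symm).trans (hexp x))
    have hfin : IsFiniteMeasure (volume.restrict S) := ⟨by simp [hSv]⟩
    refine Eq.trans ?_ (hasSum_integral_of_summable_integral_norm (μ := volume.restrict S)
      (F := fun (n : ι → ℤ) x => Complex.exp (-(2 * Real.pi * Complex.I *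
          ∑ i, (k i : ℂ) * ((x + fun i => (n i : ℝ)) i : ℝ))) * f (x + fun i => (n i : ℝ)))
      ?_ ?_).tsum_eq.symm
    · refine setIntegral_congr_fun hSm fun x _ => ?_
      have : (F fun i => (x i : UnitAddCircle)) = g x := hFg x
      rw [this, smul_eq_mul]
      have h2 : UnitAddTorus.mFourier (-k) (fun i => (x i : UnitAddCircle)) = _ := hexp x
      rw [h2]
      simp only [hstep, g]
      exact tsum_mul_left.symm
    · intro n
      exact (hint.comp_add_right (fun i => (n i : ℝ))).integrableOn
    · refine Summable.of_nonneg_of_le (fun n => integral_nonneg fun x => norm_nonneg _)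
        (fun n => ?_) hus
      calc ∫ x in S, ‖Complex.exp (-(2 * Real.pi * Complex.I *
          ∑ i, (k i : ℂ) * ((x + fun i => (n i : ℝ)) i : ℝ))) * f (x + fun i => (n i : ℝ))‖
          ≤ ∫ x in S, u n := by
            refine setIntegral_mono_on ?_ (by simp [hSv]) hSm fun x hx => ?_
            · exact (hint.comp_add_right (fun i => (n i : ℝ))).integrableOn.norm
            · rw [norm_mul, hn1, one_mul]; exact hSb x hx n
        _ = u n := by simp [Measure.real, hSv]
  have hsum := UnitAddTorus.hasSum_mFourier_series_apply_of_summable (f := F)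
    (by rw [hcoef]; exact hF) (torusProj ι h)
  rw [hFg, hcoef] at hsum
  simp only [mFourier_torusProj, smul_eq_mul] at hsum
  exact hsum.tsum_eq.symm

/-- A nondegenerate sum of squares of linear forms dominates a multiple of `∑ xᵢ²`. -/
theorem exists_mul_sum_sq_le [DecidableEq ι] {P : Matrix ι ι ℝ} (hP : P.det ≠ 0) :
    ∃ ε : ℝ, 0 < ε ∧ ∀ x : ι → ℝ, ε * ∑ i, x i ^ 2 ≤ ∑ i, (P.mulVec x i) ^ 2 := by
  set C := ∑ i, ∑ j, (P⁻¹ i j) ^ 2 with hC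
  have hC0 : 0 ≤ C := Finset.sum_nonneg fun i _ => Finset.sum_nonneg fun j _ => sq_nonneg _
  refine ⟨(C + 1)⁻¹, by positivity, fun x => ?_⟩
  have hx : x = P⁻¹.mulVec (P.mulVec x) := by
    rw [Matrix.mulVec_mulVec, Matrix.nonsing_inv_mul _ (isUnit_iff_ne_zero.2 hP),
      Matrix.one_mulVec]
  have h1 : ∑ i, x i ^ 2 ≤ C * ∑ i, (P.mulVec x i) ^ 2 := by
    conv_lhs => rw [hx]
    rw [hC, Finset.sum_mul]
    refine Finset.sum_le_sum fun i _ => ?_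
    exact Finset.sum_mul_sq_le_sq_mul_sq _ _ _
  have h0 : 0 ≤ ∑ i, (P.mulVec x i) ^ 2 := Finset.sum_nonneg fun i _ => sq_nonneg _
  rw [inv_mul_le_iff₀ (by positivity)]
  linarith

/-- The Fourier transform of the Gaussian `exp (-π t |P x|²)`. -/
theorem fourier_gaussian_matrix [DecidableEq ι] {P : Matrix ι ι ℝ} (hP : P.det ≠ 0) {t : ℂ}
    (ht : 0 < t.re) (k : ι → ℝ) :
    ∫ x : ι → ℝ, Complex.exp (-(2 * Real.pi * Complex.I * ∑ i, (k i : ℂ) * x i)) *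
        Complex.exp (-Real.pi * t * ((∑ i, (P.mulVec x i) ^ 2 : ℝ) : ℂ)) =
      (|P.det|⁻¹ : ℝ) * ((1 / t) ^ (Fintype.card ι / 2 : ℂ) *
        Complex.exp (-Real.pi * ((∑ i, (Matrix.vecMul k P⁻¹ i) ^ 2 : ℝ) : ℂ) / t)) := by
  set l := Matrix.vecMul k P⁻¹ with hl
  let G : (ι → ℝ) → ℂ := fun y =>
    Complex.exp (-(Real.pi * t) * ∑ i, (y i : ℂ) ^ 2 + ∑ i, (-(2 * Real.pi * Complex.I * l i)) * y i)
  -- in the variable `y = P x` the integrand is a product of Gaussians of one variable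
  have h1 : ∀ x : ι → ℝ, Complex.exp (-(2 * Real.pi * Complex.I * ∑ i, (k i : ℂ) * x i)) *
      Complex.exp (-Real.pi * t * ((∑ i, (P.mulVec x i) ^ 2 : ℝ) : ℂ)) =
      G (Matrix.toLin' P x) := by
    intro x
    have h2 : ∑ i, k i * x i = ∑ i, l i * P.mulVec x i := by
      have : k ⬝ᵥ x = l ⬝ᵥ P.mulVec x := by
        rw [hl, Matrix.dotProduct_mulVec, Matrix.vecMul_vecMul,
          Matrix.nonsing_inv_mul _ (isUnit_iff_ne_zero.2 hP), Matrix.vecMul_one]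
      exact this
    have h3 : ∑ i, (k i : ℂ) * x i = ∑ i, (l i : ℂ) * (P.mulVec x i : ℝ) := by
      exact_mod_cast congrArg (fun r : ℝ => (r : ℂ)) h2
    rw [h3, ← Complex.exp_add]
    simp only [G, Matrix.toLin'_apply]
    congr 1
    rw [add_comm]
    push_cast
    congr 1
    · ring
    · rw [Finset.mul_sum, ← Finset.sum_neg_distrib]
      exact Finset.sum_congr rfl fun i _ => by ring
  simp_rw [h1]
  have hmap := Real.map_matrix_volume_pi_eq_smul_volume_pi hP
  have hem : MeasurableEmbedding (Matrix.toLin' P) :=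
    ((Matrix.toLin' P).continuous_of_finiteDimensional.measurableEmbedding
      (Matrix.mulVec_injective_of_isUnit
        ((Matrix.isUnit_iff_isUnit_det _).2 (isUnit_iff_ne_zero.2 hP))))
  rw [← hem.integral_map G, hmap, integral_smul_measure, abs_inv,
    ENNReal.toReal_ofReal (by positivity)]
  rw [Complex.real_smul]
  congr 1
  have hb : 0 < (Real.pi * t : ℂ).re := by
    simpa using mul_pos Real.pi_pos ht
  have ht0 : t ≠ 0 := by rintro rfl; simp at ht
  have hpi : (Real.pi : ℂ) ≠ 0 := by exact_mod_cast Real.pi_ne_zero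
  simp only [G]
  rw [GaussianFourier.integral_cexp_neg_mul_sum_add hb]
  congr 2
  · field_simp
  · have : ∀ i, (-(2 * Real.pi * Complex.I * l i)) ^ 2 = -(4 * Real.pi ^ 2 * (l i : ℂ) ^ 2) := by
      intro i
      have : (-(2 * Real.pi * Complex.I * (l i : ℂ))) ^ 2
        = 4 * Real.pi ^ 2 * (l i : ℂ) ^ 2 * Complex.I ^ 2 := by ring
      rw [this, Complex.I_sq]; ring
    simp only [this]
    push_cast
    rw [Finset.sum_neg_distrib, ← Finset.mul_sum]
    field_simp

/-- Poisson summation for the Gaussian `exp (-π t |P x|²)` on `ℝ⁴`. -/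
theorem tsum_gaussian_matrix {P : Matrix (Fin 4) (Fin 4) ℝ} (hP : P.det ≠ 0) {t : ℂ}
    (ht : 0 < t.re) (h : Fin 4 → ℝ) :
    ∑' n : Fin 4 → ℤ, Complex.exp (-Real.pi * t *
        ((∑ i, (P.mulVec (h + fun i => (n i : ℝ)) i) ^ 2 : ℝ) : ℂ)) =
      (|P.det|⁻¹ : ℝ) * (1 / t) ^ 2 * ∑' k : Fin 4 → ℤ,
        Complex.exp (-Real.pi * ((∑ i, (Matrix.vecMul (fun i => (k i : ℝ)) P⁻¹ i) ^ 2 : ℝ) : ℂ) / t)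
          * Complex.exp (2 * Real.pi * Complex.I * ∑ i, (k i : ℂ) * h i) := by
  obtain ⟨ε, hε, hq⟩ := exists_mul_sum_sq_le hP
  have hpi := Real.pi_pos
  have hnorm : ∀ x : Fin 4 → ℝ, ‖Complex.exp (-Real.pi * t *
      ((∑ i, (P.mulVec x i) ^ 2 : ℝ) : ℂ))‖ ≤ Real.exp (-(Real.pi * t.re * ε) * ∑ i, x i ^ 2) := by
    intro x
    rw [Complex.norm_exp]
    apply Real.exp_le_exp.2
    have : (-Real.pi * t * ((∑ i, (P.mulVec x i) ^ 2 : ℝ) : ℂ)).re =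
        -(Real.pi * t.re * ∑ i, (P.mulVec x i) ^ 2) := by
      rw [Complex.re_mul_ofReal]
      simp
    rw [this]
    have := mul_le_mul_of_nonneg_left (hq x) (mul_pos hpi ht).le
    nlinarith
  set c := Real.pi * t.re * ε with hc
  have hc0 : 0 < c := by positivity
  have hcont : Continuous fun x : Fin 4 → ℝ => Complex.exp (-Real.pi * t *
      ((∑ i, (P.mulVec x i) ^ 2 : ℝ) : ℂ)) := by
    have : Continuous fun x : Fin 4 → ℝ => P.mulVec x := by fun_prop
    fun_prop
  have hint : Integrable fun x : Fin 4 → ℝ => Complex.exp (-Real.pi * t *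
      ((∑ i, (P.mulVec x i) ^ 2 : ℝ) : ℂ)) := by
    have h1 := (GaussianFourier.integrable_cexp_neg_mul_sum_add (ι := Fin 4) (b := (c : ℂ))
      (by simpa using hc0) 0).norm
    refine h1.mono' hcont.aestronglyMeasurable (Filter.Eventually.of_forall fun x => ?_)
    refine (hnorm x).trans (le_of_eq ?_)
    rw [Complex.norm_exp]
    congr 1
    simp [← Complex.ofReal_pow, ← Complex.ofReal_sum]
  have hFT := fun k : Fin 4 → ℤ => fourier_gaussian_matrix hP ht (fun i => (k i : ℝ))
  simp only [Complex.ofReal_intCast] at hFT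
  have h14 : ((1 / t : ℂ) ^ ((Fintype.card (Fin 4) : ℂ) / 2)) = (1 / t) ^ 2 := by
    have : ((Fintype.card (Fin 4) : ℂ) / 2) = ((2 : ℕ) : ℂ) := by norm_num
    rw [this, Complex.cpow_natCast]
  rw [tsum_eq_tsum_fourier hcont hint ?_ ?_ h]
  · simp only [hFT, h14]
    rw [← tsum_mul_left]
    exact tsum_congr fun k => by ring
  · intro R
    refine ⟨fun n => Real.exp (c * (4 * R ^ 2)) * Real.exp (-(c / 2) * ∑ i, (n i : ℝ) ^ 2),
      (summable_exp_neg_sq (by positivity)).mul_left _, fun x hx n => (hnorm _).trans ?_⟩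
    simp only [← Real.exp_add]
    apply Real.exp_le_exp.2
    have h2 : ∀ i, (n i : ℝ) ^ 2 / 2 - R ^ 2 ≤ (x i + n i) ^ 2 := by
      intro i
      have : x i ^ 2 ≤ R ^ 2 := sq_le_sq' (abs_le.1 (hx i)).1 (abs_le.1 (hx i)).2
      nlinarith [sq_nonneg (2 * x i + n i)]
    have h3 := Finset.sum_le_sum fun i (_ : i ∈ Finset.univ) => h2 i
    rw [Finset.sum_sub_distrib, ← Finset.sum_div] at h3
    simp only [Finset.sum_const, Finset.card_univ, Fintype.card_fin, nsmul_eq_mul,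
      Nat.cast_ofNat] at h3
    have h4 := mul_le_mul_of_nonneg_left h3 hc0.le
    simp only [Pi.add_apply]
    linarith
  · simp only [hFT]
    refine Summable.mul_left _ (Summable.mul_left _ ?_)
    have hP' : (P⁻¹.transpose).det ≠ 0 := by
      rw [Matrix.det_transpose, Matrix.det_nonsing_inv]
      simpa using hP
    obtain ⟨δ, hδ, hq'⟩ := exists_mul_sum_sq_le hP'
    have ht' : 0 < (1 / t).re := by
      have ht0 : t ≠ 0 := by rintro rfl; simp at ht
      rw [one_div, Complex.inv_re]
      exact div_pos ht (Complex.normSq_pos.2 ht0)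
    have h5 : 0 < Real.pi * (1 / t).re * δ := by positivity
    refine Summable.of_norm_bounded (summable_exp_neg_sq h5) fun k => ?_
    rw [Complex.norm_exp]
    apply Real.exp_le_exp.2
    have : (-Real.pi * ((∑ i, (Matrix.vecMul (fun i => (k i : ℝ)) P⁻¹ i) ^ 2 : ℝ) : ℂ) / t).re =
        -(Real.pi * (1 / t).re * ∑ i, (Matrix.vecMul (fun i => (k i : ℝ)) P⁻¹ i) ^ 2) := by
      rw [show (-Real.pi * ((∑ i, (Matrix.vecMul (fun i => (k i : ℝ)) P⁻¹ i) ^ 2 : ℝ) : ℂ) / t)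
        = ((-(Real.pi * ∑ i, (Matrix.vecMul (fun i => (k i : ℝ)) P⁻¹ i) ^ 2) : ℝ) : ℂ) * (1 / t) by
          push_cast; ring, Complex.re_ofReal_mul]
      ring
    rw [this]
    have h6 := hq' (fun i => (k i : ℝ))
    rw [Matrix.mulVec_transpose] at h6
    have := mul_le_mul_of_nonneg_left h6 (mul_pos hpi ht').le
    nlinarith

end Poisson

/-! ### Theta series of quaternary quadratic forms -/

section ThetaSeries

open Matrix

/-- The quadratic form `v ↦ vᵀ q v`. -/
def qform {R : Type*} [CommRing R] (q : Matrix (Fin 4) (Fin 4) R) (v : Fin 4 → R) : R :=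
  v ⬝ᵥ q *ᵥ v

theorem qform_add {R : Type*} [CommRing R] (q : Matrix (Fin 4) (Fin 4) R) (v w : Fin 4 → R) :
    qform q (v + w) = qform q v + qform q w + v ⬝ᵥ (q + qᵀ) *ᵥ w := by
  have : w ⬝ᵥ q *ᵥ v = v ⬝ᵥ qᵀ *ᵥ w := by
    rw [dotProduct_mulVec, ← mulVec_transpose, dotProduct_comm]
  simp only [qform, mulVec_add, add_dotProduct, dotProduct_add, add_mulVec, this]
  ring

theorem qform_smul {R : Type*} [CommRing R] (q : Matrix (Fin 4) (Fin 4) R) (c : R)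
    (v : Fin 4 → R) : qform q (c • v) = c ^ 2 * qform q v := by
  simp only [qform, mulVec_smul, smul_dotProduct, dotProduct_smul, smul_eq_mul]
  ring

theorem qform_map {R S : Type*} [CommRing R] [CommRing S] (f : R →+* S)
    (q : Matrix (Fin 4) (Fin 4) R) (v : Fin 4 → R) :
    qform (q.map f) (fun i => f (v i)) = f (qform q v) := by
  simp [qform, dotProduct, mulVec, map_sum, map_mul]

/-- The theta series `∑ exp (2 π i Q(n) z)` of an integral quaternary form. -/
noncomputable def thetaSeries (q : Matrix (Fin 4) (Fin 4) ℤ) (z : ℂ) : ℂ :=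
  ∑' n : Fin 4 → ℤ, Complex.exp (2 * Real.pi * Complex.I * ((qform q n : ℤ) : ℂ) * z)

/-- The dual form `k ↦ ½ kᵀ A⁻¹ k`, where `A = Pᵀ P`. -/
noncomputable def dualForm (P : Matrix (Fin 4) (Fin 4) ℝ) (k : Fin 4 → ℤ) : ℝ :=
  (∑ i, ((fun i => (k i : ℝ)) ᵥ* P⁻¹) i ^ 2) / 2

variable {q : Matrix (Fin 4) (Fin 4) ℤ} {P : Matrix (Fin 4) (Fin 4) ℝ}

theorem two_mul_qform (hA : Pᵀ * P = (q + qᵀ).map fun k : ℤ => (k : ℝ)) (n : Fin 4 → ℤ) :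
    2 * ((qform q n : ℤ) : ℝ) = ∑ i, (P *ᵥ fun i => (n i : ℝ)) i ^ 2 := by
  have h1 : ∑ i, (P *ᵥ fun i => (n i : ℝ)) i ^ 2 =
      (fun i => (n i : ℝ)) ⬝ᵥ (Pᵀ * P) *ᵥ fun i => (n i : ℝ) := by
    rw [← mulVec_mulVec, dotProduct_mulVec, vecMul_transpose, dotProduct]
    exact Finset.sum_congr rfl fun i _ => sq _
  have h2 := qform_map (Int.castRingHom ℝ) (q + qᵀ) n
  have h3 : qform (q + qᵀ) n = 2 * qform q n := by
    have : n ⬝ᵥ qᵀ *ᵥ n = n ⬝ᵥ q *ᵥ n := by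
      rw [dotProduct_mulVec, vecMul_transpose, dotProduct_comm]
    simp only [qform, add_mulVec, dotProduct_add, this]
    ring
  rw [h3] at h2
  rw [h1, hA]
  simpa [qform] using h2.symm

theorem exists_mul_sum_sq_le_qform (hP : P.det ≠ 0)
    (hA : Pᵀ * P = (q + qᵀ).map fun k : ℤ => (k : ℝ)) :
    ∃ ε : ℝ, 0 < ε ∧ ∀ n : Fin 4 → ℤ, ε * ∑ i, (n i : ℝ) ^ 2 ≤ ((qform q n : ℤ) : ℝ) := by
  obtain ⟨ε, hε, h⟩ := exists_mul_sum_sq_le hP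
  refine ⟨ε / 2, by positivity, fun n => ?_⟩
  have := h fun i => (n i : ℝ)
  rw [← two_mul_qform hA] at this
  linarith

theorem exists_mul_sum_sq_le_dualForm (hP : P.det ≠ 0) :
    ∃ ε : ℝ, 0 < ε ∧ ∀ n : Fin 4 → ℤ, ε * ∑ i, (n i : ℝ) ^ 2 ≤ dualForm P n := by
  have hP' : (P⁻¹.transpose).det ≠ 0 := by
    rw [Matrix.det_transpose, Matrix.det_nonsing_inv]
    simpa using hP
  obtain ⟨ε, hε, h⟩ := exists_mul_sum_sq_le hP'
  refine ⟨ε / 2, by positivity, fun n => ?_⟩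
  have := h fun i => (n i : ℝ)
  rw [Matrix.mulVec_transpose] at this
  rw [dualForm]
  linarith

theorem norm_exp_mul_ofReal (r : ℝ) (z : ℂ) :
    ‖Complex.exp (2 * Real.pi * Complex.I * (r : ℂ) * z)‖ =
      Real.exp (-(2 * Real.pi * r * z.im)) := by
  rw [Complex.norm_exp]
  congr 1
  rw [show (2 * Real.pi * Complex.I * (r : ℂ) * z) = ((2 * Real.pi * r : ℝ) : ℂ) * (Complex.I * z)
    by push_cast; ring, Complex.re_ofReal_mul, Complex.I_mul_re]
  ring

/-- On a half plane `y ≤ Im z`, a series `∑ exp (2 π i Q(n) z)` with `Q ≥ ε ∑ nᵢ²` is dominated by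
a convergent series of constants. -/
theorem norm_exp_le_of_le_im {Q : (Fin 4 → ℤ) → ℝ} {ε : ℝ} (hε : 0 < ε)
    (hQ : ∀ n : Fin 4 → ℤ, ε * ∑ i, (n i : ℝ) ^ 2 ≤ Q n) {y : ℝ} (hy : 0 < y) (z : ℂ)
    (hz : y ≤ z.im) (n : Fin 4 → ℤ) :
    ‖Complex.exp (2 * Real.pi * Complex.I * (Q n : ℂ) * z)‖ ≤
      Real.exp (-(2 * Real.pi * ε * y) * ∑ i, (n i : ℝ) ^ 2) := by
  rw [norm_exp_mul_ofReal]
  apply Real.exp_le_exp.2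
  have hs : 0 ≤ ∑ i, (n i : ℝ) ^ 2 := Finset.sum_nonneg fun i _ => sq_nonneg _
  have h1 : ε * (∑ i, (n i : ℝ) ^ 2) * y ≤ Q n * z.im :=
    mul_le_mul (hQ n) hz hy.le ((mul_nonneg hε.le hs).trans (hQ n))
  have := mul_le_mul_of_nonneg_left h1 (by positivity : (0 : ℝ) ≤ 2 * Real.pi)
  linarith

theorem summable_norm_exp_form {Q : (Fin 4 → ℤ) → ℝ} {ε : ℝ} (hε : 0 < ε)
    (hQ : ∀ n : Fin 4 → ℤ, ε * ∑ i, (n i : ℝ) ^ 2 ≤ Q n) {z : ℂ} (hz : 0 < z.im) :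
    Summable fun n => ‖Complex.exp (2 * Real.pi * Complex.I * (Q n : ℂ) * z)‖ :=
  Summable.of_nonneg_of_le (fun _ => norm_nonneg _)
    (fun n => norm_exp_le_of_le_im hε hQ hz z le_rfl n)
    (summable_exp_neg_sq (by have := Real.pi_pos; positivity))

theorem summable_thetaSeries (hP : P.det ≠ 0)
    (hA : Pᵀ * P = (q + qᵀ).map fun k : ℤ => (k : ℝ)) {z : ℂ} (hz : 0 < z.im) :
    Summable fun n : Fin 4 → ℤ =>
      Complex.exp (2 * Real.pi * Complex.I * ((qform q n : ℤ) : ℂ) * z) := by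
  obtain ⟨ε, hε, h⟩ := exists_mul_sum_sq_le_qform hP hA
  have := (summable_norm_exp_form hε h hz).of_norm
  simpa using this

theorem differentiableOn_thetaSeries (hP : P.det ≠ 0)
    (hA : Pᵀ * P = (q + qᵀ).map fun k : ℤ => (k : ℝ)) :
    DifferentiableOn ℂ (thetaSeries q) {z | 0 < z.im} := by
  obtain ⟨ε, hε, h⟩ := exists_mul_sum_sq_le_qform hP hA
  intro z hz
  have hz' : 0 < z.im / 2 := half_pos hz
  have hopen : IsOpen {w : ℂ | z.im / 2 < w.im} := isOpen_lt continuous_const Complex.continuous_im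
  have hd : DifferentiableOn ℂ (thetaSeries q) {w : ℂ | z.im / 2 < w.im} := by
    refine Complex.differentiableOn_tsum_of_summable_norm
      (u := fun n : Fin 4 → ℤ => Real.exp (-(2 * Real.pi * ε * (z.im / 2)) * ∑ i, (n i : ℝ) ^ 2))
      (summable_exp_neg_sq (by have := Real.pi_pos; positivity)) (fun n => by fun_prop) hopen ?_
    intro n w hw
    have := norm_exp_le_of_le_im hε h hz' w (le_of_lt hw) n
    simpa using this
  exact (hd.differentiableAt (hopen.mem_nhds (by simpa using hz))).differentiableWithinAt

/-- The coefficient sums occurring in the expansion of a theta series at a cusp. -/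
noncomputable def cuspGauss (q : Matrix (Fin 4) (Fin 4) ℤ) (P : Matrix (Fin 4) (Fin 4) ℝ)
    (a d : ℤ) (c : ℕ) (k : Fin 4 → ℤ) : ℂ :=
  ∑ g : Fin 4 → Fin c, Complex.exp (2 * Real.pi * Complex.I *
    ((a * qform q (fun i => ((g i : ℕ) : ℤ)) + ∑ i, k i * ((g i : ℕ) : ℤ) : ℤ) +
      d * dualForm P k) / c)

theorem norm_cuspGauss_le (a d : ℤ) (c : ℕ) (k : Fin 4 → ℤ) :
    ‖cuspGauss q P a d c k‖ ≤ (c : ℝ) ^ 4 := by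
  refine (norm_sum_le _ _).trans ?_
  have : ∀ g : Fin 4 → Fin c, ‖Complex.exp (2 * Real.pi * Complex.I *
    ((a * qform q (fun i => ((g i : ℕ) : ℤ)) + ∑ i, k i * ((g i : ℕ) : ℤ) : ℤ) +
      d * dualForm P k) / c)‖ = 1 := by
    intro g
    rw [show (2 * Real.pi * Complex.I *
      ((a * qform q (fun i => ((g i : ℕ) : ℤ)) + ∑ i, k i * ((g i : ℕ) : ℤ) : ℤ) +
      d * dualForm P k) / c) = ((2 * Real.pi *
      ((a * qform q (fun i => ((g i : ℕ) : ℤ)) + ∑ i, k i * ((g i : ℕ) : ℤ) : ℤ) +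
      d * dualForm P k) / c : ℝ) : ℂ) * Complex.I by push_cast; ring, Complex.norm_exp_ofReal_mul_I]
  simp only [this, Finset.sum_const, Finset.card_univ, Fintype.card_fun, Fintype.card_fin,
    nsmul_eq_mul, mul_one, Nat.cast_pow, le_refl]

/-- The equivalence `ℤ⁴ ≃ (ℤ/c)⁴ × ℤ⁴`, `c m + g ↔ (g, m)`. -/
def residueEquiv (c : ℕ) [NeZero c] : (Fin 4 → ℤ) ≃ (Fin 4 → Fin c) × (Fin 4 → ℤ) :=
  (((Equiv.refl (Fin 4)).arrowCongr (Int.divModEquiv c)).trans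
    (Equiv.arrowProdEquivProdArrow (Fin 4) (fun _ => ℤ) (fun _ => Fin c))).trans (Equiv.prodComm _ _)

theorem residueEquiv_symm_apply (c : ℕ) [NeZero c] (g : Fin 4 → Fin c) (m : Fin 4 → ℤ) :
    (residueEquiv c).symm (g, m) = (fun i => ((g i : ℕ) : ℤ)) + (c : ℤ) • m := by
  funext i
  simp [residueEquiv, Equiv.arrowProdEquivProdArrow, Equiv.arrowCongr]
  ring

/-- The expansion of a theta series at the cusp `a / c`, `c > 0`. -/
theorem thetaSeries_smul (hP : P.det ≠ 0)
    (hA : Pᵀ * P = (q + qᵀ).map fun k : ℤ => (k : ℝ)) {a b d : ℤ} {c : ℕ} (hc : 0 < c)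
    (had : a * d - b * c = 1) {z : ℂ} (hz : 0 < z.im) :
    thetaSeries q ((a * z + b) / (c * z + d)) =
      -(|P.det|⁻¹ : ℝ) * (z + d / c) ^ 2 * ∑' k : Fin 4 → ℤ,
        Complex.exp (2 * Real.pi * Complex.I * (dualForm P k : ℂ) * z) *
          cuspGauss q P a d c k := by
  have : NeZero c := ⟨hc.ne'⟩
  have hc0 : (c : ℂ) ≠ 0 := by exact_mod_cast hc.ne'
  set w : ℂ := z + d / c with hw
  have hwim : w.im = z.im := by
    have : (d / c : ℂ) = ((d / c : ℝ) : ℂ) := by push_cast; rfl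
    rw [hw, Complex.add_im, this, Complex.ofReal_im, add_zero]
  have hw0 : w ≠ 0 := by
    rintro h; rw [h] at hwim; simp at hwim; linarith
  have hcw : (c * z + d : ℂ) = c * w := by rw [hw]; field_simp
  -- `g z = a / c - 1 / (c ² w)`: on a residue class only the second term varies, and it is inverted
  -- by Poisson summation
  have hmob : ((a * z + b) / (c * z + d) : ℂ) = a / c - 1 / (c ^ 2 * w) := by
    rw [hcw]
    have hz' : z = w - d / c := by rw [hw]; ring
    have had' : (a * d - b * c : ℂ) = 1 := by exact_mod_cast had
    rw [hz']
    field_simp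
    linear_combination -had'
  have hmobim : 0 < ((a * z + b) / (c * z + d) : ℂ).im := by
    rw [hmob]
    have h1 : (a / c : ℂ) = ((a / c : ℝ) : ℂ) := by push_cast; rfl
    have h2 : (1 / (c ^ 2 * w) : ℂ) = ((1 / c ^ 2 : ℝ) : ℂ) * w⁻¹ := by
      push_cast; field_simp
    rw [h1, h2, Complex.sub_im, Complex.ofReal_im, Complex.im_ofReal_mul, Complex.inv_im, hwim]
    have h3 : 0 < Complex.normSq w := Complex.normSq_pos.2 hw0
    have h4 : (0 : ℝ) < c := by exact_mod_cast hc
    have : 0 < 1 / (c : ℝ) ^ 2 * (z.im / Complex.normSq w) := by positivity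
    rw [neg_div]; linarith
  set t : ℂ := Complex.I / w with ht
  have ht0 : 0 < t.re := by
    have : t.re = w.im / Complex.normSq w := by
      rw [ht, Complex.div_re]; simp
    rw [this, hwim]
    exact div_pos hz (Complex.normSq_pos.2 hw0)
  -- split the sum according to residues modulo `c`
  have hs := (residueEquiv c).symm.summable_iff.2 (summable_thetaSeries hP hA hmobim)
  have hs' := hs.tsum_prod
  simp only [Function.comp_apply] at hs'
  rw [(residueEquiv c).symm.tsum_eq fun n : Fin 4 → ℤ =>
    Complex.exp (2 * Real.pi * Complex.I * ((qform q n : ℤ) : ℂ) *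
      ((a * z + b) / (c * z + d)))] at hs'
  rw [thetaSeries, hs', tsum_fintype]
  have hterm : ∀ (g : Fin 4 → Fin c) (m : Fin 4 → ℤ),
      Complex.exp (2 * Real.pi * Complex.I * ((qform q ((residueEquiv c).symm (g, m)) : ℤ) : ℂ) *
        ((a * z + b) / (c * z + d))) =
      Complex.exp (2 * Real.pi * Complex.I * (a * qform q (fun i => ((g i : ℕ) : ℤ)) : ℤ) / c) *
      Complex.exp (-Real.pi * t * ((∑ i, (P.mulVec ((fun i => ((g i : ℕ) : ℝ) / c) +
        fun i => (m i : ℝ)) i) ^ 2 : ℝ) : ℂ)) := by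
    intro g m
    rw [residueEquiv_symm_apply]
    set n : Fin 4 → ℤ := (fun i => ((g i : ℕ) : ℤ)) + (c : ℤ) • m with hn
    have h1 : ∑ i, (P.mulVec ((fun i => ((g i : ℕ) : ℝ) / c) + fun i => (m i : ℝ)) i) ^ 2 =
        2 * ((qform q n : ℤ) : ℝ) / c ^ 2 := by
      rw [two_mul_qform hA]
      have : (fun i => ((n i : ℤ) : ℝ)) =
          (c : ℝ) • ((fun i => ((g i : ℕ) : ℝ) / c) + fun i => (m i : ℝ)) := by
        funext i
        have hc1 : (c : ℝ) ≠ 0 := by exact_mod_cast hc.ne'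
        simp [hn]
        field_simp
      rw [this, mulVec_smul]
      have hc1 : (c : ℝ) ≠ 0 := by exact_mod_cast hc.ne'
      simp only [Pi.smul_apply, smul_eq_mul, mul_pow, ← Finset.mul_sum]
      field_simp
    obtain ⟨r, hr⟩ : ∃ r : ℤ, qform q n = qform q (fun i => ((g i : ℕ) : ℤ)) + c * r := by
      rw [hn, qform_add, qform_smul, mulVec_smul, dotProduct_smul]
      exact ⟨c * qform q m + (fun i => ((g i : ℕ) : ℤ)) ⬝ᵥ (q + qᵀ) *ᵥ m, by
        simp only [smul_eq_mul]; ring⟩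
    rw [h1, ← Complex.exp_add, Complex.exp_eq_exp_iff_exists_int]
    refine ⟨a * r, ?_⟩
    rw [hmob, ht]
    have hr' : ((qform q n : ℤ) : ℂ) = ((qform q (fun i => ((g i : ℕ) : ℤ)) : ℤ) : ℂ) + c * r := by exact_mod_cast hr
    push_cast
    rw [hr']
    field_simp
    ring
  simp only [hterm, tsum_mul_left]
  have hmain : ∀ g : Fin 4 → Fin c, ∑' m : Fin 4 → ℤ,
      Complex.exp (-Real.pi * t * ((∑ i, (P.mulVec ((fun i => ((g i : ℕ) : ℝ) / c) +
        fun i => (m i : ℝ)) i) ^ 2 : ℝ) : ℂ)) =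
      -(|P.det|⁻¹ : ℝ) * w ^ 2 * ∑' k : Fin 4 → ℤ,
        Complex.exp (2 * Real.pi * Complex.I * (dualForm P k : ℂ) * w) *
          Complex.exp (2 * Real.pi * Complex.I * ∑ i, (k i : ℂ) * (((g i : ℕ) : ℝ) / c : ℝ)) := by
    intro g
    rw [tsum_gaussian_matrix hP ht0]
    have h1 : (1 / t) ^ 2 = -w ^ 2 := by
      rw [ht]; field_simp; rw [Complex.I_sq]; ring
    rw [h1]
    have h2 : ∀ k : Fin 4 → ℤ, -Real.pi *
        ((∑ i, (Matrix.vecMul (fun i => (k i : ℝ)) P⁻¹ i) ^ 2 : ℝ) : ℂ) / t =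
        2 * Real.pi * Complex.I * (dualForm P k : ℂ) * w := by
      intro k
      rw [ht, dualForm]
      push_cast
      field_simp
      rw [Complex.I_sq]
      ring
    simp only [h2]
    ring
  simp only [hmain]
  rw [← Finset.sum_congr rfl fun g _ => (mul_left_comm _ _ _).symm, ← Finset.mul_sum]
  congr 1
  -- absolute convergence, to interchange the sum over residues with the sum over the dual lattice
  have hsd : ∀ g : Fin 4 → Fin c, Summable fun k : Fin 4 → ℤ =>
      Complex.exp (2 * Real.pi * Complex.I * (a * qform q (fun i => ((g i : ℕ) : ℤ)) : ℤ) / c) *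
      (Complex.exp (2 * Real.pi * Complex.I * (dualForm P k : ℂ) * w) *
          Complex.exp (2 * Real.pi * Complex.I * ∑ i, (k i : ℂ) * (((g i : ℕ) : ℝ) / c : ℝ))) := by
    intro g
    refine Summable.mul_left _ ?_
    obtain ⟨ε, hε, h⟩ := exists_mul_sum_sq_le_dualForm hP
    refine Summable.of_norm ((summable_norm_exp_form hε h (hwim ▸ hz)).congr fun k => ?_)
    rw [norm_mul]
    have : (2 * Real.pi * Complex.I * ∑ i, (k i : ℂ) * (((g i : ℕ) : ℝ) / c : ℝ)) =
        ((2 * Real.pi * ∑ i, (k i : ℝ) * (((g i : ℕ) : ℝ) / c) : ℝ) : ℂ) * Complex.I := by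
      push_cast; ring
    rw [this, Complex.norm_exp_ofReal_mul_I, mul_one]
  simp only [← tsum_mul_left]
  rw [← Summable.tsum_finsetSum fun g _ => hsd g]
  refine tsum_congr fun k => ?_
  rw [cuspGauss, Finset.mul_sum]
  refine Finset.sum_congr rfl fun g _ => ?_
  rw [← Complex.exp_add, ← Complex.exp_add, ← Complex.exp_add]
  congr 1
  rw [hw]
  push_cast
  simp only [← mul_div_assoc, ← Finset.sum_div]
  field_simp
  ring

end ThetaSeries

/-! ### Modularity of quaternary theta series -/

section Modularity

open Matrix UpperHalfPlane
open scoped MatrixGroups ModularForm Manifold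

variable {q : Matrix (Fin 4) (Fin 4) ℤ} {P : Matrix (Fin 4) (Fin 4) ℝ} {N : ℕ}

/-- The integral quadratic form `q` has level dividing `N`: with `A = q + qᵀ`, the matrix `N A⁻¹`
is integral with even diagonal. The vector `κ` is `N A⁻¹ k`. -/
def HasLevel (q : Matrix (Fin 4) (Fin 4) ℤ) (N : ℕ) : Prop :=
  ∀ k : Fin 4 → ℤ, ∃ κ : Fin 4 → ℤ, (q + qᵀ) *ᵥ κ = (N : ℤ) • k ∧ (N : ℤ) ∣ qform q κ

/-- The Gauss sums of `q` at the primes not dividing `N` have the value of the split form. -/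
def HasSplitGaussSums (q : Matrix (Fin 4) (Fin 4) ℤ) (N : ℕ) : Prop :=
  ∀ (p : ℕ) [Fact p.Prime], ¬ p ∣ N → ∀ a : ZMod p, a ≠ 0 →
    ∑ x : Fin 4 → ZMod p, ZMod.stdAddChar (a * qform (q.map fun k : ℤ => (k : ZMod p)) x)
      = (p : ℂ) ^ 2

theorem dualForm_eq (hP : P.det ≠ 0) (hA : Pᵀ * P = (q + qᵀ).map fun k : ℤ => (k : ℝ))
    (hN : 0 < N) {k κ : Fin 4 → ℤ} (h : (q + qᵀ) *ᵥ κ = (N : ℤ) • k) :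
    (N : ℝ) ^ 2 * dualForm P k = ((qform q κ : ℤ) : ℝ) := by
  have hN0 : (N : ℝ) ≠ 0 := by exact_mod_cast hN.ne'
  have h1 : (Pᵀ * P) *ᵥ (fun i => (κ i : ℝ)) = (N : ℝ) • fun i => (k i : ℝ) := by
    rw [hA]
    funext i
    have := congrFun h i
    simp only [mulVec, dotProduct, Pi.smul_apply, smul_eq_mul, Matrix.map_apply] at this ⊢
    exact_mod_cast this
  have h2 : (N : ℝ) • ((fun i => (k i : ℝ)) ᵥ* P⁻¹) = P *ᵥ fun i => (κ i : ℝ) := by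
    rw [← smul_vecMul, ← h1, ← mulVec_mulVec, mulVec_transpose, vecMul_vecMul,
      mul_nonsing_inv _ (isUnit_iff_ne_zero.2 hP), vecMul_one]
  have h3 := two_mul_qform hA κ
  rw [← h2] at h3
  simp only [Pi.smul_apply, smul_eq_mul, mul_pow, ← Finset.mul_sum] at h3
  rw [dualForm]
  linarith

/-- At the cusps of prime denominator `p ∤ N`, completing the square shows that all the
coefficient sums equal the Gauss sum of the form. -/
theorem cuspGauss_eq (hP : P.det ≠ 0) (hA : Pᵀ * P = (q + qᵀ).map fun k : ℤ => (k : ℝ))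
    (hN : 0 < N) (hl : HasLevel q N) (hG : HasSplitGaussSums q N) {a b d : ℤ} {p : ℕ}
    [hp : Fact p.Prime] (hpN : ¬ p ∣ N) (had : a * d - b * p = 1) (hd : (N : ℤ) ∣ d)
    (k : Fin 4 → ℤ) : cuspGauss q P a d p k = (p : ℂ) ^ 2 := by
  obtain ⟨κ, hκ, s, hs⟩ := hl k
  obtain ⟨d', rfl⟩ := hd
  have hdual : (((N : ℤ) * d' : ℤ) : ℂ) * (dualForm P k : ℂ) = ((d' * s : ℤ) : ℂ) := by
    have h1 := dualForm_eq hP hA hN hκ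
    have hN0 : (N : ℝ) ≠ 0 := by exact_mod_cast hN.ne'
    rw [hs] at h1
    push_cast at h1
    have h2 : (N : ℝ) * dualForm P k = s := by
      apply mul_left_cancel₀ hN0
      linarith
    have h3 : ((N : ℝ) * d') * dualForm P k = d' * s := by rw [← h2]; ring
    exact_mod_cast congrArg (fun r : ℝ => (r : ℂ)) h3
  have ha : (a : ZMod p) ≠ 0 := by
    intro h
    have := congrArg (fun r : ℤ => (r : ZMod p)) had
    simp [h] at this
  let qp : Matrix (Fin 4) (Fin 4) (ZMod p) := q.map fun k : ℤ => (k : ZMod p)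
  let v : Fin 4 → ZMod p := fun i => ((d' * κ i : ℤ) : ZMod p)
  -- `p` divides `a d - 1`, so the exponent is `a Q(g + d N⁻¹ κ)` modulo `p`
  have hterm : ∀ g : Fin 4 → Fin p, Complex.exp (2 * Real.pi * Complex.I *
      ((a * qform q (fun i => ((g i : ℕ) : ℤ)) + ∑ i, k i * ((g i : ℕ) : ℤ) : ℤ) +
      ((N : ℤ) * d' : ℤ) * dualForm P k) / p) =
      ZMod.stdAddChar ((a : ZMod p) * qform qp ((fun i => ((g i : ℕ) : ZMod p)) + v)) := by
    intro g
    set n : Fin 4 → ℤ := fun i => ((g i : ℕ) : ℤ) with hn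
    rw [hdual, ← Int.cast_add, ← ZMod.stdAddChar_coe]
    congr 1
    have h1 : qform qp ((fun i => ((g i : ℕ) : ZMod p)) + v) =
        ((qform q (n + d' • κ) : ℤ) : ZMod p) := by
      rw [← eq_intCast (Int.castRingHom (ZMod p)), ← qform_map]
      congr 1
      funext i
      simp [hn, v]
    rw [h1, qform_add, qform_smul, mulVec_smul, hκ, dotProduct_smul, dotProduct_smul, hs]
    have h2 : n ⬝ᵥ k = ∑ i, k i * ((g i : ℕ) : ℤ) := by
      simp [dotProduct, hn, mul_comm]
    rw [h2]
    have h3 := congrArg (fun r : ℤ => (r : ZMod p)) had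
    simp only [smul_eq_mul]
    push_cast at h3 ⊢
    rw [CharP.cast_eq_zero (ZMod p) p, mul_zero, sub_zero] at h3
    generalize (∑ i, (k i : ZMod p) * ((g i : ℕ) : ZMod p)) = t
    linear_combination (-t - d' * s) * h3
  have hbij : Function.Bijective
      fun (g : Fin 4 → Fin p) => (fun i => ((g i : ℕ) : ZMod p)) + v := by
    rw [Fintype.bijective_iff_injective_and_card]
    constructor
    · intro g g' h
      funext i
      have h1 := congrFun (add_right_cancel h) i
      rw [ZMod.natCast_eq_natCast_iff, Nat.ModEq, Nat.mod_eq_of_lt (g i).2,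
        Nat.mod_eq_of_lt (g' i).2] at h1
      exact Fin.ext h1
    · simp [ZMod.card]
  rw [cuspGauss, Finset.sum_congr rfl fun g _ => hterm g,
    Fintype.sum_bijective _ hbij _
      (fun x => ZMod.stdAddChar ((a : ZMod p) * qform qp x)) fun g => rfl]
  exact hG p hpN _ ha

/-- The transformation of a theta series under matrices of `Γ₀(N)` with prime lower right
entry: the expansions at `b / d` and at `0` differ only by the automorphy factor. -/
theorem thetaSeries_smul_of_prime (hP : P.det ≠ 0)
    (hA : Pᵀ * P = (q + qᵀ).map fun k : ℤ => (k : ℝ))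
    (hN : 0 < N) (hl : HasLevel q N) (hG : HasSplitGaussSums q N) {a b c : ℤ} {p : ℕ}
    [hp : Fact p.Prime] (had : a * p - b * c = 1) (hc : (N : ℤ) ∣ c) {z : ℂ} (hz : 0 < z.im) :
    thetaSeries q ((a * z + b) / (c * z + p)) = (c * z + p) ^ 2 * thetaSeries q z := by
  have hpN : ¬ p ∣ N := by
    intro h
    have h1 : (p : ℤ) ∣ c := (Int.natCast_dvd_natCast.2 h).trans hc
    have h2 : (p : ℤ) ∣ 1 := by
      rw [← had]; exact dvd_sub (dvd_mul_left _ _) (h1.mul_left _)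
    exact hp.out.one_lt.ne' (by simpa using Int.natAbs_dvd_natAbs.2 h2)
  have hz0 : z ≠ 0 := by rintro rfl; simp at hz
  have hp0 : (p : ℂ) ≠ 0 := by exact_mod_cast hp.out.ne_zero
  set w : ℂ := -1 / z with hw
  have hw0 : w ≠ 0 := by rw [hw]; exact div_ne_zero (by simp) hz0
  have hwim : 0 < w.im := by
    rw [hw, Complex.div_im]
    simp only [Complex.neg_im, Complex.one_im, Complex.neg_re, Complex.one_re]
    have := Complex.normSq_pos.2 hz0
    have : 0 < z.im / Complex.normSq z := by positivity
    simp only [neg_zero, zero_mul, zero_div, zero_sub, neg_mul, one_mul, neg_div, neg_neg]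
    exact this
  -- compare the two expansions in `w = -1 / z`: both have constant coefficient sums
  have h1 := thetaSeries_smul hP hA (a := b) (b := -a) (d := -c) hp.out.pos
    (by linarith) hwim
  have h2 := thetaSeries_smul hP hA (a := 0) (b := -1) (d := 0) (c := 1) one_pos (by norm_num) hwim
  have hG0 : ∀ k, cuspGauss q P 0 0 1 k = 1 := by
    intro k
    simp only [cuspGauss]
    rw [Fintype.sum_subsingleton _ (0 : Fin 4 → Fin 1)]
    simp
  simp only [hG0, mul_one] at h2
  simp only [cuspGauss_eq hP hA hN hl hG hpN (show b * -c - (-a) * p = 1 by linarith)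
    (hc.neg_right)] at h1
  rw [tsum_mul_right] at h1
  have e1 : ((b * w + (-a : ℤ)) / (p * w + (-c : ℤ)) : ℂ) = (a * z + b) / (c * z + p) := by
    rw [hw]
    push_cast
    have : (b * (-1 / z) + -a : ℂ) = -(a * z + b) / z := by field_simp; ring
    rw [this, show (p * (-1 / z) + -c : ℂ) = -(c * z + p) / z by field_simp; ring]
    rw [div_div_div_cancel_right₀ hz0, neg_div_neg_eq]
  have e2 : (((0 : ℤ) * w + ((-1 : ℤ) : ℂ)) / ((1 : ℕ) * w + ((0 : ℤ) : ℂ)) : ℂ) = z := by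
    rw [hw]; push_cast; field_simp; ring
  rw [e1] at h1
  rw [e2] at h2
  rw [h1, h2, hw]
  push_cast
  field_simp
  ring

theorem thetaSeries_add_int (z : ℂ) (m : ℤ) : thetaSeries q (z + m) = thetaSeries q z := by
  refine tsum_congr fun n => ?_
  rw [Complex.exp_eq_exp_iff_exists_int]
  exact ⟨qform q n * m, by push_cast; ring⟩

/-- The transformation law under `Γ₀(N)`, by translation to a prime lower right entry. -/
theorem thetaSeries_smul_Gamma0 (hP : P.det ≠ 0)
    (hA : Pᵀ * P = (q + qᵀ).map fun k : ℤ => (k : ℝ))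
    (hN : 0 < N) (hl : HasLevel q N) (hG : HasSplitGaussSums q N) {a b c d : ℤ}
    (had : a * d - b * c = 1) (hc : (N : ℤ) ∣ c) {z : ℂ} (hz : 0 < z.im) :
    thetaSeries q ((a * z + b) / (c * z + d)) = (c * z + d) ^ 2 * thetaSeries q z := by
  rcases eq_or_ne c 0 with rfl | hc0
  · have h1 : a * d = 1 := by linarith
    rcases Int.mul_eq_one_iff_eq_one_or_neg_one.1 h1 with ⟨rfl, rfl⟩ | ⟨rfl, rfl⟩
    · have := thetaSeries_add_int (q := q) z b
      simpa using this
    · have := thetaSeries_add_int (q := q) z (-b)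
      have e : ((-1 : ℤ) * z + b) / ((0 : ℤ) * z + (-1 : ℤ)) = z + (-b : ℤ) := by
        push_cast; ring
      rw [e, this]
      push_cast; ring
  · -- translate so that the lower right entry becomes a prime number
    have hcop : IsCoprime d c := ⟨a, -b, by linarith⟩
    have hu : IsUnit ((d : ℤ) : ZMod c.natAbs) := by
      rw [ZMod.coe_int_isUnit_iff_isCoprime, Int.isCoprime_iff_gcd_eq_one, Int.gcd_eq_natAbs,
        Int.natAbs_natCast]
      exact Int.isCoprime_iff_gcd_eq_one.1 hcop.symm
    have : NeZero c.natAbs := ⟨Int.natAbs_ne_zero.2 hc0⟩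
    obtain ⟨p, -, hp, hpd⟩ := Nat.forall_exists_prime_gt_and_eq_mod hu 0
    have := Fact.mk hp
    have hdvd : c ∣ p - d := by
      have h1 : ((p : ℤ) : ZMod c.natAbs) = ((d : ℤ) : ZMod c.natAbs) := by exact_mod_cast hpd
      have h2 := (ZMod.intCast_eq_intCast_iff_dvd_sub _ _ _).1 h1
      rw [Int.natAbs_dvd] at h2
      have h3 := h2.neg_right
      rwa [neg_sub] at h3
    obtain ⟨m, hm⟩ := hdvd
    have hz' : 0 < (z - m).im := by simpa using hz
    have h := thetaSeries_smul_of_prime hP hA hN hl hG (a := a) (b := b + a * m) (c := c) (p := p)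
      (by rw [show (p : ℤ) = d + c * m by linarith]; linarith) hc hz'
    have hpc : (p : ℂ) = d + c * m := by
      have : (p : ℤ) = d + c * m := by linarith
      exact_mod_cast congrArg (fun r : ℤ => (r : ℂ)) this
    have h0 := thetaSeries_add_int (q := q) (z - m) m
    rw [sub_add_cancel] at h0
    rw [← h0, hpc] at h
    rw [show (c * (z - m) + (d + c * m) : ℂ) = c * z + d by ring] at h
    rw [← h]
    congr 2
    push_cast; ring

/-- The expansions of a theta series at the cusps are bounded. -/
theorem exists_norm_thetaSeries_smul_le (hP : P.det ≠ 0)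
    (hA : Pᵀ * P = (q + qᵀ).map fun k : ℤ => (k : ℝ)) {a b d : ℤ} {c : ℕ} (hc : 0 < c)
    (had : a * d - b * c = 1) :
    ∃ B : ℝ, ∀ z : ℂ, 1 ≤ z.im →
      ‖thetaSeries q ((a * z + b) / (c * z + d)) * ((c * z + d) ^ 2)⁻¹‖ ≤ B := by
  obtain ⟨ε, hε, h⟩ := exists_mul_sum_sq_le_dualForm hP
  have hsum : Summable fun n : Fin 4 → ℤ =>
      Real.exp (-(2 * Real.pi * ε * 1) * ∑ i, (n i : ℝ) ^ 2) * (c : ℝ) ^ 4 :=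
    (summable_exp_neg_sq (by have := Real.pi_pos; positivity)).mul_right _
  refine ⟨|P.det|⁻¹ * ((c : ℝ) ^ 2)⁻¹ * ∑' n : Fin 4 → ℤ,
    Real.exp (-(2 * Real.pi * ε * 1) * ∑ i, (n i : ℝ) ^ 2) * (c : ℝ) ^ 4, fun z hz => ?_⟩
  have hz0 : 0 < z.im := by linarith
  have hc0 : (c : ℂ) ≠ 0 := by exact_mod_cast hc.ne'
  have hne : (c * z + d : ℂ) ≠ 0 := by
    intro h0
    have := congrArg Complex.im h0
    simp at this
    rcases this with h | h
    · exact hc.ne' h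
    · linarith
  rw [thetaSeries_smul hP hA hc had hz0]
  have e : (z + d / c : ℂ) = (c * z + d) * (c : ℂ)⁻¹ := by field_simp
  rw [e, mul_pow]
  have : -(|P.det|⁻¹ : ℝ) * ((c * z + d) ^ 2 * ((c : ℂ)⁻¹) ^ 2) * (∑' k : Fin 4 → ℤ,
        Complex.exp (2 * Real.pi * Complex.I * (dualForm P k : ℂ) * z) *
          cuspGauss q P a d c k) * ((c * z + d) ^ 2)⁻¹ =
      -(|P.det|⁻¹ : ℝ) * ((c : ℂ)⁻¹) ^ 2 * ∑' k : Fin 4 → ℤ,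
        Complex.exp (2 * Real.pi * Complex.I * (dualForm P k : ℂ) * z) *
          cuspGauss q P a d c k := by
    field_simp
  rw [this, norm_mul, norm_mul]
  refine mul_le_mul (le_of_eq ?_) ?_ (norm_nonneg _) (by positivity)
  · simp
  · refine tsum_of_norm_bounded hsum.hasSum fun k => ?_
    rw [norm_mul]
    exact mul_le_mul (norm_exp_le_of_le_im hε h one_pos z hz k) (norm_cuspGauss_le _ _ _ _)
      (norm_nonneg _) (Real.exp_pos _).le

theorem isBoundedAtImInfty_thetaSeries (hP : P.det ≠ 0)
    (hA : Pᵀ * P = (q + qᵀ).map fun k : ℤ => (k : ℝ)) :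
    ∃ B : ℝ, ∀ z : ℂ, 1 ≤ z.im → ‖thetaSeries q z‖ ≤ B := by
  obtain ⟨ε, hε, h⟩ := exists_mul_sum_sq_le_qform hP hA
  have hsum : Summable fun n : Fin 4 → ℤ =>
      Real.exp (-(2 * Real.pi * ε * 1) * ∑ i, (n i : ℝ) ^ 2) :=
    summable_exp_neg_sq (by have := Real.pi_pos; positivity)
  refine ⟨_, fun z hz => tsum_of_norm_bounded hsum.hasSum fun k => ?_⟩
  have := norm_exp_le_of_le_im hε h one_pos z hz k
  simpa using this

/-- A positive definite integral quaternary form of level dividing `N`, all of whose Gauss sums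
prime to `N` are those of the split form, has a theta series that is a modular form of weight `2`
for `Γ₀(N)`. -/
theorem exists_modularForm_thetaSeries (hP : P.det ≠ 0)
    (hA : Pᵀ * P = (q + qᵀ).map fun k : ℤ => (k : ℝ))
    (hN : 0 < N) (hl : HasLevel q N) (hG : HasSplitGaussSums q N) :
    ∃ f : ModularForm (Gamma0GL N) 2, ∀ τ : ℍ, f τ = thetaSeries q τ := by
  have hcoe : ∀ (γ : SL(2, ℤ)) (τ : ℍ), ((γ • τ : ℍ) : ℂ) =
      (γ 0 0 * τ + γ 0 1) / (γ 1 0 * τ + γ 1 1) := by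
    intro γ τ
    rw [coe_specialLinearGroup_apply]
    simp
  have hdet : ∀ γ : SL(2, ℤ), γ 0 0 * γ 1 1 - γ 0 1 * γ 1 0 = 1 := by
    intro γ
    rw [← Matrix.det_fin_two]; exact γ.2
  let F : ℍ → ℂ := fun τ => thetaSeries q τ
  have hslash : ∀ (γ : SL(2, ℤ)) (τ : ℍ), (F ∣[(2 : ℤ)] γ) τ =
      thetaSeries q ((γ 0 0 * τ + γ 0 1) / (γ 1 0 * τ + γ 1 1)) *
        ((γ 1 0 * τ + γ 1 1 : ℂ) ^ 2)⁻¹ := by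
    intro γ τ
    rw [ModularForm.SL_slash_apply]
    simp only [F, hcoe]
    rfl
  refine ⟨⟨⟨F, ?_⟩, ?_, ?_⟩, fun τ => rfl⟩
  · rintro _ ⟨γ, hγ, rfl⟩
    change F ∣[(2 : ℤ)] γ = F
    funext τ
    rw [hslash]
    have hc : (N : ℤ) ∣ γ 1 0 := by
      have := CongruenceSubgroup.Gamma0_mem.1 hγ
      exact (ZMod.intCast_zmod_eq_zero_iff_dvd _ _).1 this
    rw [thetaSeries_smul_Gamma0 hP hA hN hl hG (hdet γ) hc τ.im_pos]
    have hne : (γ 1 0 * τ + γ 1 1 : ℂ) ≠ 0 := by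
      have := denom_ne_zero γ τ
      exact this
    field_simp
    rfl
  · rw [UpperHalfPlane.mdifferentiable_iff]
    refine (differentiableOn_thetaSeries hP hA).congr fun z hz => ?_
    simp only [Function.comp_apply, SlashInvariantForm.coe_mk, F]
    rw [ofComplex_apply_of_im_pos hz]
  · intro c hc
    have hc' : IsCusp c 𝒮ℒ := hc.mono (by rintro _ ⟨γ, -, rfl⟩; exact ⟨γ, rfl⟩)
    rw [OnePoint.isBoundedAt_iff_forall_SL2Z hc']
    intro γ _
    change IsBoundedAtImInfty (F ∣[(2 : ℤ)] γ)
    -- the sign of `γ` can be changed, so that the lower left entry is not negative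
    have key : ∃ B : ℝ, ∀ z : ℂ, 1 ≤ z.im →
        ‖thetaSeries q ((γ 0 0 * z + γ 0 1) / (γ 1 0 * z + γ 1 1)) *
          ((γ 1 0 * z + γ 1 1 : ℂ) ^ 2)⁻¹‖ ≤ B := by
      rcases lt_trichotomy (γ 1 0) 0 with h | h | h
      · obtain ⟨B, hB⟩ := exists_norm_thetaSeries_smul_le hP hA (a := -γ 0 0) (b := -γ 0 1)
          (d := -γ 1 1) (c := (-γ 1 0).toNat) (by omega)
          (by rw [Int.toNat_of_nonneg (by omega)]; linarith [hdet γ])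
        refine ⟨B, fun z hz => ?_⟩
        have h1 := hB z hz
        have h2 : (((-γ 1 0).toNat : ℕ) : ℂ) = -((γ 1 0 : ℤ) : ℂ) := by
          have : (((-γ 1 0).toNat : ℕ) : ℤ) = -γ 1 0 := Int.toNat_of_nonneg (by omega)
          exact_mod_cast congrArg (fun r : ℤ => (r : ℂ)) this
        rw [h2] at h1
        push_cast at h1
        rw [show (-(γ 0 0 : ℂ) * z + -(γ 0 1 : ℂ)) = -(γ 0 0 * z + γ 0 1) by ring,
          show (-(γ 1 0 : ℂ) * z + -(γ 1 1 : ℂ)) = -(γ 1 0 * z + γ 1 1) by ring,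
          neg_div_neg_eq, neg_sq] at h1
        exact h1
      · obtain ⟨B, hB⟩ := isBoundedAtImInfty_thetaSeries hP hA
        refine ⟨B, fun z hz => ?_⟩
        have h1 := hdet γ
        rw [h, mul_zero, sub_zero] at h1
        have hz0 : 0 < z.im := by linarith
        have h2 := thetaSeries_smul_Gamma0 hP hA hN hl hG (hdet γ) (by rw [h]; exact dvd_zero _) hz0
        rw [h2]
        have hd : ((γ 1 0 : ℂ) * z + γ 1 1) ≠ 0 := by
          rw [h]
          rcases Int.mul_eq_one_iff_eq_one_or_neg_one.1 h1 with ⟨-, h3⟩ | ⟨-, h3⟩ <;> simp [h3]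
        rw [mul_comm, ← mul_assoc, inv_mul_cancel₀ (pow_ne_zero _ hd), one_mul]
        exact hB z hz
      · obtain ⟨B, hB⟩ := exists_norm_thetaSeries_smul_le hP hA (a := γ 0 0) (b := γ 0 1)
          (d := γ 1 1) (c := (γ 1 0).toNat) (by omega)
          (by rw [Int.toNat_of_nonneg (by omega)]; linarith [hdet γ])
        refine ⟨B, fun z hz => ?_⟩
        have h1 := hB z hz
        have h2 : (((γ 1 0).toNat : ℕ) : ℂ) = ((γ 1 0 : ℤ) : ℂ) := by
          have : (((γ 1 0).toNat : ℕ) : ℤ) = γ 1 0 := Int.toNat_of_nonneg (by omega)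
          exact_mod_cast congrArg (fun r : ℤ => (r : ℂ)) this
        rw [h2] at h1
        exact h1
    obtain ⟨B, hB⟩ := key
    rw [isBoundedAtImInfty_iff]
    exact ⟨B, 1, fun τ hτ => by rw [hslash]; exact hB τ hτ⟩

end Modularity

/-! ### Quaternary quadratic forms over a prime field -/

section FiniteForms

open Matrix Module

variable {p : ℕ} [hp : Fact p.Prime]

/-- The polar form of `q` is nondegenerate. -/
def PolarNondeg {K : Type*} [Field K] (q : Matrix (Fin 4) (Fin 4) K) : Prop :=
  ∀ v, (∀ w, v ⬝ᵥ (q + qᵀ) *ᵥ w = 0) → v = 0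

theorem finrank_orthogonal_of_polarNondeg {K : Type*} [Field K] {q : Matrix (Fin 4) (Fin 4) K}
    (hq : PolarNondeg q) (U : Submodule K (Fin 4 → K)) :
    finrank K U + finrank K ((toBilin' (q + qᵀ)).orthogonal U) = 4 := by
  rw [LinearMap.BilinForm.finrank_add_finrank_orthogonal']
  have : LinearMap.ker (toBilin' (q + qᵀ)) = ⊥ := by
    rw [LinearMap.ker_eq_bot']
    intro v hv
    refine hq v fun w => ?_
    rw [← toBilin'_apply', hv]; rfl
  rw [this, inf_bot_eq, finrank_bot, finrank_fintype_fun_eq_card]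
  rfl

theorem polar_eq_zero_of_isotropic {K : Type*} [Field K] {q : Matrix (Fin 4) (Fin 4) K}
    {U : Submodule K (Fin 4 → K)} (hU : ∀ u ∈ U, qform q u = 0) {u v : Fin 4 → K}
    (hu : u ∈ U) (hv : v ∈ U) : u ⬝ᵥ (q + qᵀ) *ᵥ v = 0 := by
  have := qform_add q u v
  rw [hU _ hu, hU _ hv, hU _ (U.add_mem hu hv)] at this
  simpa using this.symm

theorem le_orthogonal_of_isotropic {K : Type*} [Field K] {q : Matrix (Fin 4) (Fin 4) K}
    {U : Submodule K (Fin 4 → K)} (hU : ∀ u ∈ U, qform q u = 0) :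
    U ≤ (toBilin' (q + qᵀ)).orthogonal U := by
  intro v hv
  rw [LinearMap.BilinForm.mem_orthogonal_iff]
  intro u hu
  change toBilin' (q + qᵀ) u v = 0
  rw [toBilin'_apply']
  exact polar_eq_zero_of_isotropic hU hu hv

theorem finrank_le_two_of_isotropic {K : Type*} [Field K] {q : Matrix (Fin 4) (Fin 4) K}
    (hq : PolarNondeg q) {U : Submodule K (Fin 4 → K)} (hU : ∀ u ∈ U, qform q u = 0) :
    finrank K U ≤ 2 := by
  have h1 := finrank_orthogonal_of_polarNondeg hq U
  have h2 := Submodule.finrank_mono (le_orthogonal_of_isotropic hU)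
  omega

theorem exists_polar_ne_zero {K : Type*} [Field K] {q : Matrix (Fin 4) (Fin 4) K}
    (hq : PolarNondeg q) {U : Submodule K (Fin 4 → K)} (hU : ∀ u ∈ U, qform q u = 0)
    (h2 : finrank K U = 2) {x : Fin 4 → K} (hx : x ∉ U) :
    ∃ u ∈ U, u ⬝ᵥ (q + qᵀ) *ᵥ x ≠ 0 := by
  by_contra! h
  apply hx
  have h1 := finrank_orthogonal_of_polarNondeg hq U
  rw [Submodule.eq_of_le_of_finrank_eq (le_orthogonal_of_isotropic hU) (by omega)]
  rw [LinearMap.BilinForm.mem_orthogonal_iff]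
  intro u hu
  change toBilin' (q + qᵀ) u x = 0
  rw [toBilin'_apply']
  exact h u hu

/-- A linear map between two nondegenerate quaternary spaces whose kernel and range are both
isotropic has a range of dimension two. -/
theorem finrank_range_eq_two {K : Type*} [Field K] {q q' : Matrix (Fin 4) (Fin 4) K}
    (hq : PolarNondeg q) (hq' : PolarNondeg q') (f : (Fin 4 → K) →ₗ[K] (Fin 4 → K))
    (hk : ∀ u ∈ LinearMap.ker f, qform q u = 0) (hr : ∀ u ∈ LinearMap.range f, qform q' u = 0) :
    finrank K (LinearMap.range f) = 2 := by
  have h1 := LinearMap.finrank_range_add_finrank_ker f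
  rw [finrank_fintype_fun_eq_card, Fintype.card_fin] at h1
  have h2 := finrank_le_two_of_isotropic hq hk
  have h3 := finrank_le_two_of_isotropic hq' hr
  omega

theorem card_of_finrank_two {U : Submodule (ZMod p) (Fin 4 → ZMod p)}
    (h : finrank (ZMod p) U = 2) : Nat.card U = p ^ 2 := by
  have : Fintype U := Fintype.ofFinite _
  rw [Nat.card_eq_fintype_card, Module.card_eq_pow_finrank (K := ZMod p), h, ZMod.card]

/-- The Gauss sum of a quaternary form with a two-dimensional isotropic subspace `U`: averaging
over the cosets of `U`, only the trivial coset contributes. -/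
theorem gaussSum_of_isotropic {q : Matrix (Fin 4) (Fin 4) (ZMod p)} (hq : PolarNondeg q)
    {U : Submodule (ZMod p) (Fin 4 → ZMod p)} (hU : ∀ u ∈ U, qform q u = 0)
    (h2 : finrank (ZMod p) U = 2) {a : ZMod p} (ha : a ≠ 0) :
    ∑ x : Fin 4 → ZMod p, ZMod.stdAddChar (a * qform q x) = (p : ℂ) ^ 2 := by
  classical
  have hcard : (Fintype.card U : ℂ) = (p : ℂ) ^ 2 := by
    rw [← Nat.card_eq_fintype_card, card_of_finrank_two h2]; push_cast; rfl
  have hp0 : (p : ℂ) ≠ 0 := by exact_mod_cast hp.out.ne_zero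
  have hinner : ∀ x : Fin 4 → ZMod p,
      ∑ u : U, ZMod.stdAddChar (a * qform q ((u : Fin 4 → ZMod p) + x)) =
        if x ∈ U then (p : ℂ) ^ 2 else 0 := by
    intro x
    split_ifs with hx
    · rw [← hcard, Finset.sum_congr rfl fun u _ => by
        rw [hU _ (U.add_mem u.2 hx), mul_zero, AddChar.map_zero_eq_one]]
      simp
    -- `U` is its own orthogonal, so for `x ∉ U` the sum runs over a nontrivial character of `U`
    · obtain ⟨u₀, hu₀, hne⟩ := exists_polar_ne_zero hq hU h2 hx
      let ψ : AddChar U ℂ :=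
        { toFun := fun u => ZMod.stdAddChar (a * ((u : Fin 4 → ZMod p) ⬝ᵥ (q + qᵀ) *ᵥ x))
          map_zero_eq_one' := by simp
          map_add_eq_mul' := fun u v => by
            simp only [Submodule.coe_add, add_dotProduct, mul_add, AddChar.map_add_eq_mul] }
      have hψ : ψ ≠ 0 := by
        rw [AddChar.ne_zero_iff]
        refine ⟨⟨u₀, hu₀⟩, fun h => mul_ne_zero ha hne ?_⟩
        apply ZMod.injective_stdAddChar (N := p)
        rw [AddChar.map_zero_eq_one]
        exact h
      have hsum : ∑ u : U, ψ u = 0 := by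
        rw [AddChar.sum_eq_ite, if_neg hψ]
      have : ∀ u : U, ZMod.stdAddChar (a * qform q ((u : Fin 4 → ZMod p) + x)) =
          ZMod.stdAddChar (a * qform q x) * ψ u := by
        intro u
        rw [qform_add, hU _ u.2, zero_add, mul_add, AddChar.map_add_eq_mul]
        rfl
      simp only [this, ← Finset.mul_sum, hsum, mul_zero]
  have h3 : ∑ x : Fin 4 → ZMod p, ∑ u : U,
      ZMod.stdAddChar (a * qform q ((u : Fin 4 → ZMod p) + x)) =
      (p : ℂ) ^ 2 * ∑ x : Fin 4 → ZMod p, ZMod.stdAddChar (a * qform q x) := by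
    rw [Finset.sum_comm, ← hcard, ← nsmul_eq_mul, Fintype.card, ← Finset.sum_const]
    refine Finset.sum_congr rfl fun u _ => ?_
    exact Fintype.sum_equiv (Equiv.addLeft (u : Fin 4 → ZMod p)) _ _ fun x => rfl
  have h4 : ∑ x : Fin 4 → ZMod p, (if x ∈ U then (p : ℂ) ^ 2 else 0) =
      (p : ℂ) ^ 2 * (p : ℂ) ^ 2 := by
    rw [← Finset.sum_filter, Finset.sum_const, nsmul_eq_mul, ← hcard]
    congr 2
    rw [Fintype.card_subtype]
  simp only [hinner] at h3
  rw [h4] at h3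
  exact (mul_left_cancel₀ (pow_ne_zero 2 hp0) h3).symm

theorem card_isotropic {q : Matrix (Fin 4) (Fin 4) (ZMod p)} (hq : PolarNondeg q)
    {U : Submodule (ZMod p) (Fin 4 → ZMod p)} (hU : ∀ u ∈ U, qform q u = 0)
    (h2 : finrank (ZMod p) U = 2) :
    Nat.card {x : Fin 4 → ZMod p // qform q x = 0 ∧ x ≠ 0} = (p ^ 2 - 1) * (p + 1) := by
  classical
  have hp1 := hp.out.one_lt
  -- detect `Q(x) = 0` by summing over all additive characters
  have key : (p : ℂ) * Fintype.card {x : Fin 4 → ZMod p // qform q x = 0} =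
      (p : ℂ) ^ 4 + (p - 1) * (p : ℂ) ^ 2 := by
    have h1 : ∑ a : ZMod p, ∑ x : Fin 4 → ZMod p, ZMod.stdAddChar (a * qform q x) =
        (p : ℂ) ^ 4 + (p - 1) * (p : ℂ) ^ 2 := by
      rw [← Finset.add_sum_erase _ _ (Finset.mem_univ (0 : ZMod p))]
      congr 1
      · simp [ZMod.card]
      · rw [Finset.sum_congr rfl fun a ha =>
          gaussSum_of_isotropic hq hU h2 (Finset.ne_of_mem_erase ha)]
        rw [Finset.sum_const, Finset.card_erase_of_mem (Finset.mem_univ _), Finset.card_univ,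
          ZMod.card, nsmul_eq_mul, Nat.cast_sub hp1.le, Nat.cast_one]
    rw [← h1, Finset.sum_comm]
    have h3 : ∀ x : Fin 4 → ZMod p, ∑ a : ZMod p, ZMod.stdAddChar (a * qform q x) =
        if qform q x = 0 then (p : ℂ) else 0 := by
      intro x
      rw [AddChar.sum_mulShift _ (ZMod.isPrimitive_stdAddChar p), ZMod.card]
      split_ifs <;> simp
    simp only [h3]
    rw [← Finset.sum_filter, Finset.sum_const, nsmul_eq_mul, mul_comm, Fintype.card_subtype]
  have key' : p * Fintype.card {x : Fin 4 → ZMod p // qform q x = 0} + p ^ 2 = p ^ 4 + p ^ 3 := by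
    have : ((p * Fintype.card {x : Fin 4 → ZMod p // qform q x = 0} + p ^ 2 : ℕ) : ℂ) =
        ((p ^ 4 + p ^ 3 : ℕ) : ℂ) := by
      push_cast
      rw [key]; ring
    exact_mod_cast this
  have key2 : Fintype.card {x : Fin 4 → ZMod p // qform q x = 0} + p = p ^ 3 + p ^ 2 := by
    apply Nat.eq_of_mul_eq_mul_left hp.out.pos
    rw [mul_add, ← sq, key']; ring
  have h5 : Fintype.card {x : Fin 4 → ZMod p // qform q x = 0 ∧ x ≠ 0} + 1 =
      Fintype.card {x : Fin 4 → ZMod p // qform q x = 0} := by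
    rw [Fintype.card_subtype, Fintype.card_subtype]
    have h0 : (0 : Fin 4 → ZMod p) ∈ Finset.univ.filter fun x => qform q x = 0 := by
      rw [Finset.mem_filter]
      exact ⟨Finset.mem_univ _, by rw [qform, zero_dotProduct]⟩
    rw [← Finset.card_erase_add_one h0]
    congr 2
    ext x
    simp [and_comm]
  rw [Nat.card_eq_fintype_card]
  have h6 : 1 ≤ p ^ 2 := Nat.one_le_pow _ _ hp.out.pos
  zify [h6] at *
  nlinarith

/-- A quaternary quadratic form over a prime field represents zero nontrivially, by the theorem of
Chevalley and Warning. -/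
theorem exists_isotropic (q : Matrix (Fin 4) (Fin 4) (ZMod p)) : ∃ x ≠ 0, qform q x = 0 := by
  classical
  let f : MvPolynomial (Fin 4) (ZMod p) :=
    ∑ i, ∑ j, MvPolynomial.C (q i j) * (MvPolynomial.X i * MvPolynomial.X j)
  have heval : ∀ x, MvPolynomial.eval x f = qform q x := by
    intro x
    simp only [f, map_sum, map_mul, MvPolynomial.eval_C, MvPolynomial.eval_X, qform, dotProduct,
      mulVec, Finset.mul_sum]
    exact Finset.sum_congr rfl fun i _ => Finset.sum_congr rfl fun j _ => by ring
  have hdeg : f.totalDegree < Fintype.card (Fin 4) := by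
    refine lt_of_le_of_lt (b := 2) ?_ (by simp)
    refine MvPolynomial.totalDegree_finsetSum_le fun i _ =>
      MvPolynomial.totalDegree_finsetSum_le fun j _ => ?_
    refine (MvPolynomial.totalDegree_mul _ _).trans ?_
    rw [MvPolynomial.totalDegree_C, zero_add]
    refine (MvPolynomial.totalDegree_mul _ _).trans ?_
    simp
  have hdvd := char_dvd_card_solutions p hdeg
  by_contra! h
  have : Fintype.card {x : Fin 4 → ZMod p // MvPolynomial.eval x f = 0} = 1 := by
    rw [Fintype.card_eq_one_iff]
    refine ⟨⟨0, by rw [heval]; simp [qform]⟩, fun x => Subtype.ext ?_⟩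
    by_contra hx
    exact h x.1 hx (by rw [← heval]; exact x.2)
  rw [this] at hdvd
  exact hp.out.one_lt.ne' (Nat.dvd_one.1 hdvd)

end FiniteForms

/-! ### Rational numbers and primes -/

section Padic

theorem padicNorm_le_one_iff {p : ℕ} [hp : Fact p.Prime] {r : ℚ} :
    padicNorm p r ≤ 1 ↔ ¬ p ∣ r.den := by
  have hden : (r.den : ℚ) ≠ 0 := by exact_mod_cast r.den_nz
  constructor
  · intro h hd
    have hnum : ¬ (p : ℤ) ∣ r.num := fun hn =>
      Nat.not_coprime_of_dvd_of_dvd hp.out.one_lt (Int.natCast_dvd.1 hn) hd r.reduced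
    have h1 : padicNorm p r * padicNorm p r.den = 1 := by
      rw [← padicNorm.mul, Rat.mul_den_eq_num, padicNorm.int_eq_one_iff]
      exact hnum
    have h2 : padicNorm p (r.den : ℚ) < 1 := (padicNorm.nat_lt_one_iff _).2 hd
    have h3 : 0 ≤ padicNorm p (r.den : ℚ) := padicNorm.nonneg _
    nlinarith
  · intro h
    have h1 : padicNorm p (r.den : ℚ) = 1 := (padicNorm.nat_eq_one_iff _).2 h
    have h2 : padicNorm p r * padicNorm p r.den = padicNorm p r.num := by
      rw [← padicNorm.mul, Rat.mul_den_eq_num]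
    rw [h1, mul_one] at h2
    rw [h2]
    exact padicNorm.of_int _

theorem exists_int_eq_of_padicNorm_le_one {r : ℚ}
    (h : ∀ (p : ℕ) [Fact p.Prime], padicNorm p r ≤ 1) : ∃ k : ℤ, r = k := by
  have hd : r.den = 1 := by
    by_contra hne
    obtain ⟨p, hp, hpd⟩ := Nat.exists_prime_and_dvd hne
    have := Fact.mk hp
    exact padicNorm_le_one_iff.1 (h p) hpd
  exact ⟨r.num, ((Rat.den_eq_one_iff r).1 hd).symm⟩

theorem eq_of_padicNorm_eq {r s : ℚ} (hr : 0 < r) (hs : 0 < s)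
    (h : ∀ (p : ℕ) [Fact p.Prime], padicNorm p r = padicNorm p s) : r = s := by
  have key : ∀ {r s : ℚ}, 0 < r → 0 < s →
      (∀ (p : ℕ) [Fact p.Prime], padicNorm p r = padicNorm p s) → s ≤ r := by
    intro r s hr hs h
    obtain ⟨k, hk⟩ := exists_int_eq_of_padicNorm_le_one (r := r / s) fun p _ => by
      rw [padicNorm.div, h p, div_self]
      exact padicNorm.nonzero hs.ne'
    have h1 : 0 < r / s := div_pos hr hs
    rw [hk] at h1
    have h2 : (1 : ℚ) ≤ k := by exact_mod_cast (by exact_mod_cast h1 : 0 < k)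
    rw [← hk, le_div_iff₀ hs, one_mul] at h2
    exact h2
  exact le_antisymm (key hs hr fun p _ => (h p).symm) (key hr hs h)

end Padic

/-! ### Reduced norm and trace -/

section Norm

variable {a b : ℚ}

theorem nrd_eq (x : Quat a b) :
    nrd x = x.re ^ 2 - a * x.imI ^ 2 - b * x.imJ ^ 2 + a * b * x.imK ^ 2 := by
  simp [nrd]; ring

theorem trd_eq (x : Quat a b) : trd x = 2 * x.re := by
  simp [trd]; ring

theorem nrd_star (x : Quat a b) : nrd (star x) = nrd x := by
  simp [nrd_eq]

theorem trd_star (x : Quat a b) : trd (star x) = trd x := by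
  simp [trd_eq]

theorem nrd_smul (r : ℚ) (x : Quat a b) : nrd (r • x) = r ^ 2 * nrd x := by
  simp [nrd_eq]; ring

theorem trd_smul (r : ℚ) (x : Quat a b) : trd (r • x) = r * trd x := by
  simp [trd_eq]; ring

theorem trd_add (x y : Quat a b) : trd (x + y) = trd x + trd y := by
  simp [trd_eq]; ring

theorem nrd_zero : nrd (0 : Quat a b) = 0 := by simp [nrd]

theorem nrd_one : nrd (1 : Quat a b) = 1 := by simp [nrd]

theorem nrd_add (x y : Quat a b) : nrd (x + y) = nrd x + nrd y + trd (x * star y) := by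
  simp [nrd_eq, trd_eq]; ring

theorem trd_mul_comm (x y : Quat a b) : trd (x * y) = trd (y * x) := by
  simp [trd_eq]; ring

theorem mul_star_self_eq (x : Quat a b) : x * star x = nrd x • (1 : Quat a b) := by
  ext <;> simp [nrd_eq] <;> ring

theorem star_mul_self_eq (x : Quat a b) : star x * x = nrd x • (1 : Quat a b) := by
  ext <;> simp [nrd_eq] <;> ring

theorem star_eq_trd_sub (x : Quat a b) : star x = trd x • (1 : Quat a b) - x := by
  ext <;> simp [trd_eq]; ring

theorem nrd_pos (ha : a < 0) (hb : b < 0) {x : Quat a b} (hx : x ≠ 0) : 0 < nrd x := by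
  have hab : 0 < a * b := mul_pos_of_neg_of_neg ha hb
  rw [nrd_eq]
  by_contra h
  have h1 := sq_nonneg x.re
  have h2 := mul_nonneg (neg_pos.2 ha).le (sq_nonneg x.imI)
  have h3 := mul_nonneg (neg_pos.2 hb).le (sq_nonneg x.imJ)
  have h4 := mul_nonneg hab.le (sq_nonneg x.imK)
  apply hx
  ext
  · simpa using (by nlinarith : x.re ^ 2 = 0)
  · have : -a * x.imI ^ 2 = 0 := by nlinarith
    simpa [ha.ne] using this
  · have : -b * x.imJ ^ 2 = 0 := by nlinarith
    simpa [hb.ne] using this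
  · have : a * b * x.imK ^ 2 = 0 := by nlinarith
    simpa [ha.ne, hb.ne] using this

theorem nrd_nonneg (ha : a < 0) (hb : b < 0) (x : Quat a b) : 0 ≤ nrd x := by
  rcases eq_or_ne x 0 with rfl | h
  · simp [nrd]
  · exact (nrd_pos ha hb h).le

/-- In a definite quaternion algebra a nonzero element is a unit. -/
theorem exists_unit_eq (ha : a < 0) (hb : b < 0) {x : Quat a b} (hx : x ≠ 0) :
    ∃ u : (Quat a b)ˣ, (u : Quat a b) = x := by
  have h := (nrd_pos ha hb hx).ne'
  exact ⟨⟨x, (nrd x)⁻¹ • star x, by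
    rw [mul_smul_comm, mul_star_self_eq, smul_smul, inv_mul_cancel₀ h, one_smul], by
    rw [smul_mul_assoc, star_mul_self_eq, smul_smul, inv_mul_cancel₀ h, one_smul]⟩, rfl⟩

theorem unit_inv_eq (u : (Quat a b)ˣ) :
    ((u⁻¹ : (Quat a b)ˣ) : Quat a b) = (nrd (u : Quat a b))⁻¹ • star (u : Quat a b) := by
  have h := nrd_unit_ne_zero u
  refine Units.inv_eq_of_mul_eq_one_right ?_
  rw [mul_smul_comm, mul_star_self_eq, smul_smul, inv_mul_cancel₀ h, one_smul]

theorem nrd_unit_inv (u : (Quat a b)ˣ) :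
    nrd ((u⁻¹ : (Quat a b)ˣ) : Quat a b) = (nrd (u : Quat a b))⁻¹ := by
  refine eq_inv_of_mul_eq_one_left ?_
  rw [← nrd_mul, Units.inv_mul, nrd_one]

theorem nrd_unit_pos (ha : a < 0) (hb : b < 0) (u : (Quat a b)ˣ) : 0 < nrd (u : Quat a b) :=
  nrd_pos ha hb fun h => nrd_unit_ne_zero u (by rw [h, nrd_zero])

end Norm

/-! ### Localization of lattices -/

section Loc

variable {a b : ℚ} {p : ℕ} [hp : Fact p.Prime]

/-- The localization of `L` at the prime `p`, as a subset of `H`: the elements a multiple of which,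
by an integer prime to `p`, lies in `L`. -/
def loc (p : ℕ) [hp : Fact p.Prime] (L : Submodule ℤ (Quat a b)) : Submodule ℤ (Quat a b) where
  carrier := {x | ∃ m : ℕ, ¬ p ∣ m ∧ (m : ℤ) • x ∈ L}
  add_mem' := by
    rintro x y ⟨m, hm, hx⟩ ⟨n, hn, hy⟩
    refine ⟨m * n, fun h => (hp.out.dvd_mul.1 h).elim hm hn, ?_⟩
    rw [smul_add]
    refine L.add_mem ?_ ?_
    · rw [Nat.cast_mul, mul_comm, mul_smul]
      exact L.smul_mem _ hx
    · rw [Nat.cast_mul, mul_smul]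
      exact L.smul_mem _ hy
  zero_mem' := ⟨1, hp.out.one_lt.ne' ∘ Nat.dvd_one.1, by simp⟩
  smul_mem' := by
    rintro c x ⟨m, hm, hx⟩
    exact ⟨m, hm, by rw [smul_comm]; exact L.smul_mem _ hx⟩

theorem mem_loc {L : Submodule ℤ (Quat a b)} {x : Quat a b} :
    x ∈ loc p L ↔ ∃ m : ℕ, ¬ p ∣ m ∧ (m : ℤ) • x ∈ L := Iff.rfl

theorem le_loc (L : Submodule ℤ (Quat a b)) : L ≤ loc p L := fun x hx =>
  ⟨1, hp.out.one_lt.ne' ∘ Nat.dvd_one.1, by simpa using hx⟩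

theorem loc_mono {L M : Submodule ℤ (Quat a b)} (h : L ≤ M) : loc p L ≤ loc p M :=
  fun _ ⟨m, hm, hx⟩ => ⟨m, hm, h hx⟩

theorem loc_loc (L : Submodule ℤ (Quat a b)) : loc p (loc p L) = loc p L := by
  refine le_antisymm ?_ (le_loc _)
  rintro x ⟨m, hm, n, hn, hx⟩
  refine ⟨n * m, fun h => (hp.out.dvd_mul.1 h).elim hn hm, ?_⟩
  rwa [Nat.cast_mul, mul_smul]

theorem loc_le_loc_of_le {L M : Submodule ℤ (Quat a b)} (h : L ≤ loc p M) : loc p L ≤ loc p M := by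
  rw [← loc_loc M]; exact loc_mono h

theorem mem_of_forall_mem_loc {L : Submodule ℤ (Quat a b)} {x : Quat a b}
    (h : ∀ (p : ℕ) [Fact p.Prime], x ∈ loc p L) : x ∈ L := by
  let I : Ideal ℤ := L.comap (LinearMap.toSpanSingleton ℤ (Quat a b) x)
  have hI : ∀ m : ℤ, m ∈ I ↔ m • x ∈ L := fun m => Iff.rfl
  have htop : I = ⊤ := by
    obtain ⟨g, hg⟩ := (IsPrincipalIdealRing.principal I).principal
    by_contra hne
    have hg1 : g.natAbs ≠ 1 := by
      intro h1
      apply hne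
      rw [hg, Ideal.submodule_span_eq, Ideal.span_singleton_eq_top]
      exact Int.isUnit_iff_natAbs_eq.2 h1
    obtain ⟨p, hp, hpg⟩ := Nat.exists_prime_and_dvd hg1
    have := Fact.mk hp
    obtain ⟨m, hm, hx⟩ := h p
    have h2 : (m : ℤ) ∈ I := (hI _).2 hx
    rw [hg, Ideal.submodule_span_eq, Ideal.mem_span_singleton] at h2
    exact hm (Int.natCast_dvd_natCast.1 ((Int.natCast_dvd.2 hpg).trans h2))
  have := (hI 1).1 (htop ▸ Submodule.mem_top)
  simpa using this

theorem le_of_forall_loc_le {L M : Submodule ℤ (Quat a b)}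
    (h : ∀ (p : ℕ) [Fact p.Prime], L ≤ loc p M) : L ≤ M :=
  fun _ hx => mem_of_forall_mem_loc fun p _ => h p hx

theorem eq_of_forall_loc_eq {L M : Submodule ℤ (Quat a b)}
    (h : ∀ (p : ℕ) [Fact p.Prime], loc p L = loc p M) : L = M :=
  le_antisymm (le_of_forall_loc_le fun p _ => h p ▸ le_loc L)
    (le_of_forall_loc_le fun p _ => (h p).symm ▸ le_loc M)

/-- The localization at `p` is stable under multiplication by `p`-integral rational numbers. -/
theorem smul_mem_loc {L : Submodule ℤ (Quat a b)} {x : Quat a b} {r : ℚ}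
    (hr : padicNorm p r ≤ 1) (hx : x ∈ loc p L) : r • x ∈ loc p L := by
  obtain ⟨m, hm, hx⟩ := hx
  refine ⟨r.den * m, fun h => (hp.out.dvd_mul.1 h).elim (padicNorm_le_one_iff.1 hr) hm, ?_⟩
  have : ((r.den * m : ℕ) : ℤ) • r • x = r.num • ((m : ℤ) • x) := by
    simp only [← Int.cast_smul_eq_zsmul ℚ, smul_smul]
    congr 1
    push_cast
    rw [← Rat.mul_den_eq_num r]
    ring
  rw [this]
  exact L.smul_mem _ hx

theorem mem_rmul {L : Submodule ℤ (Quat a b)} {y : (Quat a b)ˣ} {x : Quat a b} :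
    x ∈ rmul L y ↔ x * ((y⁻¹ : (Quat a b)ˣ) : Quat a b) ∈ L := by
  constructor
  · rintro ⟨z, hz, rfl⟩
    simpa [mul_assoc] using hz
  · intro h
    exact ⟨_, h, by simp [mul_assoc]⟩

theorem loc_rmul (L : Submodule ℤ (Quat a b)) (y : (Quat a b)ˣ) :
    loc p (rmul L y) = rmul (loc p L) y := by
  ext x
  simp only [mem_rmul, mem_loc, smul_mul_assoc]

end Loc

/-! ### The norm of a lattice -/

section LatticeNorm

variable {a b : ℚ}

theorem exists_common_den (φ : Quat a b →ₗ[ℤ] ℚ) {L : Submodule ℤ (Quat a b)} (hL : L.FG) :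
    ∃ M : ℕ, 0 < M ∧ ∀ x ∈ L, ∃ k : ℤ, M * φ x = k := by
  induction L, hL using Submodule.fg_induction with
  | singleton x =>
    refine ⟨(φ x).den, (φ x).pos, fun y hy => ?_⟩
    obtain ⟨c, rfl⟩ := Submodule.mem_span_singleton.1 hy
    refine ⟨c * (φ x).num, ?_⟩
    rw [map_smul, zsmul_eq_mul]
    push_cast
    rw [← Rat.mul_den_eq_num]
    ring
  | sup L₁ L₂ _ _ h₁ h₂ =>
    obtain ⟨M₁, hM₁, h₁⟩ := h₁
    obtain ⟨M₂, hM₂, h₂⟩ := h₂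
    refine ⟨M₁ * M₂, mul_pos hM₁ hM₂, fun x hx => ?_⟩
    obtain ⟨y, hy, z, hz, rfl⟩ := Submodule.mem_sup.1 hx
    obtain ⟨k, hk⟩ := h₁ y hy
    obtain ⟨l, hl⟩ := h₂ z hz
    refine ⟨M₂ * k + M₁ * l, ?_⟩
    rw [map_add]
    push_cast
    rw [← hk, ← hl]
    ring

/-- The coordinates with respect to `1, i, j, ij`, as additive maps. -/
noncomputable def coordHom (a b : ℚ) (i : Fin 4) : Quat a b →ₗ[ℤ] ℚ :=
  ((QuaternionAlgebra.basisOneIJK a 0 b).coord i).restrictScalars ℤ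

theorem coordHom_apply (i : Fin 4) (x : Quat a b) :
    coordHom a b i x = ![x.re, x.imI, x.imJ, x.imK] i := by
  simp [coordHom, QuaternionAlgebra.coe_basisOneIJK_repr]

theorem exists_common_den_nrd {L : Submodule ℤ (Quat a b)} (hL : L.FG) :
    ∃ M : ℕ, 0 < M ∧ ∀ x ∈ L, ∃ k : ℤ, M * nrd x = k := by
  choose M hM h using fun i => exists_common_den (coordHom a b i) hL
  set m := M 0 * M 1 * M 2 * M 3 with hm
  have hm0 : 0 < m := by
    have := hM 0; have := hM 1; have := hM 2; have := hM 3
    positivity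
  have hden : ∀ x ∈ L, ∀ i, ∃ k : ℤ, m * coordHom a b i x = k := by
    intro x hx i
    obtain ⟨k, hk⟩ := h i x hx
    have hdvd : M i ∣ m := by
      rw [hm]
      fin_cases i
      · exact (Dvd.intro _ rfl : M 0 ∣ M 0 * (M 1 * M 2 * M 3)).trans (by simp [mul_assoc])
      · exact (Dvd.intro _ rfl : M 1 ∣ M 1 * (M 0 * M 2 * M 3)).trans
          (dvd_of_eq (by ring))
      · exact (Dvd.intro _ rfl : M 2 ∣ M 2 * (M 0 * M 1 * M 3)).trans
          (dvd_of_eq (by ring))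
      · exact Dvd.intro_left _ rfl
    obtain ⟨c, hc⟩ := hdvd
    refine ⟨c * k, ?_⟩
    rw [hc]
    push_cast
    rw [← hk]
    ring
  refine ⟨m ^ 2 * (a.den * b.den), by have := a.pos; have := b.pos; positivity, fun x hx => ?_⟩
  choose k hk using hden x hx
  have h0 := hk 0; have h1 := hk 1; have h2 := hk 2; have h3 := hk 3
  simp only [coordHom_apply] at h0 h1 h2 h3
  refine ⟨a.den * b.den * k 0 ^ 2 - a.num * b.den * k 1 ^ 2 - a.den * b.num * k 2 ^ 2
    + a.num * b.num * k 3 ^ 2, ?_⟩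
  push_cast
  rw [← h0, ← h1, ← h2, ← h3, nrd_eq]
  have ha := Rat.mul_den_eq_num a
  have hb := Rat.mul_den_eq_num b
  rw [← ha, ← hb]
  simp only [Matrix.cons_val]
  ring

/-- A lattice has a positive norm, which generates the group spanned by the norms of its
elements. -/
theorem latticeNorm_spec (ha : a < 0) (hb : b < 0) {L : Submodule ℤ (Quat a b)} (hL : L.FG)
    (h0 : L ≠ ⊥) : 0 < latticeNorm L ∧
      Submodule.span ℤ (nrd '' (L : Set (Quat a b))) = Submodule.span ℤ {latticeNorm L} := by
  obtain ⟨M, hM, h⟩ := exists_common_den_nrd hL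
  have hM0 : (M : ℚ) ≠ 0 := by exact_mod_cast hM.ne'
  set S := Submodule.span ℤ (nrd '' (L : Set (Quat a b))) with hS
  let f : ℤ →ₗ[ℤ] ℚ := LinearMap.toSpanSingleton ℤ ℚ (M : ℚ)⁻¹
  have hf : ∀ k : ℤ, f k = k * (M : ℚ)⁻¹ := fun k => zsmul_eq_mul _ _
  have hle : S ≤ LinearMap.range f := by
    rw [hS, Submodule.span_le]
    rintro _ ⟨x, hx, rfl⟩
    obtain ⟨k, hk⟩ := h x hx
    exact ⟨k, by rw [hf, ← hk]; field_simp⟩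
  obtain ⟨g, hg⟩ := (IsPrincipalIdealRing.principal (S.comap f : Ideal ℤ)).principal
  have hSg : S = Submodule.span ℤ {f g} := by
    rw [← Submodule.map_comap_eq_of_le hle]
    have : S.comap f = Submodule.span ℤ {g} := hg
    rw [this, Submodule.map_span, Set.image_singleton]
  have hSr : S = Submodule.span ℤ {|f g|} := by
    rw [hSg]
    rcases abs_choice (f g) with h' | h' <;> rw [h']
    rw [← Set.neg_singleton, Submodule.span_neg]
  have hN : latticeNorm L = |f g| := ratGcd_eq (abs_nonneg _) hSr
  rw [hN]
  refine ⟨abs_pos.2 fun h1 => ?_, hSr⟩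
  obtain ⟨x, hx, hx0⟩ := Submodule.exists_mem_ne_zero_of_ne_bot h0
  have h2 : nrd x ∈ S := Submodule.subset_span ⟨x, hx, rfl⟩
  rw [hSg, h1, Submodule.span_singleton_eq_bot.2 rfl, Submodule.mem_bot] at h2
  exact (nrd_pos ha hb hx0).ne' h2

variable (ha : a < 0) (hb : b < 0) {L : Submodule ℤ (Quat a b)} (hL : L.FG) (h0 : L ≠ ⊥)
include ha hb hL h0

theorem latticeNorm_pos : 0 < latticeNorm L := (latticeNorm_spec ha hb hL h0).1

theorem exists_nrd_eq_mul {x : Quat a b} (hx : x ∈ L) : ∃ k : ℤ, nrd x = k * latticeNorm L := by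
  have h1 : nrd x ∈ Submodule.span ℤ (nrd '' (L : Set (Quat a b))) :=
    Submodule.subset_span ⟨x, hx, rfl⟩
  rw [(latticeNorm_spec ha hb hL h0).2, Submodule.mem_span_singleton] at h1
  obtain ⟨k, hk⟩ := h1
  exact ⟨k, by rw [← hk, zsmul_eq_mul]⟩

theorem latticeNorm_eq_of_span {r : ℚ} (hr : ∀ x ∈ L, ∃ k : ℤ, nrd x = k * r) :
    ∃ k : ℤ, latticeNorm L = k * r := by
  have h1 : latticeNorm L ∈ Submodule.span ℤ (nrd '' (L : Set (Quat a b))) := by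
    rw [(latticeNorm_spec ha hb hL h0).2]
    exact Submodule.mem_span_singleton_self _
  have h2 : Submodule.span ℤ (nrd '' (L : Set (Quat a b))) ≤ Submodule.span ℤ {r} := by
    rw [Submodule.span_le]
    rintro _ ⟨x, hx, rfl⟩
    obtain ⟨k, hk⟩ := hr x hx
    exact Submodule.mem_span_singleton.2 ⟨k, by rw [hk, zsmul_eq_mul]⟩
  obtain ⟨k, hk⟩ := Submodule.mem_span_singleton.1 (h2 h1)
  exact ⟨k, by rw [← hk, zsmul_eq_mul]⟩

theorem padicNorm_nrd_le {p : ℕ} [Fact p.Prime] {x : Quat a b} (hx : x ∈ L) :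
    padicNorm p (nrd x) ≤ padicNorm p (latticeNorm L) := by
  obtain ⟨k, hk⟩ := exists_nrd_eq_mul ha hb hL h0 hx
  rw [hk, padicNorm.mul]
  exact mul_le_of_le_one_left (padicNorm.nonneg _) (padicNorm.of_int _)

theorem padicNorm_latticeNorm_le {p : ℕ} [Fact p.Prime] {ρ : ℚ} (hρ : 0 ≤ ρ)
    (h : ∀ x ∈ L, padicNorm p (nrd x) ≤ ρ) : padicNorm p (latticeNorm L) ≤ ρ := by
  have h1 : latticeNorm L ∈ Submodule.span ℤ (nrd '' (L : Set (Quat a b))) := by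
    rw [(latticeNorm_spec ha hb hL h0).2]
    exact Submodule.mem_span_singleton_self _
  generalize latticeNorm L = r at h1
  induction h1 using Submodule.span_induction with
  | mem r hr => obtain ⟨x, hx, rfl⟩ := hr; exact h x hx
  | zero => simpa using hρ
  | add r s _ _ hr hs => exact (padicNorm.nonarchimedean).trans (max_le hr hs)
  | smul k r _ hr =>
    rw [zsmul_eq_mul, padicNorm.mul]
    exact (mul_le_of_le_one_left (padicNorm.nonneg _) (padicNorm.of_int _)).trans hr

theorem latticeNorm_eq_mul_of_le {L' : Submodule ℤ (Quat a b)} (hL' : L'.FG) (h : L ≤ L') :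
    ∃ k : ℤ, latticeNorm L = k * latticeNorm L' :=
  latticeNorm_eq_of_span ha hb hL h0 fun _ hx =>
    exists_nrd_eq_mul ha hb hL' (fun h' => h0 (le_bot_iff.1 (h' ▸ h))) (h hx)

end LatticeNorm

open scoped TensorProduct

/-! ### Orders -/

section Order

variable {a b : ℚ} {O : Subalgebra ℤ (Quat a b)} (hO : (Subalgebra.toSubmodule O).IsLattice ℚ)

theorem padicNorm_pow (p : ℕ) [Fact p.Prime] (r : ℚ) (n : ℕ) :
    padicNorm p (r ^ n) = padicNorm p r ^ n := by
  induction n with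
  | zero => simp
  | succ n ih => rw [pow_succ, pow_succ, padicNorm.mul, ih]

include hO

/-- Norms of elements of an order are integers: the powers of such a norm have a common
denominator. -/
theorem exists_int_nrd {x : Quat a b} (hx : x ∈ O) : ∃ k : ℤ, nrd x = k := by
  obtain ⟨M, hM, h⟩ := exists_common_den_nrd hO.fg
  refine exists_int_eq_of_padicNorm_le_one fun p _ => ?_
  by_contra! hlt
  have hpow : ∀ n : ℕ, nrd (x ^ n) = nrd x ^ n := by
    intro n
    induction n with
    | zero => simp [nrd_one]
    | succ n ih => rw [pow_succ, nrd_mul, ih, pow_succ]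
  have hM0 : 0 < padicNorm p M :=
    lt_of_le_of_ne (padicNorm.nonneg _) (Ne.symm (padicNorm.nonzero (by exact_mod_cast hM.ne')))
  obtain ⟨n, hn⟩ := pow_unbounded_of_one_lt ((padicNorm p M)⁻¹) hlt
  obtain ⟨k, hk⟩ := h (x ^ n) (O.pow_mem hx n)
  have h1 : padicNorm p M * padicNorm p (nrd x) ^ n ≤ 1 := by
    have h2 := padicNorm.of_int (p := p) k
    rwa [← hk, hpow, padicNorm.mul, padicNorm_pow] at h2
  rw [inv_lt_iff_one_lt_mul₀ hM0, mul_comm] at hn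
  linarith

theorem exists_int_trd {x : Quat a b} (hx : x ∈ O) : ∃ k : ℤ, trd x = k := by
  obtain ⟨k, hk⟩ := exists_int_nrd hO hx
  obtain ⟨l, hl⟩ := exists_int_nrd hO (O.add_mem hx O.one_mem)
  refine ⟨l - k - 1, ?_⟩
  rw [nrd_add, star_one, mul_one, nrd_one] at hl
  push_cast
  rw [← hl, ← hk]
  ring

theorem star_mem_order {x : Quat a b} (hx : x ∈ O) : star x ∈ O := by
  obtain ⟨k, hk⟩ := exists_int_trd hO hx
  rw [star_eq_trd_sub, hk, Int.cast_smul_eq_zsmul]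
  exact O.sub_mem (O.zsmul_mem O.one_mem k) hx

omit hO

theorem order_ne_bot : Subalgebra.toSubmodule O ≠ ⊥ := fun h => by
  have : (1 : Quat a b) ∈ Subalgebra.toSubmodule O := O.one_mem
  rw [h, Submodule.mem_bot] at this
  exact one_ne_zero this

variable {p : ℕ} [hp : Fact p.Prime]

theorem one_mem_loc : (1 : Quat a b) ∈ loc p (Subalgebra.toSubmodule O) := le_loc _ O.one_mem

theorem mul_mem_loc {x y : Quat a b} (hx : x ∈ loc p (Subalgebra.toSubmodule O))
    (hy : y ∈ loc p (Subalgebra.toSubmodule O)) : x * y ∈ loc p (Subalgebra.toSubmodule O) := by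
  obtain ⟨m, hm, hx⟩ := hx
  obtain ⟨n, hn, hy⟩ := hy
  refine ⟨m * n, fun h => (hp.out.dvd_mul.1 h).elim hm hn, ?_⟩
  have : ((m * n : ℕ) : ℤ) • (x * y) = ((m : ℤ) • x) * ((n : ℤ) • y) := by
    rw [smul_mul_smul_comm, Nat.cast_mul]
  rw [this]
  exact O.mul_mem hx hy

include hO

theorem star_mem_loc {x : Quat a b} (hx : x ∈ loc p (Subalgebra.toSubmodule O)) :
    star x ∈ loc p (Subalgebra.toSubmodule O) := by
  obtain ⟨m, hm, hx⟩ := hx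
  refine ⟨m, hm, ?_⟩
  have : (m : ℤ) • star x = star ((m : ℤ) • x) := by
    ext <;> simp [mul_comm]
  rw [this]
  exact star_mem_order hO hx

theorem padicNorm_nrd_le_one {x : Quat a b} (hx : x ∈ loc p (Subalgebra.toSubmodule O)) :
    padicNorm p (nrd x) ≤ 1 := by
  obtain ⟨m, hm, hx⟩ := hx
  obtain ⟨k, hk⟩ := exists_int_nrd hO hx
  rw [← Int.cast_smul_eq_zsmul ℚ, nrd_smul] at hk
  have h1 := padicNorm.of_int (p := p) k
  rw [← hk, padicNorm.mul, padicNorm_pow, Int.cast_natCast,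
    (padicNorm.nat_eq_one_iff _).2 hm, one_pow, one_mul] at h1
  exact h1

end Order

/-! ### Local generators of left ideals -/

section LocalGenerators

open Module

variable {a b : ℚ}

theorem exists_basis {L : Submodule ℤ (Quat a b)} (hL : L.IsLattice ℚ) :
    ∃ e : Basis (Fin 4) ℚ (Quat a b), Submodule.span ℤ (Set.range e) = L := by
  have : L.IsLattice ℚ := hL
  let b₀ := Module.Free.chooseBasis ℤ L
  have hcard : Fintype.card (Module.Free.ChooseBasisIndex ℤ L) = 4 := by
    rw [← finrank_eq_card_basis (b₀.extendOfIsLattice ℚ), QuaternionAlgebra.finrank_eq_four]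
  let b₁ := b₀.reindex (Fintype.equivFinOfCardEq hcard)
  refine ⟨b₁.extendOfIsLattice ℚ, ?_⟩
  have h1 : Set.range (b₁.extendOfIsLattice ℚ) = L.subtype '' Set.range b₁ := by
    rw [← Set.range_comp]
    congr 1
    funext i
    simp
  rw [h1, ← Submodule.map_span, b₁.span_eq, Submodule.map_top, Submodule.range_subtype]

theorem ne_bot_of_isLattice {L : Submodule ℤ (Quat a b)} (hL : L.IsLattice ℚ) : L ≠ ⊥ := by
  rintro rfl
  have h := hL.span_eq_top
  rw [Submodule.bot_coe, Submodule.span_zero_singleton] at h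
  have : (1 : Quat a b) ∈ (⊥ : Submodule ℚ (Quat a b)) := h ▸ Submodule.mem_top
  exact one_ne_zero ((Submodule.mem_bot _).1 this)

variable {p : ℕ} [hp : Fact p.Prime]

theorem tmul_mem_localize {L : Submodule ℤ (Quat a b)} {x : Quat a b} (hx : x ∈ loc p L) :
    (1 : ℚ_[p]) ⊗ₜ[ℚ] x ∈ localize p L := by
  obtain ⟨m, hm, hx⟩ := hx
  have h1 : (1 : ℚ_[p]) ⊗ₜ[ℚ] ((m : ℤ) • x) ∈ localize p L := Submodule.subset_span ⟨_, hx, rfl⟩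
  have hu : IsUnit (m : ℤ_[p]) := by
    rw [PadicInt.isUnit_iff, PadicInt.norm_natCast_eq_one_iff]
    exact (Nat.Prime.coprime_iff_not_dvd hp.out).2 hm
  obtain ⟨u, hu⟩ := hu
  have h2 : (1 : ℚ_[p]) ⊗ₜ[ℚ] ((m : ℤ) • x) = (m : ℤ_[p]) • ((1 : ℚ_[p]) ⊗ₜ[ℚ] x) := by
    rw [natCast_zsmul, TensorProduct.tmul_smul, Nat.cast_smul_eq_nsmul]
  rw [h2, ← hu] at h1
  have h3 := (localize p L).smul_mem ((u⁻¹ : ℤ_[p]ˣ) : ℤ_[p]) h1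
  rwa [smul_smul, Units.inv_mul, one_smul] at h3

theorem mem_loc_of_tmul_mem_localize {L : Submodule ℤ (Quat a b)} (hL : L.IsLattice ℚ)
    {x : Quat a b} (hx : (1 : ℚ_[p]) ⊗ₜ[ℚ] x ∈ localize p L) : x ∈ loc p L := by
  obtain ⟨e, he⟩ := exists_basis hL
  have heL : ∀ i, e i ∈ L := fun i => he ▸ Submodule.subset_span ⟨i, rfl⟩
  let E := e.baseChange ℚ_[p]
  have hE : ∀ y : Quat a b, ∀ i, E.repr ((1 : ℚ_[p]) ⊗ₜ[ℚ] y) i = (e.repr y i : ℚ_[p]) := by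
    intro y i
    simp [E, Algebra.smul_def]
  have hint : ∀ z ∈ localize p L, ∀ i, ‖E.repr z i‖ ≤ 1 := by
    intro z hz
    induction hz using Submodule.span_induction with
    | mem z hz =>
      obtain ⟨y, hy, rfl⟩ := hz
      intro i
      simp only [hE]
      have h1 : y ∈ Submodule.span ℤ (Set.range e) := he ▸ hy
      obtain ⟨k, hk⟩ := (e.mem_span_iff_repr_mem ℤ y).1 h1 i
      rw [← hk]
      simpa using Padic.norm_int_le_one k
    | zero => simp
    | add z w _ _ hz hw =>
      intro i
      rw [map_add, Finsupp.add_apply]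
      exact (Padic.nonarchimedean _ _).trans (max_le (hz i) (hw i))
    | smul c z _ hz =>
      intro i
      have : c • z = (c : ℚ_[p]) • z := rfl
      rw [this, map_smul, Finsupp.smul_apply, smul_eq_mul, norm_mul]
      exact mul_le_one₀ (PadicInt.norm_le_one c) (norm_nonneg _) (hz i)
  rw [← e.sum_repr x]
  refine Submodule.sum_mem _ fun i _ => smul_mem_loc ?_ (le_loc _ (heL i))
  have h1 := hint _ hx i
  rw [hE, Padic.eq_padicNorm] at h1
  exact_mod_cast h1

theorem localize_fg {L : Submodule ℤ (Quat a b)} (hL : L.FG) : (localize p L).FG := by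
  obtain ⟨S, rfl⟩ := hL
  have : localize p (Submodule.span ℤ (S : Set (Quat a b))) =
      Submodule.span ℤ_[p] ((fun y : Quat a b => (1 : ℚ_[p]) ⊗ₜ[ℚ] y) '' (S : Set (Quat a b))) := by
    refine le_antisymm (Submodule.span_le.2 ?_)
      (Submodule.span_mono (Set.image_mono Submodule.subset_span))
    rintro _ ⟨y, hy, rfl⟩
    simp only [SetLike.mem_coe] at hy ⊢
    induction hy using Submodule.span_induction with
    | mem y hy => exact Submodule.subset_span ⟨y, hy, rfl⟩
    | zero => simp
    | add y z _ _ hy hz => rw [TensorProduct.tmul_add]; exact Submodule.add_mem _ hy hz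
    | smul k y _ hy =>
      have : (1 : ℚ_[p]) ⊗ₜ[ℚ] (k • y) = (k : ℤ_[p]) • ((1 : ℚ_[p]) ⊗ₜ[ℚ] y) := by
        rw [TensorProduct.tmul_smul, Int.cast_smul_eq_zsmul]
      rw [this]
      exact Submodule.smul_mem _ _ hy
  rw [this]
  exact Submodule.fg_span (S.finite_toSet.image _)

theorem localize_loc (L : Submodule ℤ (Quat a b)) : localize p (loc p L) = localize p L := by
  refine le_antisymm (Submodule.span_le.2 ?_) (Submodule.span_mono (Set.image_mono (le_loc L)))
  rintro _ ⟨y, hy, rfl⟩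
  exact tmul_mem_localize hy

/-- An element of the localization is congruent modulo `p` to an element of the lattice. -/
theorem exists_eq_tmul_add {L : Submodule ℤ (Quat a b)} {z : ℚ_[p] ⊗[ℚ] Quat a b}
    (hz : z ∈ localize p L) :
    ∃ y ∈ L, ∃ w ∈ localize p L, z = (1 : ℚ_[p]) ⊗ₜ[ℚ] y + (p : ℤ_[p]) • w := by
  induction hz using Submodule.span_induction with
  | mem z hz =>
    obtain ⟨y, hy, rfl⟩ := hz
    exact ⟨y, hy, 0, Submodule.zero_mem _, by simp⟩
  | zero => exact ⟨0, L.zero_mem, 0, Submodule.zero_mem _, by simp⟩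
  | add z w _ _ hz hw =>
    obtain ⟨y, hy, v, hv, rfl⟩ := hz
    obtain ⟨y', hy', v', hv', rfl⟩ := hw
    refine ⟨y + y', L.add_mem hy hy', v + v', Submodule.add_mem _ hv hv', ?_⟩
    rw [TensorProduct.tmul_add, smul_add]
    abel
  | smul c z _ hz =>
    obtain ⟨y, hy, v, hv, rfl⟩ := hz
    obtain ⟨n, -, hn⟩ := PadicInt.exists_mem_range c
    rw [PadicInt.maximalIdeal_eq_span_p, Ideal.mem_span_singleton] at hn
    obtain ⟨t, ht⟩ := hn
    have hc : c = n + p * t := by rw [← ht]; ring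
    refine ⟨(n : ℤ) • y, L.smul_mem _ hy, t • ((1 : ℚ_[p]) ⊗ₜ[ℚ] y) + c • v,
      Submodule.add_mem _ (Submodule.smul_mem _ _ (Submodule.subset_span ⟨y, hy, rfl⟩))
        (Submodule.smul_mem _ _ hv), ?_⟩
    have h1 : (1 : ℚ_[p]) ⊗ₜ[ℚ] ((n : ℤ) • y) = (n : ℤ_[p]) • ((1 : ℚ_[p]) ⊗ₜ[ℚ] y) := by
      rw [natCast_zsmul, TensorProduct.tmul_smul, Nat.cast_smul_eq_nsmul]
    rw [h1, smul_add, smul_add, smul_smul, smul_smul, smul_smul, ← add_assoc, ← add_smul, ← hc,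
      mul_comm c]

theorem mul_mem_localize {O : Subalgebra ℤ (Quat a b)} {u v : ℚ_[p] ⊗[ℚ] Quat a b}
    (hu : u ∈ localize p (Subalgebra.toSubmodule O))
    (hv : v ∈ localize p (Subalgebra.toSubmodule O)) :
    u * v ∈ localize p (Subalgebra.toSubmodule O) := by
  induction hu using Submodule.span_induction with
  | mem u hu =>
    obtain ⟨x, hx, rfl⟩ := hu
    induction hv using Submodule.span_induction with
    | mem v hv =>
      obtain ⟨y, hy, rfl⟩ := hv
      exact Submodule.subset_span ⟨x * y, O.mul_mem hx hy, by simp⟩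
    | zero => simp
    | add v w _ _ hv hw => rw [mul_add]; exact Submodule.add_mem _ hv hw
    | smul c v _ hv => rw [mul_smul_comm]; exact Submodule.smul_mem _ _ hv
  | zero => simp
  | add u w _ _ hu hw => rw [add_mul]; exact Submodule.add_mem _ hu hw
  | smul c u _ hu => rw [smul_mul_assoc]; exact Submodule.smul_mem _ _ hu

/-- A local generator of a left ideal at `p` can be chosen in `H`: by Nakayama's lemma it can be
replaced by any element of the ideal congruent to it modulo `p`. -/
theorem exists_loc_eq_of_localize_eq (ha : a < 0) (hb : b < 0) {O : Subalgebra ℤ (Quat a b)}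
    (hO : (Subalgebra.toSubmodule O).IsLattice ℚ) {L : Submodule ℤ (Quat a b)}
    (hL : L.IsLattice ℚ) (x : (ℚ_[p] ⊗[ℚ] Quat a b)ˣ)
    (h : (localize p L : Set (ℚ_[p] ⊗[ℚ] Quat a b)) =
        (fun z => z * (x : ℚ_[p] ⊗[ℚ] Quat a b)) '' (localize p (Subalgebra.toSubmodule O))) :
    ∃ y : (Quat a b)ˣ, loc p L = rmul (loc p (Subalgebra.toSubmodule O)) y := by
  have hmem : ∀ z, z ∈ localize p L ↔ ∃ v ∈ localize p (Subalgebra.toSubmodule O),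
      v * (x : ℚ_[p] ⊗[ℚ] Quat a b) = z := by
    intro z
    rw [← SetLike.mem_coe, h]; rfl
  have h1O : (1 : ℚ_[p] ⊗[ℚ] Quat a b) ∈ localize p (Subalgebra.toSubmodule O) :=
    Submodule.subset_span ⟨1, O.one_mem, rfl⟩
  obtain ⟨y, hy, w', hw', hxy⟩ := exists_eq_tmul_add ((hmem x).2 ⟨1, h1O, one_mul _⟩)
  obtain ⟨w, hw, rfl⟩ := (hmem _).1 hw'
  -- otherwise `p⁻¹` would be integral over `ℤ_p`, contradicting the integrality of norms
  have hy0 : y ≠ 0 := by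
    rintro rfl
    rw [TensorProduct.tmul_zero, zero_add, ← smul_mul_assoc] at hxy
    have h2 : (p : ℤ_[p]) • w = 1 := by
      have := congrArg (fun z => z * ((x⁻¹ : (ℚ_[p] ⊗[ℚ] Quat a b)ˣ) : ℚ_[p] ⊗[ℚ] Quat a b)) hxy
      simpa [mul_assoc] using this.symm
    have hp0 : (p : ℚ) ≠ 0 := by exact_mod_cast hp.out.ne_zero
    have h3 : w = (1 : ℚ_[p]) ⊗ₜ[ℚ] ((p : ℚ)⁻¹ • (1 : Quat a b)) := by
      have h4 : (p : ℚ) • w = 1 := by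
        rw [← h2, Nat.cast_smul_eq_nsmul, Nat.cast_smul_eq_nsmul]
      rw [TensorProduct.tmul_smul, ← Algebra.TensorProduct.one_def, ← h4, smul_smul,
        inv_mul_cancel₀ hp0, one_smul]
    rw [h3] at hw
    have h5 := padicNorm_nrd_le_one hO (mem_loc_of_tmul_mem_localize hO hw)
    rw [nrd_smul, nrd_one, mul_one, padicNorm_pow, ← one_div, padicNorm.div, padicNorm.one,
      padicNorm.padicNorm_p_of_prime] at h5
    have h6 : (1 : ℚ) < p := by exact_mod_cast hp.out.one_lt
    rw [one_div, inv_inv] at h5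
    nlinarith
  obtain ⟨u, rfl⟩ := exists_unit_eq ha hb hy0
  refine ⟨u, ?_⟩
  have hmem' : ∀ z, z ∈ localize p (rmul (Subalgebra.toSubmodule O) u) ↔
      ∃ v ∈ localize p (Subalgebra.toSubmodule O), v * ((1 : ℚ_[p]) ⊗ₜ[ℚ] (u : Quat a b)) = z := by
    intro z
    rw [← SetLike.mem_coe, localize_rmul]; rfl
  have huL : (1 : ℚ_[p]) ⊗ₜ[ℚ] (u : Quat a b) ∈ localize p L := Submodule.subset_span ⟨_, hy, rfl⟩
  have hle : localize p (rmul (Subalgebra.toSubmodule O) u) ≤ localize p L := by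
    intro z hz
    obtain ⟨v, hv, rfl⟩ := (hmem' z).1 hz
    obtain ⟨v', hv', h'⟩ := (hmem _).1 huL
    rw [← h', ← mul_assoc]
    exact (hmem _).2 ⟨_, mul_mem_localize hv hv', rfl⟩
  -- the generator `x` equals `u` modulo `p L_p`, so Nakayama applies
  have hge : localize p L ≤ localize p (rmul (Subalgebra.toSubmodule O) u) := by
    refine Submodule.le_of_le_smul_of_le_jacobson_bot (I := Ideal.span {(p : ℤ_[p])})
      (localize_fg hL.fg) ?_ ?_
    · rw [← PadicInt.maximalIdeal_eq_span_p]
      exact IsLocalRing.maximalIdeal_le_jacobson _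
    · intro z hz
      obtain ⟨v, hv, rfl⟩ := (hmem z).1 hz
      rw [hxy, mul_add]
      refine Submodule.add_mem_sup ((hmem' _).2 ⟨v, hv, rfl⟩) ?_
      rw [mul_smul_comm, ← mul_assoc]
      exact Submodule.smul_mem_smul (Ideal.mem_span_singleton_self _)
        ((hmem _).2 ⟨_, mul_mem_localize hv hw, rfl⟩)
  have heq := le_antisymm hle hge
  have hlat : (rmul (Subalgebra.toSubmodule O) u).IsLattice ℚ := by
    refine ⟨hO.fg.map _, ?_⟩
    have h1 : Submodule.span ℚ ((rmul (Subalgebra.toSubmodule O) u : Submodule ℤ (Quat a b)) :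
        Set (Quat a b)) = (Submodule.span ℚ (Subalgebra.toSubmodule O : Set (Quat a b))).map
          (LinearMap.mulRight ℚ (u : Quat a b)) := by
      rw [Submodule.map_span]; rfl
    rw [h1, hO.span_eq_top, Submodule.map_top, LinearMap.range_eq_top]
    intro y
    exact ⟨y * (u⁻¹ : (Quat a b)ˣ), by simp [mul_assoc]⟩
  rw [← loc_rmul]
  ext z
  exact ⟨fun hz => mem_loc_of_tmul_mem_localize hlat (heq ▸ tmul_mem_localize hz),
    fun hz => mem_loc_of_tmul_mem_localize hL (heq.symm ▸ tmul_mem_localize hz)⟩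

/-- Being a left ideal can be checked in `H`, with the localizations `loc p` instead of the
completions. -/
theorem isLeftIdeal_iff (ha : a < 0) (hb : b < 0) {O : Subalgebra ℤ (Quat a b)}
    (hO : (Subalgebra.toSubmodule O).IsLattice ℚ) {L : Submodule ℤ (Quat a b)} :
    IsLeftIdeal O L ↔ L.IsLattice ℚ ∧ ∀ (p : ℕ) [Fact p.Prime], ∃ y : (Quat a b)ˣ,
      loc p L = rmul (loc p (Subalgebra.toSubmodule O)) y := by
  refine and_congr_right fun hL => forall_congr' fun p => forall_congr' fun _ => ⟨?_, ?_⟩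
  · rintro ⟨x, hx⟩
    exact exists_loc_eq_of_localize_eq ha hb hO hL x hx
  · rintro ⟨y, hy⟩
    refine ⟨Units.map (Algebra.TensorProduct.includeRight :
      Quat a b →ₐ[ℚ] ℚ_[p] ⊗[ℚ] Quat a b).toMonoidHom y, ?_⟩
    rw [← localize_loc L, hy, localize_rmul, localize_loc]
    rfl

end LocalGenerators

/-! ### Lattices that are locally similar to an order -/

section Lattice

variable {a b : ℚ}

theorem exists_smul_mem {L : Submodule ℤ (Quat a b)} (hL : L.IsLattice ℚ) (x : Quat a b) :
    ∃ m : ℕ, 0 < m ∧ (m : ℤ) • x ∈ L := by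
  have hx : x ∈ Submodule.span ℚ (L : Set (Quat a b)) := by rw [hL.span_eq_top]; trivial
  induction hx using Submodule.span_induction with
  | mem x hx => exact ⟨1, one_pos, by simpa using hx⟩
  | zero => exact ⟨1, one_pos, by simp⟩
  | add x y _ _ hx hy =>
    obtain ⟨m, hm, hx⟩ := hx
    obtain ⟨n, hn, hy⟩ := hy
    refine ⟨m * n, mul_pos hm hn, ?_⟩
    rw [smul_add]
    refine L.add_mem ?_ ?_
    · rw [Nat.cast_mul, mul_comm, mul_smul]
      exact L.smul_mem _ hx
    · rw [Nat.cast_mul, mul_smul]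
      exact L.smul_mem _ hy
  | smul r x _ hx =>
    obtain ⟨m, hm, hx⟩ := hx
    refine ⟨r.den * m, mul_pos r.pos hm, ?_⟩
    have : ((r.den * m : ℕ) : ℤ) • r • x = r.num • ((m : ℤ) • x) := by
      simp only [← Int.cast_smul_eq_zsmul ℚ, smul_smul]
      congr 1
      push_cast
      rw [← Rat.mul_den_eq_num r]
      ring
    rw [this]
    exact L.smul_mem _ hx

theorem exists_smul_le {L M : Submodule ℤ (Quat a b)} (hL : L.FG) (hM : M.IsLattice ℚ) :
    ∃ m : ℕ, 0 < m ∧ ∀ x ∈ L, (m : ℤ) • x ∈ M := by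
  induction L, hL using Submodule.fg_induction with
  | singleton x =>
    obtain ⟨m, hm, hx⟩ := exists_smul_mem hM x
    refine ⟨m, hm, fun y hy => ?_⟩
    obtain ⟨c, rfl⟩ := Submodule.mem_span_singleton.1 hy
    rw [smul_comm]
    exact M.smul_mem _ hx
  | sup L₁ L₂ _ _ h₁ h₂ =>
    obtain ⟨m, hm, h₁⟩ := h₁
    obtain ⟨n, hn, h₂⟩ := h₂
    refine ⟨m * n, mul_pos hm hn, fun x hx => ?_⟩
    obtain ⟨y, hy, z, hz, rfl⟩ := Submodule.mem_sup.1 hx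
    rw [smul_add]
    refine M.add_mem ?_ ?_
    · rw [Nat.cast_mul, mul_comm, mul_smul]
      exact M.smul_mem _ (h₁ y hy)
    · rw [Nat.cast_mul, mul_smul]
      exact M.smul_mem _ (h₂ z hz)

theorem exists_smul_le_of_le_loc {p : ℕ} [hp : Fact p.Prime] {L M : Submodule ℤ (Quat a b)}
    (hL : L.FG) (h : L ≤ loc p M) : ∃ m : ℕ, ¬ p ∣ m ∧ ∀ x ∈ L, (m : ℤ) • x ∈ M := by
  induction L, hL using Submodule.fg_induction with
  | singleton x =>
    obtain ⟨m, hm, hx⟩ := h (Submodule.mem_span_singleton_self x)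
    refine ⟨m, hm, fun y hy => ?_⟩
    obtain ⟨c, rfl⟩ := Submodule.mem_span_singleton.1 hy
    rw [smul_comm]
    exact M.smul_mem _ hx
  | sup L₁ L₂ _ _ h₁ h₂ =>
    obtain ⟨m, hm, h₁⟩ := h₁ (le_sup_left.trans h)
    obtain ⟨n, hn, h₂⟩ := h₂ (le_sup_right.trans h)
    refine ⟨m * n, fun h => (hp.out.dvd_mul.1 h).elim hm hn, fun x hx => ?_⟩
    obtain ⟨y, hy, z, hz, rfl⟩ := Submodule.mem_sup.1 hx
    rw [smul_add]
    refine M.add_mem ?_ ?_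
    · rw [Nat.cast_mul, mul_comm, mul_smul]
      exact M.smul_mem _ (h₁ y hy)
    · rw [Nat.cast_mul, mul_smul]
      exact M.smul_mem _ (h₂ z hz)

theorem fg_of_le {L M : Submodule ℤ (Quat a b)} (hM : M.FG) (h : L ≤ M) : L.FG := by
  have : IsNoetherian ℤ M := isNoetherian_of_fg_of_noetherian M hM
  have h1 : (L.comap M.subtype).FG := IsNoetherian.noetherian _
  have h2 := h1.map M.subtype
  rwa [Submodule.map_comap_eq_of_le (by rwa [Submodule.range_subtype])] at h2

/-- The lattice of all `x` with `𝔞 x ⊆ 𝔟`. -/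
def colon (𝔞 𝔟 : Submodule ℤ (Quat a b)) : Submodule ℤ (Quat a b) where
  carrier := {x | ∀ r ∈ 𝔞, r * x ∈ 𝔟}
  add_mem' := fun hx hy r hr => by rw [mul_add]; exact 𝔟.add_mem (hx r hr) (hy r hr)
  zero_mem' := fun r _ => by simp
  smul_mem' := fun c x hx r hr => by rw [mul_smul_comm]; exact 𝔟.smul_mem _ (hx r hr)

theorem isLattice_colon (ha : a < 0) (hb : b < 0) {𝔞 𝔟 : Submodule ℤ (Quat a b)}
    (h𝔞 : 𝔞.IsLattice ℚ) (h𝔟 : 𝔟.IsLattice ℚ) : (colon 𝔞 𝔟).IsLattice ℚ := by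
  refine ⟨?_, ?_⟩
  · obtain ⟨r, hr, hr0⟩ := Submodule.exists_mem_ne_zero_of_ne_bot (ne_bot_of_isLattice h𝔞)
    obtain ⟨u, rfl⟩ := exists_unit_eq ha hb hr0
    refine fg_of_le
      (h𝔟.fg.map (LinearMap.mulLeft ℤ ((u⁻¹ : (Quat a b)ˣ) : Quat a b))) fun x hx => ?_
    exact ⟨_, hx _ hr, by simp [← mul_assoc]⟩
  · rw [eq_top_iff]
    intro x _
    obtain ⟨m, hm, h⟩ := exists_smul_le (h𝔞.fg.map (LinearMap.mulRight ℤ x)) h𝔟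
    have hm0 : (m : ℚ) ≠ 0 := by exact_mod_cast hm.ne'
    have h1 : (m : ℤ) • x ∈ colon 𝔞 𝔟 := fun r hr => by
      rw [mul_smul_comm]
      exact h _ ⟨r, hr, rfl⟩
    have h2 : x = (m : ℚ)⁻¹ • ((m : ℤ) • x) := by
      rw [← Int.cast_smul_eq_zsmul ℚ, smul_smul, Int.cast_natCast, inv_mul_cancel₀ hm0, one_smul]
    rw [h2]
    exact Submodule.smul_mem _ _ (Submodule.subset_span h1)

theorem mem_loc_colon {p : ℕ} [Fact p.Prime] {𝔞 𝔟 : Submodule ℤ (Quat a b)} (h𝔞 : 𝔞.FG)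
    {x : Quat a b} : x ∈ loc p (colon 𝔞 𝔟) ↔ ∀ r ∈ 𝔞, r * x ∈ loc p 𝔟 := by
  constructor
  · rintro ⟨m, hm, hx⟩ r hr
    exact ⟨m, hm, by rw [← mul_smul_comm]; exact hx r hr⟩
  · intro h
    obtain ⟨m, hm, hx⟩ := exists_smul_le_of_le_loc (p := p) (M := 𝔟)
      (h𝔞.map (LinearMap.mulRight ℤ x)) (by rintro _ ⟨r, hr, rfl⟩; exact h r hr)
    exact ⟨m, hm, fun r hr => by rw [mul_smul_comm]; exact hx _ ⟨r, hr, rfl⟩⟩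

theorem mem_loc_of_smul_mem_loc {p : ℕ} [hp : Fact p.Prime] {L : Submodule ℤ (Quat a b)}
    {x : Quat a b} {m : ℕ} (hm : ¬ p ∣ m) (h : (m : ℤ) • x ∈ loc p L) : x ∈ loc p L := by
  rw [← loc_loc L]
  exact ⟨m, hm, h⟩

variable (O : Subalgebra ℤ (Quat a b))

/-- `L_p = y⁻¹ O_p z`. -/
def LocSimilar (p : ℕ) [Fact p.Prime] (L : Submodule ℤ (Quat a b)) (y z : (Quat a b)ˣ) : Prop :=
  ∀ x : Quat a b, x ∈ loc p L ↔ (y : Quat a b) * x * ((z⁻¹ : (Quat a b)ˣ) : Quat a b) ∈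
    loc p (Subalgebra.toSubmodule O)

/-- A lattice which at every prime `p` has the form `y⁻¹ O_p z`. The lattices `𝔞⁻¹ 𝔟` attached to
two left ideals are of this kind, and so are the left ideals themselves. -/
structure IsLocallySimilar (L : Submodule ℤ (Quat a b)) : Prop where
  isLattice : L.IsLattice ℚ
  exists_locSimilar : ∀ (p : ℕ) [Fact p.Prime], ∃ y z : (Quat a b)ˣ, LocSimilar O p L y z

end Lattice

section Similar

variable {a b : ℚ} (ha : a < 0) (hb : b < 0) {O : Subalgebra ℤ (Quat a b)}
  (hO : (Subalgebra.toSubmodule O).IsLattice ℚ) {p : ℕ} [hp : Fact p.Prime]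
include ha hb hO

theorem IsLeftIdeal.exists_gen {𝔞 : Submodule ℤ (Quat a b)} (h : IsLeftIdeal O 𝔞) (p : ℕ)
    [Fact p.Prime] : ∃ y : (Quat a b)ˣ, LocSimilar O p 𝔞 1 y := by
  obtain ⟨y, hy⟩ := ((isLeftIdeal_iff ha hb hO).1 h).2 p
  refine ⟨y, fun x => ?_⟩
  rw [hy, mem_rmul, Units.val_one, one_mul]

theorem IsLeftIdeal.isLocallySimilar {𝔞 : Submodule ℤ (Quat a b)} (h : IsLeftIdeal O 𝔞) :
    IsLocallySimilar O 𝔞 :=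
  ⟨h.1, fun p _ => ⟨1, h.exists_gen ha hb hO p⟩⟩

omit ha hb hO in
theorem gen_mem_loc {L : Submodule ℤ (Quat a b)} {y z : (Quat a b)ˣ} (h : LocSimilar O p L y z) :
    ((y⁻¹ * z : (Quat a b)ˣ) : Quat a b) ∈ loc p L := by
  rw [h, ← Units.val_mul, ← Units.val_mul]
  have : y * (y⁻¹ * z) * z⁻¹ = 1 := by group
  rw [this]
  exact one_mem_loc

theorem padicNorm_latticeNorm {L : Submodule ℤ (Quat a b)} (hL : L.IsLattice ℚ)
    {y z : (Quat a b)ˣ} (h : LocSimilar O p L y z) :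
    padicNorm p (latticeNorm L) = padicNorm p (nrd (z : Quat a b) / nrd (y : Quat a b)) := by
  have hy := nrd_unit_ne_zero y
  have hz := nrd_unit_ne_zero z
  refine le_antisymm ?_ ?_
  · refine padicNorm_latticeNorm_le ha hb hL.fg (ne_bot_of_isLattice hL) (padicNorm.nonneg _)
      fun x hx => ?_
    have h1 := padicNorm_nrd_le_one hO ((h x).1 (le_loc L hx))
    have h2 : nrd x = nrd ((y : Quat a b) * x * ((z⁻¹ : (Quat a b)ˣ) : Quat a b)) *
        (nrd (z : Quat a b) / nrd (y : Quat a b)) := by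
      rw [nrd_mul, nrd_mul, nrd_unit_inv]
      field_simp
    rw [h2, padicNorm.mul]
    exact mul_le_of_le_one_left (padicNorm.nonneg _) h1
  · obtain ⟨m, hm, hx⟩ := gen_mem_loc h
    have h1 := padicNorm_nrd_le (p := p) ha hb hL.fg (ne_bot_of_isLattice hL) hx
    rw [← Int.cast_smul_eq_zsmul ℚ, nrd_smul, padicNorm.mul, padicNorm_pow, Int.cast_natCast,
      (padicNorm.nat_eq_one_iff _).2 hm, one_pow, one_mul, Units.val_mul, nrd_mul,
      nrd_unit_inv] at h1
    rwa [div_eq_inv_mul]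

theorem padicNorm_nrd_div {L : Submodule ℤ (Quat a b)} (hL : L.IsLattice ℚ)
    {y z : (Quat a b)ˣ} (h : LocSimilar O p L y z) (x : Quat a b) :
    padicNorm p (nrd x / latticeNorm L) =
      padicNorm p (nrd ((y : Quat a b) * x * ((z⁻¹ : (Quat a b)ˣ) : Quat a b))) := by
  have hy := padicNorm.nonzero (p := p) (nrd_unit_ne_zero y)
  have hz := padicNorm.nonzero (p := p) (nrd_unit_ne_zero z)
  rw [padicNorm.div, padicNorm_latticeNorm ha hb hO hL h, nrd_mul, nrd_mul, nrd_unit_inv,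
    ← one_div, padicNorm.mul, padicNorm.mul, padicNorm.div, padicNorm.div, padicNorm.one]
  field_simp

theorem padicNorm_trd_div {L : Submodule ℤ (Quat a b)} (hL : L.IsLattice ℚ)
    {y z : (Quat a b)ˣ} (h : LocSimilar O p L y z) (x w : Quat a b) :
    padicNorm p (trd (x * star w) / latticeNorm L) =
      padicNorm p (trd (((y : Quat a b) * x * ((z⁻¹ : (Quat a b)ˣ) : Quat a b)) *
        star ((y : Quat a b) * w * ((z⁻¹ : (Quat a b)ˣ) : Quat a b)))) := by
  have hy := padicNorm.nonzero (p := p) (nrd_unit_ne_zero y)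
  have hz := padicNorm.nonzero (p := p) (nrd_unit_ne_zero z)
  have h1 : trd (((y : Quat a b) * x * ((z⁻¹ : (Quat a b)ˣ) : Quat a b)) *
        star ((y : Quat a b) * w * ((z⁻¹ : (Quat a b)ˣ) : Quat a b))) =
      nrd (y : Quat a b) * trd (x * star w) / nrd (z : Quat a b) := by
    have h2 : ((y : Quat a b) * x * ((z⁻¹ : (Quat a b)ˣ) : Quat a b)) *
        star ((y : Quat a b) * w * ((z⁻¹ : (Quat a b)ˣ) : Quat a b)) =
        (y : Quat a b) * (x * ((((z⁻¹ : (Quat a b)ˣ) : Quat a b)) * star ((z⁻¹ : (Quat a b)ˣ) : Quat a b)) *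
          star w * star (y : Quat a b)) := by
      simp only [star_mul, mul_assoc]
    rw [h2, trd_mul_comm, mul_star_self_eq, nrd_unit_inv, mul_assoc, star_mul_self_eq]
    simp only [mul_smul_comm, smul_mul_assoc, mul_one, trd_smul]
    ring
  rw [h1, padicNorm.div, padicNorm_latticeNorm ha hb hO hL h]
  simp only [padicNorm.div, padicNorm.mul]
  field_simp

omit ha hb hO in
theorem locSimilar_colon {𝔞 𝔟 : Submodule ℤ (Quat a b)} (h𝔞 : IsLeftIdeal O 𝔞)
    {y z : (Quat a b)ˣ} (hy : LocSimilar O p 𝔞 1 y) (hz : LocSimilar O p 𝔟 1 z) :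
    LocSimilar O p (colon 𝔞 𝔟) y z := by
  intro x
  rw [mem_loc_colon h𝔞.1.fg]
  constructor
  · intro h
    obtain ⟨m, hm, hy'⟩ := gen_mem_loc hy
    rw [inv_one, one_mul] at hy'
    have h1 := (hz _).1 (h _ hy')
    rw [smul_mul_assoc, Units.val_one, one_mul, smul_mul_assoc] at h1
    exact mem_loc_of_smul_mem_loc hm h1
  · intro h r hr
    rw [hz, Units.val_one, one_mul]
    have h1 := (hy r).1 (le_loc _ hr)
    rw [Units.val_one, one_mul] at h1
    have h2 := mul_mem_loc h1 h
    have h3 : r * ((y⁻¹ : (Quat a b)ˣ) : Quat a b) *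
        ((y : Quat a b) * x * ((z⁻¹ : (Quat a b)ˣ) : Quat a b)) = r * x * ((z⁻¹ : (Quat a b)ˣ) : Quat a b) := by
      rw [← mul_assoc, ← mul_assoc, mul_assoc r, Units.inv_mul, mul_one]
    rwa [h3] at h2

theorem isLocallySimilar_colon {𝔞 𝔟 : Submodule ℤ (Quat a b)} (h𝔞 : IsLeftIdeal O 𝔞)
    (h𝔟 : IsLeftIdeal O 𝔟) : IsLocallySimilar O (colon 𝔞 𝔟) := by
  refine ⟨isLattice_colon ha hb h𝔞.1 h𝔟.1, fun p _ => ?_⟩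
  obtain ⟨y, hy⟩ := h𝔞.exists_gen ha hb hO p
  obtain ⟨z, hz⟩ := h𝔟.exists_gen ha hb hO p
  exact ⟨y, z, locSimilar_colon h𝔞 hy hz⟩

theorem latticeNorm_colon {𝔞 𝔟 : Submodule ℤ (Quat a b)} (h𝔞 : IsLeftIdeal O 𝔞)
    (h𝔟 : IsLeftIdeal O 𝔟) : latticeNorm (colon 𝔞 𝔟) = latticeNorm 𝔟 / latticeNorm 𝔞 := by
  have h := isLocallySimilar_colon ha hb hO h𝔞 h𝔟
  refine eq_of_padicNorm_eq (latticeNorm_pos ha hb h.1.fg (ne_bot_of_isLattice h.1))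
    (div_pos (latticeNorm_pos ha hb h𝔟.1.fg (ne_bot_of_isLattice h𝔟.1))
      (latticeNorm_pos ha hb h𝔞.1.fg (ne_bot_of_isLattice h𝔞.1))) fun p _ => ?_
  obtain ⟨y, hy⟩ := h𝔞.exists_gen ha hb hO p
  obtain ⟨z, hz⟩ := h𝔟.exists_gen ha hb hO p
  rw [padicNorm_latticeNorm ha hb hO h.1 (locSimilar_colon h𝔞 hy hz), padicNorm.div,
    padicNorm.div, padicNorm_latticeNorm ha hb hO h𝔟.1 hz, padicNorm_latticeNorm ha hb hO h𝔞.1 hy,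
    Units.val_one, nrd_one, div_one, div_one]

theorem IsLeftIdeal.mul_mem {𝔞 : Submodule ℤ (Quat a b)} (h : IsLeftIdeal O 𝔞) {r x : Quat a b}
    (hr : r ∈ O) (hx : x ∈ 𝔞) : r * x ∈ 𝔞 := by
  refine mem_of_forall_mem_loc fun p _ => ?_
  obtain ⟨y, hy⟩ := h.exists_gen ha hb hO p
  have h1 := (hy x).1 (le_loc _ hx)
  rw [hy, Units.val_one, one_mul]
  rw [Units.val_one, one_mul] at h1
  rw [mul_assoc]
  exact mul_mem_loc (le_loc _ hr) h1

omit ha hb in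
theorem isLeftIdeal_order : IsLeftIdeal O (Subalgebra.toSubmodule O) :=
  ⟨hO, fun p _ => ⟨1, by simp⟩⟩

theorem colon_order {𝔞 : Submodule ℤ (Quat a b)} (h : IsLeftIdeal O 𝔞) :
    colon (Subalgebra.toSubmodule O) 𝔞 = 𝔞 := by
  refine le_antisymm (fun x hx => ?_) fun x hx r hr => h.mul_mem ha hb hO hr hx
  simpa using hx 1 O.one_mem

theorem latticeNorm_order : latticeNorm (Subalgebra.toSubmodule O) = 1 := by
  have h := latticeNorm_colon ha hb hO (isLeftIdeal_order hO) (isLeftIdeal_order hO)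
  rwa [colon_order ha hb hO (isLeftIdeal_order hO), div_self
    (latticeNorm_pos ha hb hO.fg order_ne_bot).ne'] at h

/-- The lattice `𝔞⁻¹ 𝔟` consists of the `x` with `𝔞 x ⊆ 𝔟`. -/
theorem invLattice_mul_eq_colon {𝔞 𝔟 : Submodule ℤ (Quat a b)} (h𝔞 : IsLeftIdeal O 𝔞)
    (h𝔟 : IsLeftIdeal O 𝔟) : invLattice 𝔞 * 𝔟 = colon 𝔞 𝔟 := by
  refine le_antisymm (Submodule.mul_le.2 fun s hs t ht r hr => ?_)
    (le_of_forall_loc_le fun p _ x hx => ?_)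
  · -- locally `r s` lies in `O_p` for `r ∈ 𝔞` and `s ∈ 𝔞⁻¹`
    refine mem_of_forall_mem_loc fun p _ => ?_
    obtain ⟨y, hy⟩ := h𝔞.exists_gen ha hb hO p
    obtain ⟨z, hz⟩ := h𝔟.exists_gen ha hb hO p
    have h1 : r * s ∈ loc p (Subalgebra.toSubmodule O) := by
      obtain ⟨m, hm, hy'⟩ := gen_mem_loc hy
      rw [inv_one, one_mul] at hy'
      have h2 := (hy _).1 (le_loc _ (hs r hr _ hy'))
      rw [mul_smul_comm, Units.val_one, one_mul, smul_mul_assoc, mul_assoc, Units.mul_inv,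
        mul_one] at h2
      exact mem_loc_of_smul_mem_loc hm h2
    have h3 := (hz t).1 (le_loc _ ht)
    rw [hz]
    rw [Units.val_one, one_mul] at h3 ⊢
    have h4 := mul_mem_loc h1 h3
    simpa only [mul_assoc] using h4
  · obtain ⟨y, hy⟩ := h𝔞.exists_gen ha hb hO p
    obtain ⟨z, hz⟩ := h𝔟.exists_gen ha hb hO p
    -- the inverse of a local generator of `𝔞` lies in `𝔞⁻¹` at `p`
    have hy1 : ((y⁻¹ : (Quat a b)ˣ) : Quat a b) ∈ loc p (invLattice 𝔞) := by
      obtain ⟨m, hm, h⟩ := exists_smul_le_of_le_loc (p := p) (M := 𝔞)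
        ((h𝔞.1.fg.map (LinearMap.mulRight ℤ ((y⁻¹ : (Quat a b)ˣ) : Quat a b))).mul h𝔞.1.fg) (by
          refine Submodule.mul_le.2 ?_
          rintro _ ⟨r, hr, rfl⟩ s hs
          have h1 := (hy r).1 (le_loc _ hr)
          have h2 := (hy s).1 (le_loc _ hs)
          rw [hy]
          simp only [Units.val_one, one_mul, LinearMap.mulRight_apply] at h1 h2 ⊢
          rw [mul_assoc]
          exact mul_mem_loc h1 h2)
      refine ⟨m, hm, fun r hr s hs => ?_⟩
      rw [mul_smul_comm, smul_mul_assoc]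
      exact h _ (Submodule.mul_mem_mul ⟨r, hr, rfl⟩ hs)
    have hx1 := (locSimilar_colon h𝔞 hy hz x).1 (le_loc _ hx)
    have hx2 : (y : Quat a b) * x ∈ loc p 𝔟 := by
      rw [hz, Units.val_one, one_mul]
      exact hx1
    obtain ⟨m, hm, h1⟩ := hy1
    obtain ⟨n, hn, h2⟩ := hx2
    refine ⟨m * n, fun h => ((Fact.out : p.Prime).dvd_mul.1 h).elim hm hn, ?_⟩
    have h3 : ((m * n : ℕ) : ℤ) • x =
        ((m : ℤ) • ((y⁻¹ : (Quat a b)ˣ) : Quat a b)) * ((n : ℤ) • ((y : Quat a b) * x)) := by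
      rw [smul_mul_smul_comm, ← mul_assoc, Units.inv_mul, one_mul, Nat.cast_mul]
    rw [h3]
    exact Submodule.mul_mem_mul h1 h2

/-- Conjugation, suitably scaled, exchanges `𝔞⁻¹ 𝔟` and `𝔟⁻¹ 𝔞`. -/
theorem smul_star_mem_colon {𝔞 𝔟 : Submodule ℤ (Quat a b)} (h𝔞 : IsLeftIdeal O 𝔞)
    (h𝔟 : IsLeftIdeal O 𝔟) {x : Quat a b} (hx : x ∈ colon 𝔞 𝔟) :
    (latticeNorm (colon 𝔞 𝔟))⁻¹ • star x ∈ colon 𝔟 𝔞 := by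
  have hc := isLocallySimilar_colon ha hb hO h𝔞 h𝔟
  refine mem_of_forall_mem_loc fun p _ => ?_
  obtain ⟨y, hy⟩ := h𝔞.exists_gen ha hb hO p
  obtain ⟨z, hz⟩ := h𝔟.exists_gen ha hb hO p
  have hyz := locSimilar_colon h𝔞 hy hz
  rw [locSimilar_colon h𝔟 hz hy]
  have h1 := star_mem_loc hO ((hyz x).1 (le_loc _ hx))
  have h2 : (z : Quat a b) * ((latticeNorm (colon 𝔞 𝔟))⁻¹ • star x) *
      ((y⁻¹ : (Quat a b)ˣ) : Quat a b) =
      ((latticeNorm (colon 𝔞 𝔟))⁻¹ * (nrd (z : Quat a b) / nrd (y : Quat a b))) •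
        star ((y : Quat a b) * x * ((z⁻¹ : (Quat a b)ˣ) : Quat a b)) := by
    rw [unit_inv_eq y, unit_inv_eq z]
    simp only [star_mul, star_smul, star_star, mul_smul_comm, smul_mul_assoc, smul_smul,
      mul_assoc, star_trivial]
    congr 1
    have := nrd_unit_ne_zero z
    field_simp
  rw [h2]
  refine smul_mem_loc ?_ h1
  rw [padicNorm.mul, ← padicNorm_latticeNorm ha hb hO hc.1 hyz, ← padicNorm.mul, inv_mul_cancel₀
    (latticeNorm_pos ha hb hc.1.fg (ne_bot_of_isLattice hc.1)).ne', padicNorm.one]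

end Similar

/-! ### Gram matrices -/

section Gram

open Matrix

variable {a b : ℚ}

/-- Coordinates on a lattice `L` together with an integral matrix of the quadratic form
`x ↦ N x / N L` in these coordinates. -/
structure GramData (L : Submodule ℤ (Quat a b)) where
  /-- the coordinates -/
  coord : L ≃ₗ[ℤ] (Fin 4 → ℤ)
  /-- the matrix -/
  form : Matrix (Fin 4) (Fin 4) ℤ
  nrd_eq : ∀ x : L, nrd (x : Quat a b) = (qform form (coord x) : ℤ) * latticeNorm L

theorem GramData.trd_eq {L : Submodule ℤ (Quat a b)} (g : GramData L) (x w : L) :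
    trd ((x : Quat a b) * star (w : Quat a b)) =
      ((g.coord x ⬝ᵥ (g.form + g.formᵀ) *ᵥ g.coord w : ℤ) : ℚ) * latticeNorm L := by
  have h := g.nrd_eq (x + w)
  rw [map_add, qform_add, Submodule.coe_add, nrd_add, g.nrd_eq x, g.nrd_eq w] at h
  push_cast at h ⊢
  linarith

/-- The matrix of the coordinates of `e` with respect to `1, i, j, ij`. -/
def coordMatrix (e : Fin 4 → Quat a b) : Matrix (Fin 4) (Fin 4) ℚ :=
  Matrix.of fun i k => ![(e i).re, (e i).imI, (e i).imJ, (e i).imK] k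

theorem trd_mul_star_eq (e : Fin 4 → Quat a b) :
    (Matrix.of fun i j => trd (e i * star (e j))) =
      coordMatrix e * Matrix.diagonal ![2, -2 * a, -2 * b, 2 * (a * b)] * (coordMatrix e)ᵀ := by
  ext i j
  rw [Matrix.mul_apply]
  simp only [Matrix.mul_diagonal, Fin.sum_univ_four, coordMatrix, Matrix.transpose_apply,
    Matrix.of_apply, QuatTheta.trd_eq]
  simp
  ring

theorem det_trd_mul_star (e : Fin 4 → Quat a b) :
    (Matrix.of fun i j => trd (e i * star (e j))).det =
      (4 * (a * b) * (coordMatrix e).det) ^ 2 := by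
  rw [trd_mul_star_eq, Matrix.det_mul, Matrix.det_mul, Matrix.det_transpose, Matrix.det_diagonal,
    Fin.prod_univ_four]
  simp
  ring

theorem IsLatticeBasis.linearIndependent_rat {L : Submodule ℤ (Quat a b)} {e : Fin 4 → Quat a b}
    (h : IsLatticeBasis L e) : LinearIndependent ℚ e :=
  (LinearIndependent.iff_fractionRing ℤ ℚ).1 h.1

theorem IsLatticeBasis.det_ne_zero {L : Submodule ℤ (Quat a b)} {e : Fin 4 → Quat a b}
    (h : IsLatticeBasis L e) : (coordMatrix e).det ≠ 0 := by
  intro h0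
  obtain ⟨v, hv, hv0⟩ := Matrix.exists_vecMul_eq_zero_iff.2 h0
  apply hv
  have h1 := Fintype.linearIndependent_iff.1 h.linearIndependent_rat v
  refine funext (h1 ?_)
  have h2 := congrFun hv0
  simp only [Matrix.vecMul, dotProduct, coordMatrix, Matrix.of_apply, Pi.zero_apply,
    Fin.sum_univ_four] at h2
  rw [Fin.sum_univ_four]
  ext
  · simpa using h2 0
  · simpa using h2 1
  · simpa using h2 2
  · simpa using h2 3

theorem exists_isLatticeBasis {L : Submodule ℤ (Quat a b)} (hL : L.IsLattice ℚ) :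
    ∃ e : Fin 4 → Quat a b, IsLatticeBasis L e := by
  obtain ⟨e, he⟩ := exists_basis hL
  exact ⟨e, LinearIndependent.restrict_scalars' ℤ e.linearIndependent, he⟩

theorem nrd_sum (n : Fin 4 → ℤ) (e : Fin 4 → Quat a b) :
    nrd (∑ i, n i • e i) = n 0 ^ 2 * nrd (e 0) + n 1 ^ 2 * nrd (e 1) + n 2 ^ 2 * nrd (e 2)
      + n 3 ^ 2 * nrd (e 3) + n 0 * n 1 * trd (e 0 * star (e 1))
      + n 0 * n 2 * trd (e 0 * star (e 2)) + n 0 * n 3 * trd (e 0 * star (e 3))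
      + n 1 * n 2 * trd (e 1 * star (e 2)) + n 1 * n 3 * trd (e 1 * star (e 3))
      + n 2 * n 3 * trd (e 2 * star (e 3)) := by
  simp only [Fin.sum_univ_four, ← Int.cast_smul_eq_zsmul ℚ, nrd_add, add_mul, trd_add,
    smul_mul_assoc, star_smul, star_trivial, mul_smul_comm, trd_smul, nrd_smul]
  ring

variable (ha : a < 0) (hb : b < 0)
include ha hb

/-- A positive definite integral form in coordinates on `L`; the matrix `P` is a square root of its
polar form. -/
theorem exists_gramData {L : Submodule ℤ (Quat a b)} (hL : L.IsLattice ℚ) :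
    ∃ (g : GramData L) (P : Matrix (Fin 4) (Fin 4) ℝ), P.det ≠ 0 ∧
      Pᵀ * P = (g.form + g.formᵀ).map fun k : ℤ => (k : ℝ) := by
  obtain ⟨e, he⟩ := exists_isLatticeBasis hL
  have hdet := he.det_ne_zero
  have hN := latticeNorm_pos ha hb hL.fg (ne_bot_of_isLattice hL)
  have heL : ∀ i, e i ∈ L := fun i => he.2 ▸ Submodule.subset_span ⟨i, rfl⟩
  choose k hk using fun i => exists_nrd_eq_mul ha hb hL.fg (ne_bot_of_isLattice hL) (heL i)
  have hl : ∀ i j, ∃ l : ℤ, trd (e i * star (e j)) = l * latticeNorm L := by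
    intro i j
    obtain ⟨m, hm⟩ := exists_nrd_eq_mul ha hb hL.fg (ne_bot_of_isLattice hL)
      (L.add_mem (heL i) (heL j))
    refine ⟨m - k i - k j, ?_⟩
    rw [nrd_add, hk, hk] at hm
    push_cast
    linarith
  choose l hl using hl
  have hlsymm : ∀ i j, l i j = l j i := by
    intro i j
    have h1 : trd (e i * star (e j)) = trd (e j * star (e i)) := by
      rw [← trd_star, star_mul, star_star]
    rw [hl, hl] at h1
    exact_mod_cast mul_right_cancel₀ hN.ne' h1
  have hldiag : ∀ i, l i i = 2 * k i := by
    intro i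
    have h1 : trd (e i * star (e i)) = 2 * nrd (e i) := by
      rw [mul_star_self_eq, trd_smul, QuatTheta.trd_eq]
      simp [mul_comm]
    rw [hl, hk, ← mul_assoc] at h1
    exact_mod_cast mul_right_cancel₀ hN.ne' h1
  let B : Module.Basis (Fin 4) ℤ L :=
    (Module.Basis.span he.1).map (LinearEquiv.ofEq _ _ he.2)
  have hB : ∀ i, (B i : Quat a b) = e i := by
    intro i
    simp [B, Module.Basis.span_apply]
  -- an upper triangular matrix, since the polar form need not have an integral half
  let q : Matrix (Fin 4) (Fin 4) ℤ :=
    Matrix.of fun i j => if i = j then k i else if i < j then l i j else 0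
  have hqq : q + qᵀ = Matrix.of l := by
    ext i j
    simp only [q, Matrix.add_apply, Matrix.transpose_apply, Matrix.of_apply]
    rcases lt_trichotomy i j with h | h | h
    · simp [h.ne, h.ne', h, h.not_gt]
    · subst h
      simp [hldiag, two_mul]
    · simp [h.ne, h.ne', h, h.not_gt, hlsymm]
  let g : GramData L :=
    { coord := B.equivFun
      form := q
      nrd_eq := by
        intro x
        have hx : (x : Quat a b) = ∑ i, B.equivFun x i • e i := by
          have h := congrArg Subtype.val (B.sum_equivFun x)
          simp only [AddSubmonoidClass.coe_finsetSum, Submodule.coe_smul, hB] at h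
          exact h.symm
        generalize B.equivFun x = n at hx
        rw [hx, nrd_sum]
        simp only [hk, hl, qform, dotProduct, Matrix.mulVec, Fin.sum_univ_four, q, Matrix.of_apply]
        simp
        ring }
  -- in the basis `1, i, j, ij` the polar form is diagonal with positive entries `w`
  let w : Fin 4 → ℚ := ![2, -2 * a, -2 * b, 2 * (a * b)]
  have hw : ∀ i, 0 < w i / latticeNorm L := by
    intro i
    refine div_pos ?_ hN
    have := mul_pos_of_neg_of_neg ha hb
    fin_cases i <;> simp [w] <;> linarith
  let s : Fin 4 → ℝ := fun i => Real.sqrt ((w i / latticeNorm L : ℚ) : ℝ)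
  have hs : ∀ i, s i * s i = ((w i / latticeNorm L : ℚ) : ℝ) := fun i =>
    Real.mul_self_sqrt (by exact_mod_cast (hw i).le)
  let C : Matrix (Fin 4) (Fin 4) ℝ := (coordMatrix e).map fun r : ℚ => (r : ℝ)
  refine ⟨g, Matrix.diagonal s * Cᵀ, ?_, ?_⟩
  · rw [Matrix.det_mul, Matrix.det_diagonal, Matrix.det_transpose]
    refine mul_ne_zero (Finset.prod_ne_zero_iff.2 fun i _ => ?_) ?_
    · exact (Real.sqrt_pos.2 (by exact_mod_cast hw i)).ne'
    · have : C.det = ((coordMatrix e).det : ℝ) :=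
        ((Rat.castHom ℝ).map_det (coordMatrix e)).symm
      rw [this]
      exact_mod_cast hdet
  · change _ = (q + qᵀ).map _
    rw [hqq]
    ext i j
    have h1 := congrFun (congrFun (trd_mul_star_eq e) i) j
    rw [Matrix.of_apply, hl, Matrix.mul_apply] at h1
    have h2 : ((l i j : ℤ) : ℚ) = ∑ m, coordMatrix e i m * (w m / latticeNorm L) *
        coordMatrix e j m := by
      rw [← mul_right_cancel_iff_of_pos hN, h1, Finset.sum_mul]
      refine Finset.sum_congr rfl fun m _ => ?_
      rw [Matrix.mul_diagonal, Matrix.transpose_apply]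
      change coordMatrix e i m * w m * coordMatrix e j m = _
      field_simp
    rw [Matrix.map_apply, Matrix.of_apply, ← Rat.cast_intCast, h2, Matrix.mul_apply]
    push_cast
    refine Finset.sum_congr rfl fun m _ => ?_
    have h3 := hs m
    push_cast at h3
    rw [← h3]
    simp only [Matrix.transpose_apply, Matrix.diagonal_mul, C, Matrix.map_apply]
    ring

theorem GramData.det_ne_zero {L : Submodule ℤ (Quat a b)} (g : GramData L) :
    (g.form + g.formᵀ).det ≠ 0 := by
  intro h0
  obtain ⟨v, hv, hv0⟩ := Matrix.exists_mulVec_eq_zero_iff.2 h0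
  apply hv
  have h := g.trd_eq (g.coord.symm v) (g.coord.symm v)
  rw [LinearEquiv.apply_symm_apply, hv0, dotProduct_zero, Int.cast_zero, zero_mul,
    mul_star_self_eq, trd_smul, QuatTheta.trd_eq] at h
  by_contra hne
  have h1 := nrd_pos ha hb (x := (g.coord.symm v : Quat a b)) (by simpa using hne)
  simp at h
  exact h1.ne' h

end Gram

/-! ### Level and discriminant -/

section Level

open Matrix

variable {a b : ℚ} (ha : a < 0) (hb : b < 0) {O : Subalgebra ℤ (Quat a b)}
  (hO : (Subalgebra.toSubmodule O).IsLattice ℚ)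
include ha hb hO

/-- The reduced discriminant is a positive integer `D`, and `D ² O^♯ ⊆ O`. -/
theorem exists_disc : ∃ D : ℕ, 0 < D ∧ (D : ℝ) = disc (Subalgebra.toSubmodule O) ∧
    ∀ x ∈ dualLattice (Subalgebra.toSubmodule O), ((D ^ 2 : ℕ) : ℤ) • x ∈ O := by
  have hex := exists_isLatticeBasis hO
  have he := hex.choose_spec
  set e := hex.choose with hedef
  have heO : ∀ i, e i ∈ O := fun i => by
    rw [← Subalgebra.mem_toSubmodule, ← he.2]
    exact Submodule.subset_span ⟨i, rfl⟩
  choose l hl using fun i j => exists_int_trd hO (O.mul_mem (heO i) (star_mem_order hO (heO j)))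
  have hmap : (Matrix.of fun i j => trd (e i * star (e j))) = (Int.castRingHom ℚ).mapMatrix
      (Matrix.of l) := by
    ext i j
    simp [hl]
  have hdet : (((Matrix.of l).det : ℤ) : ℚ) = (4 * (a * b) * (coordMatrix e).det) ^ 2 := by
    rw [← det_trd_mul_star, hmap, ← RingHom.map_det]; rfl
  have hlat : latticeDet (Subalgebra.toSubmodule O) =
      (4 * (a * b) * (coordMatrix e).det) ^ 2 := by
    rw [latticeDet, dif_pos hex, latticeNorm_order ha hb hO]
    simp only [div_one]
    exact det_trd_mul_star e
  set r := 4 * (a * b) * (coordMatrix e).det with hr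
  have hr0 : r ≠ 0 := mul_ne_zero (mul_ne_zero four_ne_zero (mul_ne_zero ha.ne hb.ne)) he.det_ne_zero
  -- the integral Gram determinant is the square of the rational number `r`, which is thus integral
  obtain ⟨k, hk⟩ := exists_int_eq_of_padicNorm_le_one (r := r) fun p _ => by
    have h1 := padicNorm.of_int (p := p) (Matrix.of l).det
    rw [hdet, padicNorm_pow] at h1
    exact (pow_le_one_iff_of_nonneg (padicNorm.nonneg _) two_ne_zero).1 h1
  refine ⟨k.natAbs, ?_, ?_, ?_⟩
  · rw [Int.natAbs_pos]
    rintro rfl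
    exact hr0 (by simpa using hk)
  · rw [disc, hlat, hk, Nat.cast_natAbs, Int.cast_abs]
    push_cast
    rw [Real.sqrt_sq_eq_abs]
  · intro x hx
    have hD : ((k.natAbs ^ 2 : ℕ) : ℤ) = (Matrix.of l).det := by
      have : (((Matrix.of l).det : ℤ) : ℚ) = ((k ^ 2 : ℤ) : ℚ) := by
        rw [hdet, hk]; push_cast; rfl
      rw [Nat.cast_pow, Int.natAbs_sq]
      exact_mod_cast this.symm
    rw [hD]
    let B := basisOfLinearIndependentOfCardEqFinrank he.linearIndependent_rat
      (by rw [QuaternionAlgebra.finrank_eq_four, Fintype.card_fin])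
    have hB : ∀ i, B i = e i := fun i => by simp [B]
    have hx1 : x = ∑ i, B.repr x i • e i := by
      conv_lhs => rw [← B.sum_repr x]
      simp [hB]
    choose m hm using fun j => hx _ (star_mem_order hO (heO j))
    have h1 : (fun i => B.repr x i) ᵥ* (Int.castRingHom ℚ).mapMatrix (Matrix.of l) =
        fun j => ((m j : ℤ) : ℚ) := by
      funext j
      rw [← hm j, ← hmap]
      conv_rhs => rw [hx1]
      simp only [Matrix.vecMul, dotProduct, Matrix.of_apply, Fin.sum_univ_four, add_mul, trd_add,
        smul_mul_assoc, trd_smul]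
    -- Cramer's rule
    have h2 : ∀ i, ((Matrix.of l).det : ℚ) * B.repr x i =
        (((m ᵥ* (Matrix.of l).adjugate) i : ℤ) : ℚ) := by
      intro i
      have h3 := congrArg (fun v => v ᵥ* ((Int.castRingHom ℚ).mapMatrix (Matrix.of l)).adjugate) h1
      rw [Matrix.vecMul_vecMul, Matrix.mul_adjugate, Matrix.vecMul_smul, Matrix.vecMul_one,
        ← RingHom.map_det, ← RingHom.map_adjugate] at h3
      have h4 := congrFun h3 i
      rw [Pi.smul_apply, smul_eq_mul, eq_intCast] at h4
      rw [h4]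
      simp [Matrix.vecMul, dotProduct]
    rw [hx1, Finset.smul_sum]
    refine O.sum_mem fun i _ => ?_
    rw [← Int.cast_smul_eq_zsmul ℚ, smul_smul, h2, Int.cast_smul_eq_zsmul]
    exact O.zsmul_mem (heO i) _

/-- Level and discriminant are positive integers `N` and `D`, every prime dividing `N` divides `D`,
and `N · N(x)` is an integer for `x ∈ O^♯`. -/
theorem exists_level_disc : ∃ N D : ℕ, 0 < N ∧ 0 < D ∧ (N : ℚ) = level O ∧
    (D : ℝ) = disc (Subalgebra.toSubmodule O) ∧ N ∣ D ^ 4 ∧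
    ∀ x ∈ dualLattice (Subalgebra.toSubmodule O), ∃ k : ℤ, N * nrd x = k := by
  obtain ⟨D, hD, hdisc, h⟩ := exists_disc ha hb hO
  set L := dualLattice (Subalgebra.toSubmodule O) with hLdef
  have hD0 : ((D ^ 2 : ℕ) : ℚ) ≠ 0 := by positivity
  have hfg : L.FG := by
    refine fg_of_le (hO.fg.map
      (LinearMap.mulLeft ℤ ((((D ^ 2 : ℕ) : ℚ)⁻¹) • (1 : Quat a b)))) fun x hx => ?_
    refine ⟨_, h x hx, ?_⟩
    rw [LinearMap.mulLeft_apply, smul_mul_assoc, one_mul, ← Int.cast_smul_eq_zsmul ℚ, smul_smul,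
      Int.cast_natCast, inv_mul_cancel₀ hD0, one_smul]
  have h1 : (1 : Quat a b) ∈ L := fun y hy => by
    rw [one_mul]
    exact exists_int_trd hO hy
  have hbot : L ≠ ⊥ := fun h0 => one_ne_zero ((Submodule.mem_bot ℤ).1 (h0 ▸ h1))
  have hpos := latticeNorm_pos ha hb hfg hbot
  -- `1 ∈ O^♯` has norm `1`, so the inverse of the norm of `O^♯` is an integer
  obtain ⟨k, hk⟩ := exists_nrd_eq_mul ha hb hfg hbot h1
  rw [nrd_one] at hk
  have hkl : (k : ℚ) = level O := by
    rw [level, ← hLdef]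
    exact eq_inv_of_mul_eq_one_left hk.symm
  have hk0 : 0 < k := by
    have : (0 : ℚ) < k := by rw [hkl, level, ← hLdef]; exact inv_pos.2 hpos
    exact_mod_cast this
  lift k to ℕ using hk0.le
  have hk1 : (k : ℚ) * latticeNorm L = 1 := by exact_mod_cast hk.symm
  refine ⟨k, D, by exact_mod_cast hk0, hD, by exact_mod_cast hkl, hdisc, ?_, fun x hx => ?_⟩
  -- `D ² O^♯ ⊆ O`, so the norms on `O^♯` have denominators dividing `D ^ 4`
  · obtain ⟨m, hm⟩ := latticeNorm_eq_of_span ha hb hfg hbot (r := ((D ^ 4 : ℕ) : ℚ)⁻¹)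
      fun x hx => by
        obtain ⟨c, hc⟩ := exists_int_nrd hO (h x hx)
        refine ⟨c, ?_⟩
        rw [← Int.cast_smul_eq_zsmul ℚ, nrd_smul] at hc
        rw [← hc]
        push_cast
        field_simp
    rw [hm] at hk1
    have h4 : ((D ^ 4 : ℕ) : ℚ) ≠ 0 := by positivity
    have h5 : (((k : ℤ) * m : ℤ) : ℚ) = ((D ^ 4 : ℕ) : ℚ) := by
      field_simp at hk1
      push_cast at hk1 ⊢
      exact hk1
    exact Int.natCast_dvd_natCast.1 ⟨m, by exact_mod_cast h5.symm⟩
  · obtain ⟨m, hm⟩ := exists_nrd_eq_mul ha hb hfg hbot hx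
    refine ⟨m, ?_⟩
    rw [hm]
    linear_combination (m : ℚ) * hk1

variable {p : ℕ} [hp : Fact p.Prime]

omit ha hb in
/-- The level bounds the norms on the local dual lattice at each prime. -/
theorem padicNorm_level_mul_nrd_le {N : ℕ}
    (hN : ∀ x ∈ dualLattice (Subalgebra.toSubmodule O), ∃ k : ℤ, N * nrd x = k)
    {x : Quat a b} (hx : ∀ w ∈ loc p (Subalgebra.toSubmodule O), padicNorm p (trd (x * star w)) ≤ 1) :
    padicNorm p (N * nrd x) ≤ 1 := by
  let φ : Quat a b →ₗ[ℤ] ℚ :=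
    { toFun := fun w => trd (x * w)
      map_add' := fun v w => by rw [mul_add, trd_add]
      map_smul' := fun c w => by
        rw [mul_smul_comm, ← Int.cast_smul_eq_zsmul ℚ, trd_smul, eq_intCast, zsmul_eq_mul]; rfl }
  -- clearing denominators prime to `p` puts a multiple of `x` into the dual lattice
  obtain ⟨M, hM, h⟩ := exists_common_den φ hO.fg
  obtain ⟨k, m, hm, hMk⟩ := Nat.exists_eq_pow_mul_and_not_dvd hM.ne' p hp.out.ne_one
  have hmem : (m : ℤ) • x ∈ dualLattice (Subalgebra.toSubmodule O) := by
    intro w hw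
    rw [smul_mul_assoc, ← Int.cast_smul_eq_zsmul ℚ, trd_smul, Int.cast_natCast]
    refine exists_int_eq_of_padicNorm_le_one fun l hl => ?_
    by_cases hlp : l = p
    · subst hlp
      have h1 := hx _ (le_loc _ (star_mem_order hO hw))
      rw [star_star] at h1
      rw [padicNorm.mul, (padicNorm.nat_eq_one_iff m).2 hm, one_mul]
      exact h1
    · obtain ⟨c, hc⟩ := h w hw
      have h1 := padicNorm.of_int (p := l) c
      rw [← hc, hMk, Nat.cast_mul, Nat.cast_pow, mul_assoc, padicNorm.mul, padicNorm_pow,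
        (padicNorm.nat_eq_one_iff p).2 (fun h => hlp ((Nat.prime_dvd_prime_iff_eq hl.out hp.out).1 h)),
        one_pow, one_mul] at h1
      exact h1
  obtain ⟨c, hc⟩ := hN _ hmem
  have h1 := padicNorm.of_int (p := p) c
  rw [← hc, ← Int.cast_smul_eq_zsmul ℚ, nrd_smul, Int.cast_natCast, mul_left_comm, padicNorm.mul,
    padicNorm_pow, (padicNorm.nat_eq_one_iff m).2 hm, one_pow, one_mul] at h1
  exact h1

omit hp in
theorem level_mul_nrd {N : ℕ}
    (hN : ∀ x ∈ dualLattice (Subalgebra.toSubmodule O), ∃ k : ℤ, N * nrd x = k)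
    {L : Submodule ℤ (Quat a b)} (hL : IsLocallySimilar O L) {x : Quat a b}
    (hx : ∀ w ∈ L, ∃ k : ℤ, trd (x * star w) = k * latticeNorm L) :
    ∃ k : ℤ, N * nrd x = k * latticeNorm L := by
  have hpos := latticeNorm_pos ha hb hL.1.fg (ne_bot_of_isLattice hL.1)
  suffices h : ∃ k : ℤ, N * (nrd x / latticeNorm L) = k by
    obtain ⟨k, hk⟩ := h
    exact ⟨k, by rw [← hk]; field_simp⟩
  refine exists_int_eq_of_padicNorm_le_one fun p hp => ?_
  obtain ⟨y, z, hyz⟩ := hL.2 p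
  rw [padicNorm.mul, padicNorm_nrd_div ha hb hO hL.1 hyz, ← padicNorm.mul]
  refine padicNorm_level_mul_nrd_le hO hN fun w hw => ?_
  have h1 : (y : Quat a b) * (((y⁻¹ : (Quat a b)ˣ) : Quat a b) * w * (z : Quat a b)) *
      ((z⁻¹ : (Quat a b)ˣ) : Quat a b) = w := by
    simp only [← mul_assoc, Units.mul_inv, one_mul]
    rw [mul_assoc, Units.mul_inv, mul_one]
  obtain ⟨m, hm, h2⟩ := (hyz (((y⁻¹ : (Quat a b)ˣ) : Quat a b) * w * (z : Quat a b))).2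
    (by rwa [h1])
  obtain ⟨k, hk⟩ := hx _ h2
  have h3 := padicNorm_trd_div ha hb hO hL.1 hyz x
    (((y⁻¹ : (Quat a b)ˣ) : Quat a b) * w * (z : Quat a b))
  rw [h1] at h3
  rw [← h3]
  have h4 : (m : ℚ) * (trd (x * star (((y⁻¹ : (Quat a b)ˣ) : Quat a b) * w * (z : Quat a b))) /
      latticeNorm L) = k := by
    rw [← Int.cast_smul_eq_zsmul ℚ, star_smul, star_trivial, mul_smul_comm, trd_smul,
      Int.cast_natCast] at hk
    rw [← mul_div_assoc, hk, mul_div_cancel_right₀ _ hpos.ne']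
  have h5 := padicNorm.of_int (p := p) k
  rwa [← h4, padicNorm.mul, (padicNorm.nat_eq_one_iff m).2 hm, one_mul] at h5

/-- The form of a lattice that is locally similar to `O` has level dividing that of `O`. -/
theorem hasLevel {N : ℕ}
    (hN : ∀ x ∈ dualLattice (Subalgebra.toSubmodule O), ∃ k : ℤ, N * nrd x = k)
    {L : Submodule ℤ (Quat a b)} (hL : IsLocallySimilar O L) (g : GramData L) :
    HasLevel g.form N := by
  set A := g.form + g.formᵀ with hA
  set d := A.det with hd
  have hd0 : d ≠ 0 := g.det_ne_zero ha hb
  have hpos := latticeNorm_pos ha hb hL.1.fg (ne_bot_of_isLattice hL.1)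
  -- the vectors `A⁻¹ k` form the dual lattice; `d A⁻¹ k` has integral coordinates
  have key : ∀ k : Fin 4 → ℤ, ∃ c : ℤ, N * qform g.form (A.adjugate *ᵥ k) = d ^ 2 * c := by
    intro k
    set X := g.coord.symm (A.adjugate *ᵥ k) with hX
    have hXc : g.coord X = A.adjugate *ᵥ k := g.coord.apply_symm_apply _
    obtain ⟨c, hc⟩ := level_mul_nrd ha hb hO hN hL (x := (d : ℚ)⁻¹ • (X : Quat a b)) (by
      intro w hw
      refine ⟨k ⬝ᵥ g.coord ⟨w, hw⟩, ?_⟩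
      have hdq : (d : ℚ) ≠ 0 := by exact_mod_cast hd0
      have h1 := g.trd_eq X ⟨w, hw⟩
      have hAt : Aᵀ = A := by rw [hA, Matrix.transpose_add, Matrix.transpose_transpose, add_comm]
      have h2 : (A.adjugate *ᵥ k) ᵥ* A = d • k := by
        rw [← hAt, Matrix.vecMul_transpose, hAt, Matrix.mulVec_mulVec, Matrix.mul_adjugate,
          Matrix.smul_mulVec, Matrix.one_mulVec]
      rw [hXc, ← hA, Matrix.dotProduct_mulVec, h2, smul_dotProduct, smul_eq_mul] at h1
      rw [smul_mul_assoc, trd_smul, h1]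
      push_cast
      field_simp)
    refine ⟨c, ?_⟩
    rw [nrd_smul, g.nrd_eq X, hXc] at hc
    have hdq : (d : ℚ) ≠ 0 := by exact_mod_cast hd0
    have h2 : (N : ℚ) * (qform g.form (A.adjugate *ᵥ k) : ℤ) = d ^ 2 * c := by
      field_simp at hc
      linarith
    exact_mod_cast h2
  -- polarization of the integrality statement `key`
  have key2 : ∀ (k : Fin 4 → ℤ) (i : Fin 4), d ∣ N * (A.adjugate *ᵥ k) i := by
    intro k i
    obtain ⟨c1, h1⟩ := key k
    obtain ⟨c2, h2⟩ := key (Pi.single i 1)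
    obtain ⟨c3, h3⟩ := key (k + Pi.single i 1)
    rw [Matrix.mulVec_add, qform_add, ← hA, Matrix.mulVec_mulVec, Matrix.mul_adjugate,
      Matrix.smul_mulVec, Matrix.one_mulVec, dotProduct_smul, dotProduct_single_one,
      smul_eq_mul] at h3
    refine ⟨c3 - c1 - c2, mul_left_cancel₀ hd0 ?_⟩
    linear_combination h3 - h1 - h2
  intro k
  choose κ hκ using key2 k
  have hκ' : (N : ℤ) • (A.adjugate *ᵥ k) = d • κ := by
    funext i
    simp [hκ i]
  refine ⟨κ, ?_, ?_⟩
  · have h1 : d • (A *ᵥ κ) = d • ((N : ℤ) • k) := by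
      rw [← Matrix.mulVec_smul, ← hκ', Matrix.mulVec_smul, Matrix.mulVec_mulVec,
        Matrix.mul_adjugate, Matrix.smul_mulVec, Matrix.one_mulVec, smul_comm]
    exact smul_right_injective _ hd0 h1
  · obtain ⟨c, hc⟩ := key k
    have h1 : d ^ 2 * qform g.form κ = d ^ 2 * (N * c) := by
      rw [← qform_smul, ← hκ', qform_smul]
      linear_combination (N : ℤ) * hc
    exact ⟨c, mul_left_cancel₀ (pow_ne_zero 2 hd0) h1⟩

omit ha hb hO in
theorem polarNondeg_of_hasLevel {q : Matrix (Fin 4) (Fin 4) ℤ} {N : ℕ} (h : HasLevel q N)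
    (hpN : ¬ p ∣ N) : PolarNondeg (q.map fun k : ℤ => (k : ZMod p)) := by
  intro v hv
  funext i
  obtain ⟨κ, hκ, -⟩ := h (Pi.single i 1)
  have h1 := hv fun i => ((κ i : ℤ) : ZMod p)
  have h2 : (q.map (fun k : ℤ => (k : ZMod p)) + (q.map (fun k : ℤ => (k : ZMod p)))ᵀ) *ᵥ
      (fun i => ((κ i : ℤ) : ZMod p)) = (N : ZMod p) • Pi.single i 1 := by
    funext j
    have h3 := congrArg (fun k : ℤ => (k : ZMod p)) (congrFun hκ j)
    simp only [Matrix.mulVec, dotProduct, Matrix.add_apply, Matrix.transpose_apply,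
      Pi.smul_apply, smul_eq_mul] at h3
    push_cast at h3
    simp only [Matrix.mulVec, dotProduct, Matrix.add_apply, Matrix.transpose_apply,
      Matrix.map_apply, Pi.smul_apply, smul_eq_mul]
    rw [h3]
    by_cases hij : j = i
    · subst hij; simp
    · simp [Pi.single_eq_of_ne hij]
  rw [h2, dotProduct_smul, dotProduct_single_one, smul_eq_mul] at h1
  exact (mul_eq_zero.1 h1).resolve_left fun h => hpN ((ZMod.natCast_eq_zero_iff N p).1 h)

end Level

/-! ### Reduction modulo a prime -/

section Reduction

open Matrix

variable {a b : ℚ} {L : Submodule ℤ (Quat a b)} (g : GramData L)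

/-- The coordinates modulo `p`. -/
def GramData.red (p : ℕ) : L →+ (Fin 4 → ZMod p) where
  toFun x i := (g.coord x i : ZMod p)
  map_zero' := by ext; simp
  map_add' x y := by ext; simp

/-- The form modulo `p`. -/
def GramData.formMod (p : ℕ) : Matrix (Fin 4) (Fin 4) (ZMod p) :=
  g.form.map fun k : ℤ => (k : ZMod p)

theorem GramData.qform_red (p : ℕ) (x : L) :
    qform (g.formMod p) (g.red p x) = ((qform g.form (g.coord x) : ℤ) : ZMod p) :=
  qform_map (Int.castRingHom (ZMod p)) g.form (g.coord x)

theorem GramData.red_surjective (p : ℕ) : Function.Surjective (g.red p) := by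
  intro v
  choose n hn using fun i => ZMod.intCast_surjective (v i)
  exact ⟨g.coord.symm n, by ext i; simp [GramData.red, hn]⟩

theorem GramData.red_eq_zero_iff (p : ℕ) (x : L) :
    g.red p x = 0 ↔ ∃ w ∈ L, (x : Quat a b) = (p : ℤ) • w := by
  constructor
  · intro h
    have h1 : ∀ i, ∃ k : ℤ, g.coord x i = p * k := fun i =>
      (ZMod.intCast_zmod_eq_zero_iff_dvd _ p).1 (congrFun h i)
    choose k hk using h1
    refine ⟨g.coord.symm k, (g.coord.symm k).2, ?_⟩
    have h2 : x = (p : ℤ) • g.coord.symm k := by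
      rw [← map_smul, LinearEquiv.eq_symm_apply]
      funext i
      simp [hk]
    exact congrArg Subtype.val h2
  · rintro ⟨w, hw, h⟩
    have h2 : x = (p : ℤ) • ⟨w, hw⟩ := Subtype.ext h
    rw [h2, map_zsmul]
    ext i
    simp

theorem GramData.qform_eq_zero_iff (ha : a < 0) (hb : b < 0) (hL : L.IsLattice ℚ) (p : ℕ) (x : L) :
    qform (g.formMod p) (g.red p x) = 0 ↔
      ∃ k : ℤ, nrd (x : Quat a b) = (p * k : ℤ) * latticeNorm L := by
  have hpos := latticeNorm_pos ha hb hL.fg (ne_bot_of_isLattice hL)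
  rw [g.qform_red, ZMod.intCast_zmod_eq_zero_iff_dvd]
  refine exists_congr fun k => ?_
  rw [g.nrd_eq, mul_left_inj' hpos.ne', Int.cast_inj]

end Reduction

section Plane

open Matrix Module

variable {a b : ℚ} (ha : a < 0) (hb : b < 0) {O : Subalgebra ℤ (Quat a b)}
  (hO : (Subalgebra.toSubmodule O).IsLattice ℚ) {N : ℕ}
  (hN : ∀ x ∈ dualLattice (Subalgebra.toSubmodule O), ∃ k : ℤ, N * nrd x = k)
include ha hb hO hN

theorem GramData.polarNondeg {L : Submodule ℤ (Quat a b)} (hL : IsLocallySimilar O L)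
    (g : GramData L) {p : ℕ} [Fact p.Prime] (hpN : ¬ p ∣ N) : PolarNondeg (g.formMod p) :=
  polarNondeg_of_hasLevel (hasLevel ha hb hO hN hL g) hpN

/-- Modulo a prime not dividing the level, the form of `𝔞⁻¹ 𝔟` has an isotropic plane, namely
`R x` for an isotropic vector `x`, where `R` is the right order of `𝔞`: both `R x` and the
annihilator of `x` in `R` are isotropic. -/
theorem exists_isotropic_plane {𝔞 𝔟 L : Submodule ℤ (Quat a b)} (h𝔞 : IsLeftIdeal O 𝔞)
    (h𝔟 : IsLeftIdeal O 𝔟) (hLc : L = colon 𝔞 𝔟) (g : GramData L) {p : ℕ} [hp : Fact p.Prime]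
    (hpN : ¬ p ∣ N) (x : L) (hv0 : g.red p x ≠ 0) (hv : qform (g.formMod p) (g.red p x) = 0) :
    ∃ U : Submodule (ZMod p) (Fin 4 → ZMod p),
      (∀ u ∈ U, qform (g.formMod p) u = 0) ∧ finrank (ZMod p) U = 2 ∧
      ∀ u, u ∈ U ↔ ∃ r ∈ colon 𝔞 𝔞, ∃ w : L, (w : Quat a b) = r * x ∧ g.red p w = u := by
  subst hLc
  have hL := isLocallySimilar_colon ha hb hO h𝔞 h𝔟
  have hR := isLocallySimilar_colon ha hb hO h𝔞 h𝔞
  obtain ⟨gR, -, -, -⟩ := exists_gramData ha hb hR.1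
  have hNR : latticeNorm (colon 𝔞 𝔞) = 1 := by
    rw [latticeNorm_colon ha hb hO h𝔞 h𝔞, div_self
      (latticeNorm_pos ha hb h𝔞.1.fg (ne_bot_of_isLattice h𝔞.1)).ne']
  let m : colon 𝔞 𝔞 →ₗ[ℤ] colon 𝔞 𝔟 :=
    { toFun := fun r => ⟨(r : Quat a b) * x, fun t ht => by
        rw [← mul_assoc]; exact x.2 _ (r.2 t ht)⟩
      map_add' := fun r s => Subtype.ext (by simp [add_mul])
      map_smul' := fun c r => Subtype.ext (by simp [mul_assoc]) }
  let F : (Fin 4 → ℤ) →ₗ[ℤ] (Fin 4 → ℤ) :=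
    g.coord.toLinearMap ∘ₗ m ∘ₗ gR.coord.symm.toLinearMap
  -- the map `r ↦ r x` from `R / p R` to `L / p L`
  let f := Matrix.mulVecLin ((LinearMap.toMatrix' F).map fun k : ℤ => (k : ZMod p))
  have hf : ∀ r, f (gR.red p r) = g.red p (m r) := by
    intro r
    have h1 : LinearMap.toMatrix' F *ᵥ gR.coord r = g.coord (m r) := by
      rw [LinearMap.toMatrix'_mulVec]
      simp [F]
    funext i
    have h2 := congrArg (fun k : ℤ => (k : ZMod p)) (congrFun h1 i)
    simp only [f, Matrix.mulVecLin_apply, Matrix.mulVec, dotProduct, Matrix.map_apply,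
      GramData.red, AddMonoidHom.coe_mk, ZeroHom.coe_mk] at h2 ⊢
    rw [← h2]
    push_cast
    rfl
  have hker : ∀ u ∈ LinearMap.ker f, qform (gR.formMod p) u = 0 := by
    intro u hu
    obtain ⟨r, rfl⟩ := gR.red_surjective p u
    rw [LinearMap.mem_ker, hf, g.red_eq_zero_iff] at hu
    obtain ⟨w, hw, hrw⟩ := hu
    obtain ⟨k, hk⟩ := exists_nrd_eq_mul ha hb hR.1.fg (ne_bot_of_isLattice hR.1) r.2
    have hstar : star (r : Quat a b) ∈ colon 𝔞 𝔞 := by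
      have := smul_star_mem_colon ha hb hO h𝔞 h𝔞 r.2
      rwa [hNR, inv_one, one_smul] at this
    -- `N(r) x = r̄ (r x)` lies in `p 𝔞⁻¹ 𝔟`, so `p` divides `N(r)`
    have h1 : k • (x : Quat a b) = (p : ℤ) • (star (r : Quat a b) * w) := by
      rw [← mul_smul_comm, ← hrw]
      change _ = star (r : Quat a b) * ((r : Quat a b) * x)
      rw [← mul_assoc, star_mul_self_eq, hk, hNR, mul_one, smul_mul_assoc, one_mul,
        Int.cast_smul_eq_zsmul]
    have h2 : g.red p (k • x) = 0 := (g.red_eq_zero_iff p _).2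
      ⟨_, fun t ht => by rw [← mul_assoc]; exact hw _ (hstar t ht), h1⟩
    have h3 : (k : ZMod p) • g.red p x = 0 := by
      rw [map_zsmul] at h2
      rw [Int.cast_smul_eq_zsmul]
      exact h2
    have h4 : (k : ZMod p) = 0 := (smul_eq_zero.1 h3).resolve_right hv0
    rw [gR.qform_red, ← h4]
    congr 1
    have h5 := gR.nrd_eq r
    rw [hk, hNR, mul_one, mul_one] at h5
    exact_mod_cast h5.symm
  have hrange : ∀ u ∈ LinearMap.range f, qform (g.formMod p) u = 0 := by
    rintro _ ⟨u, rfl⟩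
    obtain ⟨r, rfl⟩ := gR.red_surjective p u
    rw [hf, g.qform_eq_zero_iff ha hb hL.1]
    rw [g.qform_eq_zero_iff ha hb hL.1] at hv
    obtain ⟨k, hk⟩ := exists_nrd_eq_mul ha hb hR.1.fg (ne_bot_of_isLattice hR.1) r.2
    obtain ⟨l, hl⟩ := hv
    refine ⟨k * l, ?_⟩
    change nrd ((r : Quat a b) * (x : Quat a b)) = _
    rw [nrd_mul, hk, hl, hNR]
    push_cast
    ring
  refine ⟨LinearMap.range f, hrange, finrank_range_eq_two (gR.polarNondeg ha hb hO hN hR hpN)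
    (g.polarNondeg ha hb hO hN hL hpN) f hker hrange, fun u => ⟨?_, ?_⟩⟩
  · rintro ⟨u, rfl⟩
    obtain ⟨r, rfl⟩ := gR.red_surjective p u
    exact ⟨r, r.2, m r, rfl, (hf r).symm⟩
  · rintro ⟨r, hr, w, hw, rfl⟩
    exact ⟨gR.red p ⟨r, hr⟩, by rw [hf]; congr 1; exact Subtype.ext hw.symm⟩

theorem hasSplitGaussSums {𝔞 𝔟 : Submodule ℤ (Quat a b)} (h𝔞 : IsLeftIdeal O 𝔞)
    (h𝔟 : IsLeftIdeal O 𝔟) (g : GramData (colon 𝔞 𝔟)) : HasSplitGaussSums g.form N := by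
  intro p _ hpN c hc
  obtain ⟨v, hv0, hv⟩ := exists_isotropic (g.formMod p)
  obtain ⟨x, rfl⟩ := g.red_surjective p v
  obtain ⟨U, hU, hU2, -⟩ := exists_isotropic_plane ha hb hO hN h𝔞 h𝔟 rfl g hpN x hv0 hv
  exact gaussSum_of_isotropic (g.polarNondeg ha hb hO hN
    (isLocallySimilar_colon ha hb hO h𝔞 h𝔟) hpN) hU hU2 hc

end Plane

/-! ### Theta series of lattices in the quaternion algebra -/

section LatticeTheta

open Complex

variable {a b : ℚ}

theorem qPow_eq_thetaSeries_term {L : Submodule ℤ (Quat a b)} (g : GramData L)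
    (h : 0 < latticeNorm L) (τ : UpperHalfPlane) (x : L) :
    qPow (nrd (x : Quat a b) / latticeNorm L) τ =
      cexp (2 * Real.pi * I * ((qform g.form (g.coord x) : ℤ) : ℂ) * τ) := by
  rw [qPow, g.nrd_eq, mul_div_cancel_right₀ _ h.ne', Rat.cast_intCast]

/-- The number of elements of norm `m · N L` in `L`. -/
noncomputable def reprNum (L : Submodule ℤ (Quat a b)) (m : ℕ) : ℕ :=
  Nat.card {x : L // nrd (x : Quat a b) = m * latticeNorm L}

variable (ha : a < 0) (hb : b < 0)
include ha hb

theorem theta_eq_thetaSeries {L : Submodule ℤ (Quat a b)} (hL : L.IsLattice ℚ) (g : GramData L)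
    (τ : UpperHalfPlane) : theta L τ = thetaSeries g.form τ := by
  have hpos := latticeNorm_pos ha hb hL.fg (ne_bot_of_isLattice hL)
  rw [theta, thetaSeries, ← g.coord.toEquiv.tsum_eq]
  exact tsum_congr fun x => qPow_eq_thetaSeries_term g hpos τ x

theorem summable_theta {L : Submodule ℤ (Quat a b)} (hL : L.IsLattice ℚ) (τ : UpperHalfPlane) :
    Summable fun x : L => qPow (nrd (x : Quat a b) / latticeNorm L) τ := by
  have hpos := latticeNorm_pos ha hb hL.fg (ne_bot_of_isLattice hL)
  obtain ⟨g, P, hP, hA⟩ := exists_gramData ha hb hL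
  have h1 := summable_thetaSeries hP hA τ.2
  rw [← g.coord.toEquiv.summable_iff] at h1
  exact h1.congr fun x => (qPow_eq_thetaSeries_term g hpos τ x).symm

theorem finite_nrd_eq {L : Submodule ℤ (Quat a b)} (hL : L.IsLattice ℚ) (m : ℕ) :
    Finite {x : L // nrd (x : Quat a b) = m * latticeNorm L} := by
  have hpos := latticeNorm_pos ha hb hL.fg (ne_bot_of_isLattice hL)
  have h1 := (summable_theta ha hb hL UpperHalfPlane.I).tendsto_cofinite_zero
  have h2 : ∀ᶠ x : L in Filter.cofinite,
      qPow (nrd (x : Quat a b) / latticeNorm L) UpperHalfPlane.I ≠ qPow m UpperHalfPlane.I :=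
    h1.eventually_ne (Complex.exp_ne_zero _).symm
  rw [Filter.eventually_cofinite] at h2
  refine (h2.subset fun x hx => ?_ :
    Set.Finite {x : L | nrd (x : Quat a b) = m * latticeNorm L}).to_subtype
  have hx' : nrd (x : Quat a b) = m * latticeNorm L := hx
  simp [hx', hpos.ne']

theorem hasSum_theta {L : Submodule ℤ (Quat a b)} (hL : L.IsLattice ℚ) (τ : UpperHalfPlane) :
    HasSum (fun m : ℕ => (reprNum L m : ℂ) * qPow m τ) (theta L τ) := by
  have hpos := latticeNorm_pos ha hb hL.fg (ne_bot_of_isLattice hL)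
  have hval : ∀ x : L, ∃ m : ℕ, nrd (x : Quat a b) = m * latticeNorm L := by
    intro x
    obtain ⟨k, hk⟩ := exists_nrd_eq_mul ha hb hL.fg (ne_bot_of_isLattice hL) x.2
    have h1 := nrd_nonneg ha hb (x : Quat a b)
    rw [hk] at h1
    have h2 : 0 ≤ k := by exact_mod_cast nonneg_of_mul_nonneg_left h1 hpos
    lift k to ℕ using h2
    exact ⟨k, by exact_mod_cast hk⟩
  choose v hv using hval
  have hvm : ∀ (m : ℕ) (x : L), v x = m ↔ nrd (x : Quat a b) = m * latticeNorm L := by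
    intro m x
    rw [hv x, mul_left_inj' hpos.ne', Nat.cast_inj]
  have h1 := (summable_theta ha hb hL τ).hasSum
  rw [← (Equiv.sigmaFiberEquiv v).hasSum_iff] at h1
  refine h1.sigma fun m => ?_
  have : Finite {x : L // v x = m} := by
    have := finite_nrd_eq ha hb hL m
    exact Finite.of_equiv _ (Equiv.subtypeEquivRight fun x => (hvm m x).symm)
  have : Fintype {x : L // v x = m} := Fintype.ofFinite _
  have h2 : ∀ x : {x : L // v x = m},
      qPow (nrd ((x : L) : Quat a b) / latticeNorm L) τ = qPow m τ := by
    intro x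
    rw [(hvm m x).1 x.2, mul_div_cancel_right₀ _ hpos.ne']
  have h3 : (reprNum L m : ℂ) * qPow m τ = ∑ x : {x : L // v x = m},
      qPow (nrd ((x : L) : Quat a b) / latticeNorm L) τ := by
    rw [Finset.sum_congr rfl fun x _ => h2 x, Finset.sum_const, nsmul_eq_mul, Finset.card_univ,
      ← Nat.card_eq_fintype_card, reprNum,
      Nat.card_congr (Equiv.subtypeEquivRight fun x => (hvm m x))]
  rw [h3]
  exact hasSum_fintype _

theorem reprNum_zero {L : Submodule ℤ (Quat a b)} : reprNum L 0 = 1 := by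
  rw [reprNum, Nat.card_eq_one_iff_unique]
  refine ⟨⟨fun x y => ?_⟩, ⟨0, by simp [nrd_zero]⟩⟩
  have h : ∀ z : {x : L // nrd (x : Quat a b) = (0 : ℕ) * latticeNorm L},
      ((z : L) : Quat a b) = 0 := by
    intro z
    by_contra h0
    have := nrd_pos ha hb h0
    rw [z.2] at this
    simp at this
  exact Subtype.ext (Subtype.ext ((h x).trans (h y).symm))

theorem exists_modularForm_theta {O : Subalgebra ℤ (Quat a b)}
    (hO : (Subalgebra.toSubmodule O).IsLattice ℚ) {N : ℕ} (hN0 : 0 < N)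
    (hN : ∀ x ∈ dualLattice (Subalgebra.toSubmodule O), ∃ k : ℤ, N * nrd x = k)
    {𝔞 𝔟 : Submodule ℤ (Quat a b)} (h𝔞 : IsLeftIdeal O 𝔞) (h𝔟 : IsLeftIdeal O 𝔟) :
    ∃ f : ModularForm (Gamma0GL N) 2, (f : UpperHalfPlane → ℂ) = theta (colon 𝔞 𝔟) := by
  have hL := isLocallySimilar_colon ha hb hO h𝔞 h𝔟
  obtain ⟨g, P, hP, hA⟩ := exists_gramData ha hb hL.1
  obtain ⟨f, hf⟩ := exists_modularForm_thetaSeries hP hA hN0 (hasLevel ha hb hO hN hL g)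
    (hasSplitGaussSums ha hb hO hN h𝔞 h𝔟 g)
  exact ⟨f, funext fun τ => by rw [hf, theta_eq_thetaSeries ha hb hL.1 g]⟩

end LatticeTheta

/-! ### Inclusions between left ideals -/

section Inclusion

variable {a b : ℚ}

/-- A positive integer, as a unit of `H`. -/
noncomputable def natUnit (a b : ℚ) (n : ℕ) (hn : n ≠ 0) : (Quat a b)ˣ :=
  Units.map (algebraMap ℚ (Quat a b)).toMonoidHom (Units.mk0 (n : ℚ) (Nat.cast_ne_zero.2 hn))

theorem mul_natUnit {n : ℕ} (hn : n ≠ 0) (x : Quat a b) :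
    x * (natUnit a b n hn : Quat a b) = (n : ℤ) • x := by
  have : (natUnit a b n hn : Quat a b) = algebraMap ℚ (Quat a b) n := rfl
  rw [this, ← Algebra.commutes, ← Algebra.smul_def, ← Int.cast_smul_eq_zsmul ℚ, Int.cast_natCast]

theorem nrd_natUnit {n : ℕ} (hn : n ≠ 0) : nrd (natUnit a b n hn : Quat a b) = (n : ℚ) ^ 2 := by
  have := mul_natUnit (a := a) (b := b) hn 1
  rw [one_mul] at this
  rw [this, ← Int.cast_smul_eq_zsmul ℚ, nrd_smul, nrd_one, mul_one, Int.cast_natCast]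

theorem mem_rmul_natUnit {n : ℕ} (hn : n ≠ 0) {L : Submodule ℤ (Quat a b)} {x : Quat a b} :
    x ∈ rmul L (natUnit a b n hn) ↔ ∃ w ∈ L, x = (n : ℤ) • w := by
  constructor
  · rintro ⟨w, hw, rfl⟩
    exact ⟨w, hw, mul_natUnit hn w⟩
  · rintro ⟨w, hw, rfl⟩
    exact ⟨w, hw, mul_natUnit hn w⟩

theorem latticeNorm_rmul_natUnit {n : ℕ} (hn : n ≠ 0) (L : Submodule ℤ (Quat a b)) :
    latticeNorm (rmul L (natUnit a b n hn)) = (n : ℚ) ^ 2 * latticeNorm L := by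
  rw [latticeNorm_rmul, nrd_natUnit, abs_of_nonneg (by positivity)]

theorem isLattice_of_le {L M : Submodule ℤ (Quat a b)} (hM : M.IsLattice ℚ) (h : L ≤ M) {m : ℕ}
    (hm : m ≠ 0) (hmL : ∀ x ∈ M, (m : ℤ) • x ∈ L) : L.IsLattice ℚ := by
  refine ⟨fg_of_le hM.fg h, ?_⟩
  rw [eq_top_iff]
  intro x _
  obtain ⟨k, hk, hx⟩ := exists_smul_mem hM x
  have hk0 : ((m * k : ℕ) : ℚ) ≠ 0 := by exact_mod_cast mul_ne_zero hm hk.ne'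
  have h2 : x = ((m * k : ℕ) : ℚ)⁻¹ • ((m : ℤ) • (k : ℤ) • x) := by
    simp only [← Int.cast_smul_eq_zsmul ℚ, smul_smul]
    push_cast at hk0 ⊢
    rw [inv_mul_cancel₀ hk0, one_smul]
  rw [h2]
  exact Submodule.smul_mem _ _ (Submodule.subset_span (hmL _ hx))

variable {p : ℕ} [hp : Fact p.Prime]

theorem padicNorm_latticeNorm_le_of_loc (ha : a < 0) (hb : b < 0) {L M : Submodule ℤ (Quat a b)}
    (hL : L.IsLattice ℚ) (hM : M.IsLattice ℚ) (h : loc p L ≤ loc p M) :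
    padicNorm p (latticeNorm L) ≤ padicNorm p (latticeNorm M) := by
  refine padicNorm_latticeNorm_le ha hb hL.fg (ne_bot_of_isLattice hL) (padicNorm.nonneg _)
    fun x hx => ?_
  obtain ⟨m, hm, hx⟩ := h (le_loc _ hx)
  have h1 := padicNorm_nrd_le (p := p) ha hb hM.fg (ne_bot_of_isLattice hM) hx
  rwa [← Int.cast_smul_eq_zsmul ℚ, nrd_smul, padicNorm.mul, padicNorm_pow, Int.cast_natCast,
    (padicNorm.nat_eq_one_iff _).2 hm, one_pow, one_mul] at h1

theorem padicNorm_latticeNorm_congr (ha : a < 0) (hb : b < 0) {L M : Submodule ℤ (Quat a b)}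
    (hL : L.IsLattice ℚ) (hM : M.IsLattice ℚ) (h : loc p L = loc p M) :
    padicNorm p (latticeNorm L) = padicNorm p (latticeNorm M) :=
  le_antisymm (padicNorm_latticeNorm_le_of_loc ha hb hL hM h.le)
    (padicNorm_latticeNorm_le_of_loc ha hb hM hL h.ge)

variable (ha : a < 0) (hb : b < 0) {O : Subalgebra ℤ (Quat a b)}
  (hO : (Subalgebra.toSubmodule O).IsLattice ℚ)
include ha hb hO

omit hO in
theorem IsLeftIdeal.norm_pos {𝔞 : Submodule ℤ (Quat a b)} (h : IsLeftIdeal O 𝔞) :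
    0 < latticeNorm 𝔞 := latticeNorm_pos ha hb h.1.fg (ne_bot_of_isLattice h.1)

theorem IsLeftIdeal.exists_gen' {𝔞 : Submodule ℤ (Quat a b)} (h : IsLeftIdeal O 𝔞) (p : ℕ)
    [Fact p.Prime] : ∃ y : (Quat a b)ˣ, (∀ x, x ∈ loc p 𝔞 ↔
      x * ((y⁻¹ : (Quat a b)ˣ) : Quat a b) ∈ loc p (Subalgebra.toSubmodule O)) ∧
      padicNorm p (nrd (y : Quat a b)) = padicNorm p (latticeNorm 𝔞) ∧
      (y : Quat a b) ∈ loc p 𝔞 := by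
  obtain ⟨y, hy⟩ := h.exists_gen ha hb hO p
  refine ⟨y, fun x => by rw [hy, Units.val_one, one_mul], ?_, ?_⟩
  · rw [padicNorm_latticeNorm ha hb hO h.1 hy, Units.val_one, nrd_one, div_one]
  · have := gen_mem_loc hy
    rwa [inv_one, one_mul] at this

omit ha hb in
theorem smul_inv_mem_loc {u : (Quat a b)ˣ}
    (hu : (u : Quat a b) ∈ loc p (Subalgebra.toSubmodule O)) {r : ℚ}
    (h : padicNorm p r ≤ padicNorm p (nrd (u : Quat a b))) :
    r • ((u⁻¹ : (Quat a b)ˣ) : Quat a b) ∈ loc p (Subalgebra.toSubmodule O) := by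
  rw [unit_inv_eq, smul_smul, ← div_eq_mul_inv]
  refine smul_mem_loc ?_ (star_mem_loc hO hu)
  rw [padicNorm.div]
  exact div_le_one_of_le₀ h (padicNorm.nonneg _)

/-- If `𝔟 ⊆ 𝔞` are left ideals with `N 𝔟 = m N 𝔞` then `m 𝔞 ⊆ 𝔟`, locally at each prime. -/
theorem smul_mem_loc_of_le {𝔞 𝔟 : Submodule ℤ (Quat a b)} (h𝔞 : IsLeftIdeal O 𝔞)
    (h𝔟 : IsLeftIdeal O 𝔟) (hle : 𝔟 ≤ 𝔞) {r : ℚ}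
    (hr : padicNorm p r * padicNorm p (latticeNorm 𝔞) ≤ padicNorm p (latticeNorm 𝔟))
    {x : Quat a b} (hx : x ∈ loc p 𝔞) : r • x ∈ loc p 𝔟 := by
  obtain ⟨y, hy, hy1, -⟩ := h𝔞.exists_gen' ha hb hO p
  obtain ⟨z, hz, hz1, hz2⟩ := h𝔟.exists_gen' ha hb hO p
  have h1 := (hy _).1 (loc_mono hle hz2)
  rw [← Units.val_mul] at h1
  have h2 : padicNorm p r ≤ padicNorm p (nrd ((z * y⁻¹ : (Quat a b)ˣ) : Quat a b)) := by
    rw [Units.val_mul, nrd_mul, nrd_unit_inv, ← div_eq_mul_inv, padicNorm.div, hz1, hy1,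
      le_div_iff₀]
    · exact hr
    · exact lt_of_le_of_ne (padicNorm.nonneg _)
        (padicNorm.nonzero (h𝔞.norm_pos ha hb).ne').symm
  have h3 := mul_mem_loc ((hy x).1 hx) (smul_inv_mem_loc hO h1 h2)
  rw [hz]
  rw [mul_inv_rev, inv_inv, mul_smul_comm, Units.val_mul, mul_assoc, ← mul_assoc _ (y : Quat a b),
    Units.inv_mul, one_mul] at h3
  rwa [smul_mul_assoc]

theorem loc_eq_of_le {𝔞 𝔟 : Submodule ℤ (Quat a b)} (h𝔞 : IsLeftIdeal O 𝔞)
    (h𝔟 : IsLeftIdeal O 𝔟) (hle : 𝔟 ≤ 𝔞)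
    (h : padicNorm p (latticeNorm 𝔞) = padicNorm p (latticeNorm 𝔟)) : loc p 𝔟 = loc p 𝔞 := by
  refine le_antisymm (loc_mono hle) fun x hx => ?_
  have := smul_mem_loc_of_le ha hb hO h𝔞 h𝔟 hle (r := 1) (by rw [padicNorm.one, one_mul, h]) hx
  rwa [one_smul] at this

omit hp in
theorem eq_of_le_of_latticeNorm_eq {𝔞 𝔟 : Submodule ℤ (Quat a b)} (h𝔞 : IsLeftIdeal O 𝔞)
    (h𝔟 : IsLeftIdeal O 𝔟) (hle : 𝔟 ≤ 𝔞) (h : latticeNorm 𝔟 = latticeNorm 𝔞) : 𝔟 = 𝔞 :=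
  eq_of_forall_loc_eq fun p _ => loc_eq_of_le ha hb hO h𝔞 h𝔟 hle (by rw [h])

omit hp in
theorem smul_mem_of_mem_heckeSet {𝔞 𝔟 : LeftIdeal O} {m : ℕ} (h : 𝔟 ∈ heckeSet m 𝔞)
    {x : Quat a b} (hx : x ∈ 𝔞.1) : (m : ℤ) • x ∈ 𝔟.1 := by
  refine mem_of_forall_mem_loc fun p _ => ?_
  have := smul_mem_loc_of_le (p := p) ha hb hO 𝔞.2 𝔟.2 h.1 (r := (m : ℚ))
    (by rw [h.2, padicNorm.mul]) (le_loc _ hx)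
  rwa [← Int.cast_natCast, Int.cast_smul_eq_zsmul] at this

omit hp in
theorem heckeSet_finite {m : ℕ} (hm : m ≠ 0) (𝔞 : LeftIdeal O) : (heckeSet m 𝔞).Finite := by
  obtain ⟨g, -, -, -⟩ := exists_gramData ha hb 𝔞.2.1
  have : NeZero m := ⟨hm⟩
  -- an ideal of `T_m(𝔞)` contains `m 𝔞`, so it is determined by its image in `𝔞 / m 𝔞`
  have hinj : Set.InjOn (fun 𝔟 : LeftIdeal O => {v | ∃ x : 𝔞.1, (x : Quat a b) ∈ 𝔟.1 ∧
      g.red m x = v}) (heckeSet m 𝔞) := by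
    have key : ∀ 𝔟 ∈ heckeSet m 𝔞, ∀ x : 𝔞.1, (x : Quat a b) ∈ 𝔟.1 ↔
        ∃ x' : 𝔞.1, (x' : Quat a b) ∈ 𝔟.1 ∧ g.red m x' = g.red m x := by
      intro 𝔟 h𝔟 x
      refine ⟨fun hx => ⟨x, hx, rfl⟩, ?_⟩
      rintro ⟨x', hx', h⟩
      have h1 : g.red m (x - x') = 0 := by rw [map_sub, h, sub_self]
      obtain ⟨w, hw, h2⟩ := (g.red_eq_zero_iff m _).1 h1
      have h3 : (x : Quat a b) = x' + (m : ℤ) • w := by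
        rw [← h2]; simp
      rw [h3]
      exact 𝔟.1.add_mem hx' (smul_mem_of_mem_heckeSet ha hb hO h𝔟 hw)
    intro 𝔟 h𝔟 𝔠 h𝔠 h
    have h' := fun v => Set.ext_iff.1 h v
    refine Subtype.ext (Submodule.ext fun x => ?_)
    constructor
    · intro hx
      exact (key 𝔠 h𝔠 ⟨x, h𝔟.1 hx⟩).2 ((h' _).1 ⟨⟨x, h𝔟.1 hx⟩, hx, rfl⟩)
    · intro hx
      exact (key 𝔟 h𝔟 ⟨x, h𝔠.1 hx⟩).2 ((h' _).2 ⟨⟨x, h𝔠.1 hx⟩, hx, rfl⟩)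
  exact Set.Finite.of_finite_image (Set.toFinite _) hinj

omit hp in
theorem heckeSet_one (𝔞 : LeftIdeal O) : heckeSet 1 𝔞 = {𝔞} := by
  ext 𝔟
  rw [Set.mem_singleton_iff]
  constructor
  · rintro ⟨h1, h2⟩
    exact Subtype.ext (eq_of_le_of_latticeNorm_eq ha hb hO 𝔞.2 𝔟.2 h1 (by simpa using h2))
  · rintro rfl
    exact ⟨le_rfl, by simp⟩

end Inclusion

/-! ### Left ideals of prime index -/

section Neighbor

open Matrix

variable {a b : ℚ}

/-- The lattice `O x + p 𝔞`. -/
noncomputable def neighbor (O : Subalgebra ℤ (Quat a b)) (𝔞 : Submodule ℤ (Quat a b)) {p : ℕ}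
    (hp : p ≠ 0) (x : Quat a b) : Submodule ℤ (Quat a b) :=
  (Subalgebra.toSubmodule O).map (LinearMap.mulRight ℤ x) ⊔ rmul 𝔞 (natUnit a b p hp)

theorem mem_neighbor_self (O : Subalgebra ℤ (Quat a b)) (𝔞 : Submodule ℤ (Quat a b)) {p : ℕ}
    (hp : p ≠ 0) (x : Quat a b) : x ∈ neighbor O 𝔞 hp x :=
  Submodule.mem_sup_left ⟨1, O.one_mem, one_mul x⟩

theorem smul_mem_neighbor (O : Subalgebra ℤ (Quat a b)) {𝔞 : Submodule ℤ (Quat a b)} {p : ℕ}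
    (hp : p ≠ 0) (x : Quat a b) {w : Quat a b} (hw : w ∈ 𝔞) :
    (p : ℤ) • w ∈ neighbor O 𝔞 hp x :=
  Submodule.mem_sup_right ((mem_rmul_natUnit hp).2 ⟨w, hw, rfl⟩)

variable (ha : a < 0) (hb : b < 0) {O : Subalgebra ℤ (Quat a b)}
  (hO : (Subalgebra.toSubmodule O).IsLattice ℚ) {N : ℕ}
  (hN : ∀ x ∈ dualLattice (Subalgebra.toSubmodule O), ∃ k : ℤ, N * nrd x = k)
  {p : ℕ} [hp : Fact p.Prime] {𝔞 : Submodule ℤ (Quat a b)} (h𝔞 : IsLeftIdeal O 𝔞)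
include ha hb hO h𝔞

omit h𝔞 in
theorem neighbor_le {𝔟 : Submodule ℤ (Quat a b)} (h𝔟 : IsLeftIdeal O 𝔟) {x : Quat a b}
    (hx : x ∈ 𝔟) (h : ∀ w ∈ 𝔞, (p : ℤ) • w ∈ 𝔟) : neighbor O 𝔞 hp.out.ne_zero x ≤ 𝔟 := by
  refine sup_le ?_ fun y hy => ?_
  · rintro _ ⟨r, hr, rfl⟩
    exact h𝔟.mul_mem ha hb hO hr hx
  · obtain ⟨w, hw, rfl⟩ := (mem_rmul_natUnit _).1 hy
    exact h w hw

include hN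

/-- A primitive vector of `𝔞` that is isotropic modulo `p` is congruent modulo `p 𝔞` to a vector
whose norm has exact valuation one. -/
theorem exists_add_smul_padicNorm (hpN : ¬ p ∣ N) {x : Quat a b} (hx : x ∈ 𝔞)
    (hx0 : ¬ ∃ w ∈ 𝔞, x = (p : ℤ) • w)
    (hxp : ∃ k : ℤ, nrd x = (p * k : ℤ) * latticeNorm 𝔞) :
    ∃ w ∈ 𝔞, padicNorm p (nrd (x + (p : ℤ) • w)) = padicNorm p p * padicNorm p (latticeNorm 𝔞) := by
  obtain ⟨k, hk⟩ := hxp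
  by_cases hpk : (p : ℤ) ∣ k
  -- move `x` by `p w`, where `w` is not orthogonal to `x` modulo `p`
  · obtain ⟨g, -, -, -⟩ := exists_gramData ha hb h𝔞.1
    have h1 : g.red p ⟨x, hx⟩ ≠ 0 := fun h => hx0 ((g.red_eq_zero_iff p _).1 h)
    have h2 : ∃ w : 𝔞, ¬ (p : ℤ) ∣ g.coord ⟨x, hx⟩ ⬝ᵥ (g.form + g.formᵀ) *ᵥ g.coord w := by
      by_contra! hcon
      refine h1 (g.polarNondeg ha hb hO hN (h𝔞.isLocallySimilar ha hb hO) hpN _ fun v => ?_)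
      obtain ⟨w, rfl⟩ := g.red_surjective p v
      have h3 := (ZMod.intCast_zmod_eq_zero_iff_dvd _ p).2 (hcon w)
      rw [← h3]
      simp [dotProduct, Matrix.mulVec, GramData.red, GramData.formMod]
    obtain ⟨w, hw⟩ := h2
    obtain ⟨l, hl⟩ := exists_nrd_eq_mul ha hb h𝔞.1.fg (ne_bot_of_isLattice h𝔞.1) w.2
    have h3 := g.trd_eq ⟨x, hx⟩ w
    set β := g.coord ⟨x, hx⟩ ⬝ᵥ (g.form + g.formᵀ) *ᵥ g.coord w
    refine ⟨w, w.2, ?_⟩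
    have h4 : nrd (x + (p : ℤ) • (w : Quat a b)) =
        (p : ℚ) * (k + p * l + β : ℤ) * latticeNorm 𝔞 := by
      rw [nrd_add, ← Int.cast_smul_eq_zsmul ℚ, nrd_smul, star_smul, star_trivial, mul_smul_comm,
        trd_smul, h3, hk, hl]
      push_cast
      ring
    rw [h4, padicNorm.mul, padicNorm.mul, (padicNorm.int_eq_one_iff _).2, mul_one]
    intro h5
    exact hw ((Int.dvd_add_right (dvd_add hpk (dvd_mul_right _ _))).1 h5)
  · refine ⟨0, 𝔞.zero_mem, ?_⟩
    rw [smul_zero, add_zero, hk]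
    push_cast
    rw [padicNorm.mul, padicNorm.mul, (padicNorm.int_eq_one_iff _).2 hpk, mul_one]

/-- For `x ∈ 𝔞` outside `p 𝔞` with norm divisible by `p`, the lattice `O x + p 𝔞` is an ideal of
`T_p(𝔞)`. -/
theorem neighbor_spec (hpN : ¬ p ∣ N) {x : Quat a b} (hx : x ∈ 𝔞)
    (hx0 : ¬ ∃ w ∈ 𝔞, x = (p : ℤ) • w)
    (hxp : ∃ k : ℤ, nrd x = (p * k : ℤ) * latticeNorm 𝔞) :
    IsLeftIdeal O (neighbor O 𝔞 hp.out.ne_zero x) ∧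
      latticeNorm (neighbor O 𝔞 hp.out.ne_zero x) = p * latticeNorm 𝔞 := by
  set 𝔟 := neighbor O 𝔞 hp.out.ne_zero x with h𝔟def
  have hpa : ∀ w ∈ 𝔞, (p : ℤ) • w ∈ 𝔟 := fun w hw => smul_mem_neighbor O _ x hw
  have hle : 𝔟 ≤ 𝔞 := neighbor_le ha hb hO h𝔞 hx fun w hw => 𝔞.smul_mem _ hw
  have hlat : 𝔟.IsLattice ℚ := isLattice_of_le h𝔞.1 hle hp.out.ne_zero hpa
  have hmul : ∀ r ∈ O, r * x ∈ 𝔟 := fun r hr => Submodule.mem_sup_left ⟨r, hr, rfl⟩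
  have hpos := h𝔞.norm_pos ha hb
  have hp0 : (p : ℚ) ≠ 0 := Nat.cast_ne_zero.2 hp.out.ne_zero
  -- away from `p` the lattice coincides with `𝔞`
  have hother : ∀ (l : ℕ) [Fact l.Prime], l ≠ p → loc l 𝔟 = loc l 𝔞 := by
    intro l hl hlp
    refine le_antisymm (loc_mono hle) (loc_le_loc_of_le fun v hv => ⟨p, fun h =>
      hlp ((Nat.prime_dvd_prime_iff_eq hl.out hp.out).1 h), hpa v hv⟩)
  -- at `p` it is generated by the perturbed vector
  obtain ⟨w, hw, hnorm⟩ := exists_add_smul_padicNorm ha hb hO hN h𝔞 hpN hx hx0 hxp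
  have hx'0 : x + (p : ℤ) • w ≠ 0 := by
    intro h
    rw [h, nrd_zero, padicNorm.zero] at hnorm
    exact mul_ne_zero (padicNorm.nonzero hp0) (padicNorm.nonzero hpos.ne') hnorm.symm
  obtain ⟨x', hx'⟩ := exists_unit_eq ha hb hx'0
  rw [← hx'] at hnorm
  obtain ⟨y, hy, hy1, -⟩ := h𝔞.exists_gen' ha hb hO p
  have hx'𝔞 : (x' : Quat a b) ∈ 𝔞 := hx' ▸ 𝔞.add_mem hx (𝔞.smul_mem _ hw)
  have hu : ((x' * y⁻¹ : (Quat a b)ˣ) : Quat a b) ∈ loc p (Subalgebra.toSubmodule O) := by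
    rw [Units.val_mul]
    exact (hy _).1 (le_loc _ hx'𝔞)
  have hpx' : ∀ v ∈ 𝔞, (p : ℤ) • v ∈ rmul (loc p (Subalgebra.toSubmodule O)) x' := by
    intro v hv
    have h1 := smul_inv_mem_loc (r := (p : ℚ)) hO hu (by
      rw [Units.val_mul, nrd_mul, nrd_unit_inv, ← div_eq_mul_inv, padicNorm.div, hnorm, hy1,
        mul_div_cancel_right₀ _ (padicNorm.nonzero hpos.ne')])
    have h2 := mul_mem_loc ((hy v).1 (le_loc _ hv)) h1
    rw [_root_.mul_inv_rev, inv_inv, mul_smul_comm, Units.val_mul, mul_assoc,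
      ← mul_assoc _ (y : Quat a b), Units.inv_mul, one_mul] at h2
    rwa [mem_rmul, smul_mul_assoc, ← Int.cast_smul_eq_zsmul ℚ, Int.cast_natCast]
  have hloc : loc p 𝔟 = rmul (loc p (Subalgebra.toSubmodule O)) x' := by
    refine le_antisymm ?_ ?_
    · rw [← loc_loc (Subalgebra.toSubmodule O), ← loc_rmul]
      refine loc_mono (sup_le ?_ fun v hv => ?_)
      · rintro _ ⟨r, hr, rfl⟩
        have h1 : r * x = r * (x' : Quat a b) - (p : ℤ) • (r * w) := by
          rw [hx', mul_add, mul_smul_comm, add_sub_cancel_right]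
        rw [LinearMap.mulRight_apply, h1]
        exact Submodule.sub_mem _ ⟨r, le_loc _ hr, rfl⟩ (hpx' _ (h𝔞.mul_mem ha hb hO hr hw))
      · obtain ⟨w, hw, rfl⟩ := (mem_rmul_natUnit _).1 hv
        exact hpx' w hw
    · rintro _ ⟨r, ⟨m, hm, hr⟩, rfl⟩
      refine ⟨m, hm, ?_⟩
      rw [LinearMap.mulRight_apply, ← smul_mul_assoc, hx', mul_add, mul_smul_comm]
      exact 𝔟.add_mem (hmul _ hr) (hpa _ (h𝔞.mul_mem ha hb hO hr hw))
  have hideal : IsLeftIdeal O 𝔟 := by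
    rw [isLeftIdeal_iff ha hb hO]
    refine ⟨hlat, fun l hl => ?_⟩
    by_cases hlp : l = p
    · subst hlp
      exact ⟨x', hloc⟩
    · rw [hother l hlp]
      exact ((isLeftIdeal_iff ha hb hO).1 h𝔞).2 l
  refine ⟨hideal, eq_of_padicNorm_eq (hideal.norm_pos ha hb) (mul_pos (by
    exact_mod_cast hp.out.pos) hpos) fun l hl => ?_⟩
  by_cases hlp : l = p
  · subst hlp
    have h1 : LocSimilar O l 𝔟 1 x' := fun v => by
      rw [hloc, mem_rmul, Units.val_one, one_mul]
    rw [padicNorm_latticeNorm ha hb hO hlat h1, Units.val_one, nrd_one, div_one, hnorm,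
      padicNorm.mul]
  · rw [padicNorm_latticeNorm_congr ha hb hlat h𝔞.1 (hother l hlp), padicNorm.mul,
      (padicNorm.nat_eq_one_iff p).2 fun h => hlp ((Nat.prime_dvd_prime_iff_eq hl.out hp.out).1 h),
      one_mul]

end Neighbor

/-! ### The sets `T_m(𝔞)` -/

section HeckeSets

open Matrix Module

variable {a b : ℚ} (ha : a < 0) (hb : b < 0) {O : Subalgebra ℤ (Quat a b)}
  (hO : (Subalgebra.toSubmodule O).IsLattice ℚ)

/-- The finite set `T_m(𝔞)` for `m ≥ 1`. -/
noncomputable def heckeFinset {m : ℕ} (hm : m ≠ 0) (𝔞 : LeftIdeal O) : Finset (LeftIdeal O) :=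
  (heckeSet_finite ha hb hO hm 𝔞).toFinset

theorem mem_heckeFinset {m : ℕ} (hm : m ≠ 0) {𝔞 𝔟 : LeftIdeal O} :
    𝔟 ∈ heckeFinset ha hb hO hm 𝔞 ↔ 𝔟 ∈ heckeSet m 𝔞 := by
  rw [heckeFinset, Set.Finite.mem_toFinset]

theorem mem_heckeSet_mul {m n : ℕ} {𝔞 𝔟 𝔠 : LeftIdeal O} (h𝔟 : 𝔟 ∈ heckeSet n 𝔞)
    (h𝔠 : 𝔠 ∈ heckeSet m 𝔟) : 𝔠 ∈ heckeSet (m * n) 𝔞 := by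
  refine ⟨h𝔠.1.trans h𝔟.1, ?_⟩
  rw [h𝔠.2, h𝔟.2]
  push_cast
  ring

theorem mem_heckeSet_of_le {m n : ℕ} {𝔞 𝔟 𝔠 : LeftIdeal O} (h𝔟 : 𝔟 ∈ heckeSet n 𝔞)
    (h𝔠 : 𝔠 ∈ heckeSet (m * n) 𝔞) (hle : 𝔠.1 ≤ 𝔟.1) : 𝔠 ∈ heckeSet m 𝔟 := by
  refine ⟨hle, ?_⟩
  rw [h𝔠.2, h𝔟.2]
  push_cast
  ring

open Classical in
theorem sum_heckeFinset_heckeFinset {A : Type*} [AddCommMonoid A] {m n : ℕ} (hm : m ≠ 0)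
    (hn : n ≠ 0) (𝔞 : LeftIdeal O) (F : LeftIdeal O → A) :
    ∑ 𝔟 ∈ heckeFinset ha hb hO hn 𝔞, ∑ 𝔠 ∈ heckeFinset ha hb hO hm 𝔟, F 𝔠 =
      ∑ 𝔠 ∈ heckeFinset ha hb hO (mul_ne_zero hm hn) 𝔞,
        ((heckeFinset ha hb hO hn 𝔞).filter fun 𝔟 => 𝔠.1 ≤ 𝔟.1).card • F 𝔠 := by
  rw [Finset.sum_comm' (t' := heckeFinset ha hb hO (mul_ne_zero hm hn) 𝔞)
    (s' := fun 𝔠 => (heckeFinset ha hb hO hn 𝔞).filter fun 𝔟 => 𝔠.1 ≤ 𝔟.1)]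
  · exact Finset.sum_congr rfl fun 𝔠 _ => Finset.sum_const _
  · intro 𝔟 𝔠
    simp only [mem_heckeFinset, Finset.mem_filter]
    exact ⟨fun h => ⟨⟨h.1, h.2.1⟩, mem_heckeSet_mul h.1 h.2⟩,
      fun h => ⟨h.1.1, mem_heckeSet_of_le h.1.1 h.2 h.1.2⟩⟩

include ha hb hO

/-- For coprime `m` and `n` there is exactly one ideal of `T_n(𝔞)` above an ideal `𝔠` of
`T_{mn}(𝔞)`, namely `𝔠 + n 𝔞`. -/
theorem existsUnique_heckeSet_of_coprime {m n : ℕ} (hn : n ≠ 0) (hmn : m.Coprime n)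
    {𝔞 𝔠 : LeftIdeal O} (h𝔠 : 𝔠 ∈ heckeSet (m * n) 𝔞) :
    ∃! 𝔟 : LeftIdeal O, 𝔟 ∈ heckeSet n 𝔞 ∧ 𝔠.1 ≤ 𝔟.1 := by
  set L := 𝔠.1 ⊔ rmul 𝔞.1 (natUnit a b n hn) with hL
  have hnL : ∀ w ∈ 𝔞.1, (n : ℤ) • w ∈ L := fun w hw =>
    Submodule.mem_sup_right ((mem_rmul_natUnit hn).2 ⟨w, hw, rfl⟩)
  have hle : L ≤ 𝔞.1 := sup_le h𝔠.1 fun x hx => by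
    obtain ⟨w, hw, rfl⟩ := (mem_rmul_natUnit hn).1 hx
    exact 𝔞.1.smul_mem _ hw
  have hlat : L.IsLattice ℚ := isLattice_of_le 𝔞.2.1 hle hn hnL
  -- the lattice `𝔠 + n 𝔞` is `𝔠` at the primes dividing `n` and `𝔞` at the other primes
  have h1 : ∀ (p : ℕ) [Fact p.Prime], p ∣ n → loc p L = loc p 𝔠.1 := by
    intro p hp hpn
    have hpm : ¬ p ∣ m := fun h => Nat.not_coprime_of_dvd_of_dvd hp.out.one_lt h hpn hmn
    refine le_antisymm (loc_le_loc_of_le (sup_le (le_loc _) fun x hx => ?_))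
      (loc_mono le_sup_left)
    obtain ⟨w, hw, rfl⟩ := (mem_rmul_natUnit hn).1 hx
    refine ⟨m, hpm, ?_⟩
    have := smul_mem_of_mem_heckeSet ha hb hO h𝔠 hw
    rwa [Nat.cast_mul, mul_smul] at this
  have h2 : ∀ (p : ℕ) [Fact p.Prime], ¬ p ∣ n → loc p L = loc p 𝔞.1 := fun p hp hpn =>
    le_antisymm (loc_mono hle) (loc_le_loc_of_le fun x hx => ⟨n, hpn, hnL x hx⟩)
  have hideal : IsLeftIdeal O L := by
    rw [isLeftIdeal_iff ha hb hO]
    refine ⟨hlat, fun p hp => ?_⟩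
    by_cases hpn : p ∣ n
    · rw [h1 p hpn]
      exact ((isLeftIdeal_iff ha hb hO).1 𝔠.2).2 p
    · rw [h2 p hpn]
      exact ((isLeftIdeal_iff ha hb hO).1 𝔞.2).2 p
  have hnorm : latticeNorm L = n * latticeNorm 𝔞.1 := by
    refine eq_of_padicNorm_eq (hideal.norm_pos ha hb) (mul_pos (by
      exact_mod_cast Nat.pos_of_ne_zero hn) (𝔞.2.norm_pos ha hb)) fun p hp => ?_
    by_cases hpn : p ∣ n
    · have hpm : ¬ p ∣ m := fun h => Nat.not_coprime_of_dvd_of_dvd hp.out.one_lt h hpn hmn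
      rw [padicNorm_latticeNorm_congr ha hb hlat 𝔠.2.1 (h1 p hpn), h𝔠.2, Nat.cast_mul, mul_assoc,
        padicNorm.mul, (padicNorm.nat_eq_one_iff m).2 hpm, one_mul]
    · rw [padicNorm_latticeNorm_congr ha hb hlat 𝔞.2.1 (h2 p hpn), padicNorm.mul,
        (padicNorm.nat_eq_one_iff n).2 hpn, one_mul]
  refine ⟨⟨L, hideal⟩, ⟨⟨hle, hnorm⟩, le_sup_left⟩, ?_⟩
  rintro 𝔟 ⟨h𝔟, h𝔠𝔟⟩
  refine Subtype.ext (eq_of_le_of_latticeNorm_eq ha hb hO 𝔟.2 hideal (sup_le h𝔠𝔟 fun x hx => ?_)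
    (by rw [hnorm, h𝔟.2])).symm
  obtain ⟨w, hw, rfl⟩ := (mem_rmul_natUnit hn).1 hx
  exact smul_mem_of_mem_heckeSet ha hb hO h𝔟 hw

variable {N : ℕ} (hN : ∀ x ∈ dualLattice (Subalgebra.toSubmodule O), ∃ k : ℤ, N * nrd x = k)
  {p : ℕ} [hp : Fact p.Prime]

omit hO hp in
theorem exists_nrd_eq_of_mem_heckeSet {m : ℕ} {𝔞 𝔟 : LeftIdeal O} (h𝔟 : 𝔟 ∈ heckeSet m 𝔞)
    (hpm : p ∣ m) {x : Quat a b} (hx : x ∈ 𝔟.1) :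
    ∃ k : ℤ, nrd x = (p * k : ℤ) * latticeNorm 𝔞.1 := by
  obtain ⟨k, hk⟩ := exists_nrd_eq_mul ha hb 𝔟.2.1.fg (ne_bot_of_isLattice 𝔟.2.1) hx
  obtain ⟨c, rfl⟩ := hpm
  refine ⟨c * k, ?_⟩
  rw [hk, h𝔟.2]
  push_cast
  ring

include hN

/-- An ideal of `T_p(𝔞)` is determined by any of its vectors outside `p 𝔞`. -/
theorem eq_neighbor (hpN : ¬ p ∣ N) {𝔞 𝔟 : LeftIdeal O} (h𝔟 : 𝔟 ∈ heckeSet p 𝔞) {x : Quat a b}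
    (hx : x ∈ 𝔟.1) (hx0 : ¬ ∃ w ∈ 𝔞.1, x = (p : ℤ) • w) :
    𝔟.1 = neighbor O 𝔞.1 hp.out.ne_zero x := by
  obtain ⟨h1, h2⟩ := neighbor_spec ha hb hO hN 𝔞.2 hpN (h𝔟.1 hx) hx0
    (exists_nrd_eq_of_mem_heckeSet ha hb h𝔟 dvd_rfl hx)
  exact (eq_of_le_of_latticeNorm_eq ha hb hO 𝔟.2 h1 (neighbor_le ha hb hO 𝔟.2 hx fun w hw =>
    smul_mem_of_mem_heckeSet ha hb hO h𝔟 hw) (by rw [h2, h𝔟.2])).symm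

omit hN in
/-- An ideal contained in `𝔞` but not in `p 𝔞` contains a vector `x ∉ p 𝔞` that generates it
at `p`; then it is contained in `O x + p 𝔞`, which is `𝔞` away from `p`. -/
theorem exists_le_neighbor {𝔞 𝔠 : LeftIdeal O} (hle : 𝔠.1 ≤ 𝔞.1)
    (h : ¬ 𝔠.1 ≤ rmul 𝔞.1 (natUnit a b p hp.out.ne_zero)) :
    ∃ x ∈ 𝔠.1, (¬ ∃ w ∈ 𝔞.1, x = (p : ℤ) • w) ∧ 𝔠.1 ≤ neighbor O 𝔞.1 hp.out.ne_zero x := by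
  obtain ⟨z, hz, -, m, hm, hx⟩ := 𝔠.2.exists_gen' ha hb hO p
  have hgen : ∀ v ∈ 𝔠.1, ∃ (k : ℕ) (r : Quat a b), ¬ p ∣ k ∧ r ∈ O ∧
      (k : ℤ) • v = r * ((m : ℤ) • (z : Quat a b)) := by
    intro v hv
    obtain ⟨k, hk, hr⟩ := (hz v).1 (le_loc _ hv)
    refine ⟨m * k, _, fun h => (hp.out.dvd_mul.1 h).elim hm hk, hr, ?_⟩
    rw [smul_mul_assoc, mul_smul_comm, mul_assoc, Units.inv_mul, mul_one, smul_smul, Nat.cast_mul,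
      mul_comm (m : ℤ)]
  have hother : ∀ {M : Submodule ℤ (Quat a b)}, (∀ w ∈ 𝔞.1, (p : ℤ) • w ∈ M) →
      (∀ r ∈ O, r * ((m : ℤ) • (z : Quat a b)) ∈ M) → 𝔠.1 ≤ M := by
    intro M h1 h2
    refine le_of_forall_loc_le fun l hl v hv => ?_
    by_cases hlp : l = p
    · subst hlp
      obtain ⟨k, r, hk, hr, h3⟩ := hgen v hv
      exact ⟨k, hk, h3 ▸ h2 r hr⟩
    · exact ⟨p, fun h => hlp ((Nat.prime_dvd_prime_iff_eq hl.out hp.out).1 h), h1 v (hle hv)⟩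
  refine ⟨_, hx, ?_, hother (fun w hw => smul_mem_neighbor O _ _ hw)
    fun r hr => Submodule.mem_sup_left ⟨r, hr, rfl⟩⟩
  rintro ⟨w, hw, h1⟩
  refine h (hother (fun w hw => (mem_rmul_natUnit _).2 ⟨w, hw, rfl⟩) fun r hr => ?_)
  rw [h1, mul_smul_comm]
  exact (mem_rmul_natUnit _).2 ⟨_, 𝔞.2.mul_mem ha hb hO hr hw, rfl⟩

omit hN hO in
theorem not_le_rmul_of_mem_heckeSet {𝔞 𝔟 : LeftIdeal O} (h𝔟 : 𝔟 ∈ heckeSet p 𝔞) :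
    ¬ 𝔟.1 ≤ rmul 𝔞.1 (natUnit a b p hp.out.ne_zero) := by
  intro h
  obtain ⟨k, hk⟩ := latticeNorm_eq_mul_of_le ha hb 𝔟.2.1.fg (ne_bot_of_isLattice 𝔟.2.1)
    (𝔞.2.rmul _).1.fg h
  rw [latticeNorm_rmul_natUnit, h𝔟.2, ← mul_assoc, mul_left_inj' (𝔞.2.norm_pos ha hb).ne', sq,
    ← mul_assoc] at hk
  have hp0 : (p : ℚ) ≠ 0 := Nat.cast_ne_zero.2 hp.out.ne_zero
  have h1 : (1 : ℚ) = k * p := mul_right_cancel₀ hp0 (by rw [one_mul]; exact hk)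
  have h2 : (p : ℤ) ∣ 1 := ⟨k, by rw [mul_comm]; exact_mod_cast h1⟩
  exact hp.out.one_lt.ne' (by exact_mod_cast Int.eq_one_of_dvd_one (by positivity) h2)

/-- An ideal of `T_m(𝔞)`, `p ∣ m`, that is not contained in `p 𝔞` is contained in exactly one
ideal of `T_p(𝔞)`. -/
theorem existsUnique_heckeSet_of_not_le (hpN : ¬ p ∣ N) {m : ℕ} (hpm : p ∣ m) {𝔞 𝔠 : LeftIdeal O}
    (h𝔠 : 𝔠 ∈ heckeSet m 𝔞) (h : ¬ 𝔠.1 ≤ rmul 𝔞.1 (natUnit a b p hp.out.ne_zero)) :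
    ∃! 𝔟 : LeftIdeal O, 𝔟 ∈ heckeSet p 𝔞 ∧ 𝔠.1 ≤ 𝔟.1 := by
  obtain ⟨x, hx, hx0, hle⟩ := exists_le_neighbor ha hb hO h𝔠.1 h
  obtain ⟨h1, h2⟩ := neighbor_spec ha hb hO hN 𝔞.2 hpN (h𝔠.1 hx) hx0
    (exists_nrd_eq_of_mem_heckeSet ha hb h𝔠 hpm hx)
  refine ⟨⟨_, h1⟩, ⟨⟨neighbor_le ha hb hO 𝔞.2 (h𝔠.1 hx) fun w hw => 𝔞.1.smul_mem _ hw, h2⟩, hle⟩,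
    ?_⟩
  rintro 𝔟 ⟨h𝔟, h𝔠𝔟⟩
  exact Subtype.ext (eq_neighbor ha hb hO hN hpN h𝔟 (h𝔠𝔟 hx) hx0)

/-- `T_p(𝔞)` has `p + 1` elements: its members correspond to isotropic planes in `𝔞 / p 𝔞`, any
isotropic vector lies in exactly one of them, and the isotropic vectors have been counted. -/
theorem card_heckeFinset_prime (hpN : ¬ p ∣ N) (𝔞 : LeftIdeal O) :
    (heckeFinset ha hb hO hp.out.ne_zero 𝔞).card = p + 1 := by
  classical
  obtain ⟨g, -, -, -⟩ := exists_gramData ha hb 𝔞.2.1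
  have hcol : 𝔞.1 = colon (Subalgebra.toSubmodule O) 𝔞.1 := (colon_order ha hb hO 𝔞.2).symm
  have hnd := g.polarNondeg ha hb hO hN (𝔞.2.isLocallySimilar ha hb hO) hpN
  let S : Finset (Fin 4 → ZMod p) := Finset.univ.filter fun v => qform (g.formMod p) v = 0 ∧ v ≠ 0
  have hS : S.card = (p ^ 2 - 1) * (p + 1) := by
    obtain ⟨v, hv0, hv⟩ := exists_isotropic (g.formMod p)
    obtain ⟨x, rfl⟩ := g.red_surjective p v
    obtain ⟨U, hU, hU2, -⟩ := exists_isotropic_plane ha hb hO hN (isLeftIdeal_order hO) 𝔞.2 hcol g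
      hpN x hv0 hv
    rw [← card_isotropic hnd hU hU2, Nat.card_eq_fintype_card, Fintype.card_subtype]
  -- count the pairs of an ideal and a nonzero isotropic vector modulo `p` in its image
  let r : LeftIdeal O → (Fin 4 → ZMod p) → Prop := fun 𝔟 v =>
    ∃ x : 𝔞.1, (x : Quat a b) ∈ 𝔟.1 ∧ g.red p x = v
  have key := Finset.card_mul_eq_card_mul (s := heckeFinset ha hb hO hp.out.ne_zero 𝔞) (t := S) r
    (m := p ^ 2 - 1) (n := 1) ?_ ?_
  · rw [hS, mul_one, mul_comm] at key
    refine Nat.eq_of_mul_eq_mul_left ?_ key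
    have : 1 < p ^ 2 := Nat.one_lt_pow two_ne_zero hp.out.one_lt
    omega
  · intro 𝔟 h𝔟
    rw [mem_heckeFinset] at h𝔟
    obtain ⟨x, hx, hx0, -⟩ := exists_le_neighbor ha hb hO h𝔟.1
      (not_le_rmul_of_mem_heckeSet ha hb h𝔟)
    have hxp := exists_nrd_eq_of_mem_heckeSet ha hb h𝔟 dvd_rfl hx
    obtain ⟨U, hU, hU2, hUmem⟩ := exists_isotropic_plane ha hb hO hN (isLeftIdeal_order hO) 𝔞.2
      hcol g hpN ⟨x, h𝔟.1 hx⟩ (fun h => hx0 ((g.red_eq_zero_iff p _).1 h))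
      ((g.qform_eq_zero_iff ha hb 𝔞.2.1 p _).2 hxp)
    rw [colon_order ha hb hO (isLeftIdeal_order hO)] at hUmem
    have hrU : ∀ v, r 𝔟 v ↔ v ∈ U := by
      intro v
      rw [hUmem]
      constructor
      · rintro ⟨w, hw, rfl⟩
        rw [eq_neighbor ha hb hO hN hpN h𝔟 hx hx0] at hw
        obtain ⟨_, ⟨s, hs, rfl⟩, y, hy, hw⟩ := Submodule.mem_sup.1 hw
        have hsx : s * x ∈ 𝔞.1 := 𝔞.2.mul_mem ha hb hO hs (h𝔟.1 hx)
        refine ⟨s, hs, ⟨s * x, hsx⟩, rfl, ?_⟩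
        rw [← sub_eq_zero, ← map_sub, g.red_eq_zero_iff]
        obtain ⟨y', hy', rfl⟩ := (mem_rmul_natUnit _).1 hy
        refine ⟨-y', 𝔞.1.neg_mem hy', ?_⟩
        change s * x - (w : Quat a b) = _
        rw [← hw, LinearMap.mulRight_apply, smul_neg]
        abel
      · rintro ⟨s, hs, w, hw, rfl⟩
        exact ⟨w, hw ▸ 𝔟.2.mul_mem ha hb hO hs hx, rfl⟩
    have h1 : Finset.bipartiteAbove r S 𝔟 =
        (Finset.univ.filter fun v => v ∈ U).erase 0 := by
      ext v
      simp only [Finset.bipartiteAbove, Finset.mem_filter, Finset.mem_univ, true_and, S,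
        Finset.mem_erase, hrU]
      exact ⟨fun h => ⟨h.1.2, h.2⟩, fun h => ⟨⟨hU v h.2, h.1⟩, h.2⟩⟩
    rw [h1, Finset.card_erase_of_mem (by simp [U.zero_mem]), ← card_of_finrank_two hU2,
      Nat.card_eq_fintype_card, Fintype.card_subtype]
  · intro v hv
    rw [Finset.mem_filter] at hv
    obtain ⟨-, hv, hv0⟩ := hv
    obtain ⟨x, rfl⟩ := g.red_surjective p v
    have hx0 : ¬ ∃ w ∈ 𝔞.1, (x : Quat a b) = (p : ℤ) • w := fun h =>
      hv0 ((g.red_eq_zero_iff p _).2 h)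
    obtain ⟨h1, h2⟩ := neighbor_spec ha hb hO hN 𝔞.2 hpN x.2 hx0
      ((g.qform_eq_zero_iff ha hb 𝔞.2.1 p _).1 hv)
    rw [Finset.card_eq_one]
    let 𝔟₀ : LeftIdeal O := ⟨_, h1⟩
    refine ⟨𝔟₀, ?_⟩
    ext 𝔟
    rw [Finset.bipartiteBelow, Finset.mem_filter, Finset.mem_singleton, mem_heckeFinset]
    constructor
    · rintro ⟨h𝔟, x', hx', hxx'⟩
      refine Subtype.ext (eq_neighbor ha hb hO hN hpN h𝔟 ?_ hx0)
      have h3 : g.red p (x - x') = 0 := by rw [map_sub, hxx', sub_self]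
      obtain ⟨w, hw, h4⟩ := (g.red_eq_zero_iff p _).1 h3
      have h5 : (x : Quat a b) = x' + (p : ℤ) • w := by
        rw [← h4]; simp
      rw [h5]
      exact 𝔟.1.add_mem hx' (smul_mem_of_mem_heckeSet ha hb hO h𝔟 hw)
    · rintro rfl
      exact ⟨⟨neighbor_le ha hb hO 𝔞.2 x.2 fun w hw => 𝔞.1.smul_mem _ hw, h2⟩, x,
        mem_neighbor_self _ _ _ _, rfl⟩

end HeckeSets

/-! ### Hecke operators -/

section HeckeOperators

variable {a b : ℚ} (ha : a < 0) (hb : b < 0) {O : Subalgebra ℤ (Quat a b)}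
  (hO : (Subalgebra.toSubmodule O).IsLattice ℚ) (R : Type) [CommRing R]

theorem hecke_single {m : ℕ} (hm : m ≠ 0) (𝔞 : LeftIdeal O) :
    hecke R m (Finsupp.single (cls 𝔞) 1) =
      ∑ 𝔟 ∈ heckeFinset ha hb hO hm 𝔞, (Finsupp.single (cls 𝔟) 1 : ClassSet O →₀ R) := by
  rw [hecke, Finsupp.linearCombination_single, one_smul, heckeFinset,
    ← finsum_mem_eq_finite_toFinset_sum]
  rfl

theorem hecke_ext {A : Type*} [AddCommGroup A] [Module R A] {f g : (ClassSet O →₀ R) →ₗ[R] A}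
    (h : ∀ 𝔞 : LeftIdeal O, f (Finsupp.single (cls 𝔞) 1) = g (Finsupp.single (cls 𝔞) 1)) :
    f = g := by
  refine Finsupp.lhom_ext' fun c => LinearMap.ext_ring ?_
  induction c using Quotient.inductionOn with
  | h 𝔞 => exact h 𝔞

include ha hb hO

theorem hecke_one : hecke R 1 = (1 : Module.End R (ClassSet O →₀ R)) := by
  refine hecke_ext R fun 𝔞 => ?_
  rw [hecke_single ha hb hO R one_ne_zero, Module.End.one_apply]
  have : heckeFinset ha hb hO one_ne_zero 𝔞 = {𝔞} := by
    ext 𝔟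
    rw [mem_heckeFinset, heckeSet_one ha hb hO, Set.mem_singleton_iff, Finset.mem_singleton]
  rw [this, Finset.sum_singleton]

theorem hecke_mul_of_coprime {m n : ℕ} (hm : m ≠ 0) (hn : n ≠ 0) (hmn : m.Coprime n) :
    hecke R (m * n) = (hecke R m * hecke R n : Module.End R (ClassSet O →₀ R)) := by
  classical
  refine hecke_ext R fun 𝔞 => ?_
  rw [Module.End.mul_apply, hecke_single ha hb hO R hn, map_sum,
    Finset.sum_congr rfl fun 𝔟 _ => hecke_single ha hb hO R hm 𝔟, sum_heckeFinset_heckeFinset,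
    hecke_single ha hb hO R (mul_ne_zero hm hn)]
  refine Finset.sum_congr rfl fun 𝔠 h𝔠 => ?_
  rw [mem_heckeFinset] at h𝔠
  obtain ⟨𝔟, h𝔟, huniq⟩ := existsUnique_heckeSet_of_coprime ha hb hO hn hmn h𝔠
  rw [Finset.card_eq_one.2 ⟨𝔟, ?_⟩, one_smul]
  ext 𝔡
  rw [Finset.mem_filter, mem_heckeFinset, Finset.mem_singleton]
  exact ⟨huniq 𝔡, fun h => h ▸ h𝔟⟩

theorem hecke_prime_pow {N : ℕ}
    (hN : ∀ x ∈ dualLattice (Subalgebra.toSubmodule O), ∃ k : ℤ, N * nrd x = k)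
    {p : ℕ} [hp : Fact p.Prime] (hpN : ¬ p ∣ N) (k : ℕ) :
    (hecke R (p ^ (k + 1)) * hecke R p : Module.End R (ClassSet O →₀ R)) =
      hecke R (p ^ (k + 2)) + p • hecke R (p ^ k) := by
  classical
  have hp0 := hp.out.ne_zero
  refine hecke_ext R fun 𝔞 => ?_
  have hpow : p ^ (k + 1) * p = p ^ (k + 2) := rfl
  let T := heckeFinset ha hb hO (mul_ne_zero (pow_ne_zero (k + 1) hp0) hp0) 𝔞
  rw [Module.End.mul_apply, hecke_single ha hb hO R hp0, map_sum,
    Finset.sum_congr rfl fun 𝔟 _ => hecke_single ha hb hO R (pow_ne_zero (k + 1) hp0) 𝔟,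
    sum_heckeFinset_heckeFinset, LinearMap.add_apply, LinearMap.smul_apply,
    hecke_single ha hb hO R (pow_ne_zero k hp0)]
  have h1 : hecke R (p ^ (k + 2)) (Finsupp.single (cls 𝔞) 1) =
      ∑ 𝔠 ∈ T, (Finsupp.single (cls 𝔠) 1 : ClassSet O →₀ R) :=
    hecke_single ha hb hO R (mul_ne_zero (pow_ne_zero (k + 1) hp0) hp0) 𝔞
  let u := natUnit a b p hp0
  -- the ideals of `T_{p^k}(𝔞)` correspond to those of `T_{p^(k+2)}(𝔞)` contained in `p 𝔞`
  have h2 : ∑ 𝔟 ∈ heckeFinset ha hb hO (pow_ne_zero k hp0) 𝔞,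
      (Finsupp.single (cls 𝔟) 1 : ClassSet O →₀ R) =
      ∑ 𝔠 ∈ T.filter fun 𝔠 => 𝔠.1 ≤ rmul 𝔞.1 u, (Finsupp.single (cls 𝔠) 1 : ClassSet O →₀ R) := by
    have hnorm : ∀ L : Submodule ℤ (Quat a b), latticeNorm (rmul L u) = p ^ 2 * latticeNorm L :=
      latticeNorm_rmul_natUnit hp0
    refine Finset.sum_bij' (fun 𝔟 _ => 𝔟.rmul u) (fun 𝔠 _ => 𝔠.rmul u⁻¹) ?_ ?_ ?_ ?_ ?_
    · intro 𝔟 h𝔟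
      rw [mem_heckeFinset] at h𝔟
      rw [Finset.mem_filter, mem_heckeFinset]
      have h3 : rmul 𝔟.1 u ≤ rmul 𝔞.1 u := rmul_mono h𝔟.1 u
      refine ⟨⟨h3.trans fun x hx => ?_, ?_⟩, h3⟩
      · obtain ⟨w, hw, rfl⟩ := (mem_rmul_natUnit hp0).1 hx
        exact 𝔞.1.smul_mem _ hw
      · change latticeNorm (rmul 𝔟.1 u) = _
        rw [hnorm, h𝔟.2]
        push_cast
        ring
    · intro 𝔠 h𝔠
      rw [Finset.mem_filter, mem_heckeFinset] at h𝔠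
      rw [mem_heckeFinset]
      have h3 := rmul_mono h𝔠.2 u⁻¹
      rw [rmul_rmul, mul_inv_cancel, rmul_one] at h3
      refine ⟨h3, ?_⟩
      have h4 := hnorm (rmul 𝔠.1 u⁻¹)
      rw [rmul_rmul, inv_mul_cancel, rmul_one, h𝔠.1.2] at h4
      have hp0' : (p : ℚ) ^ 2 ≠ 0 := pow_ne_zero 2 (Nat.cast_ne_zero.2 hp0)
      refine mul_left_cancel₀ hp0' (h4.symm.trans ?_)
      push_cast
      ring
    · intro 𝔟 _
      rw [LeftIdeal.rmul_rmul, mul_inv_cancel, LeftIdeal.rmul_one]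
    · intro 𝔠 _
      rw [LeftIdeal.rmul_rmul, inv_mul_cancel, LeftIdeal.rmul_one]
    · intro 𝔟 _
      have : cls 𝔟 = cls (𝔟.rmul u) := Quotient.sound ⟨u, rfl⟩
      rw [this]
  rw [h1, h2, Finset.sum_filter, Finset.smul_sum, ← Finset.sum_add_distrib]
  refine Finset.sum_congr rfl fun 𝔠 h𝔠 => ?_
  rw [mem_heckeFinset] at h𝔠
  -- an ideal inside `p 𝔞` lies in all `p + 1` members of `T_p(𝔞)`, any other in exactly one
  split_ifs with hle
  · have : ((heckeFinset ha hb hO hp0 𝔞).filter fun 𝔟 => 𝔠.1 ≤ 𝔟.1) =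
        heckeFinset ha hb hO hp0 𝔞 := by
      refine Finset.filter_true_of_mem fun 𝔟 h𝔟 => hle.trans fun x hx => ?_
      rw [mem_heckeFinset] at h𝔟
      obtain ⟨w, hw, rfl⟩ := (mem_rmul_natUnit hp0).1 hx
      exact smul_mem_of_mem_heckeSet ha hb hO h𝔟 hw
    rw [this, card_heckeFinset_prime ha hb hO hN hpN, add_smul, one_smul, add_comm]
  · obtain ⟨𝔟, h𝔟, huniq⟩ := existsUnique_heckeSet_of_not_le ha hb hO hN hpN
      (dvd_mul_left p _) h𝔠 hle
    rw [Finset.card_eq_one.2 ⟨𝔟, ?_⟩, one_smul, smul_zero, add_zero]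
    ext 𝔡
    rw [Finset.mem_filter, mem_heckeFinset, Finset.mem_singleton]
    exact ⟨huniq 𝔡, fun h => h ▸ h𝔟⟩

end HeckeOperators

/-! ### The Hecke algebra -/

section HeckeAlgebra

variable {A : Type*} [Ring A] {T : ℕ → A} {N : ℕ}

theorem hecke_pow_succ_mul_pow_succ {p : ℕ} (h1 : T 1 = 1)
    (hT : ∀ k, T (p ^ (k + 1)) * T p = T (p ^ (k + 2)) + p • T (p ^ k)) (s : ℕ) :
    ∀ r, T (p ^ (r + 1)) * T (p ^ (s + 1)) =
      T (p ^ (r + s + 2)) + p • (T (p ^ r) * T (p ^ s)) := by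
  have hsucc : ∀ k, T (p ^ (k + 2)) = T (p ^ (k + 1)) * T p - p • T (p ^ k) := fun k =>
    eq_sub_of_add_eq (hT k).symm
  induction s using Nat.strong_induction_on with
  | _ s ih =>
    intro r
    match s with
    | 0 => simpa [h1] using hT r
    | 1 =>
      have h2 := hsucc 0
      have h3 := hT r
      have h4 := hT (r + 1)
      simp only [zero_add, pow_one, pow_zero, h1] at h2 h3 h4 ⊢
      rw [show 1 + 1 = 2 from rfl, h2, mul_sub, ← mul_assoc, h3, add_mul, smul_mul_assoc,
        mul_smul_comm, mul_one]
      have h5 : T (p ^ (r + 2)) * T p = T (p ^ (r + 1 + 2)) + p • T (p ^ (r + 1)) := h4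
      rw [h5]
      abel
    | s + 2 =>
      have h2 := ih (s + 1) (by omega) r
      have h3 := ih s (by omega) r
      have h4 : T (p ^ (r + (s + 1) + 2)) * T p =
          T (p ^ (r + (s + 2) + 2)) + p • T (p ^ (r + s + 2)) := hT (r + (s + 1) + 1)
      have h5 : T (p ^ (s + 1)) * T p = T (p ^ (s + 2)) + p • T (p ^ s) := hT s
      have h6 : T (p ^ (s + 2 + 1)) = T (p ^ (s + 1 + 1)) * T p - p • T (p ^ (s + 1)) :=
        hsucc (s + 1)
      rw [h6, mul_sub, ← mul_assoc, h2, add_mul, smul_mul_assoc, mul_assoc, h5, mul_smul_comm, h3,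
        h4, mul_add, mul_smul_comm, smul_add, smul_add]
      abel

theorem hecke_pow_mul_pow {p : ℕ} (h1 : T 1 = 1)
    (hT : ∀ k, T (p ^ (k + 1)) * T p = T (p ^ (k + 2)) + p • T (p ^ k)) (r s : ℕ) :
    T (p ^ r) * T (p ^ s) =
      ∑ i ∈ Finset.range (min r s + 1), p ^ i • T (p ^ (r + s - 2 * i)) := by
  induction s generalizing r with
  | zero => simp [h1]
  | succ s ih =>
    cases r with
    | zero => simp [h1]
    | succ r =>
      rw [hecke_pow_succ_mul_pow_succ h1 hT, ih,
        show min (r + 1) (s + 1) = min r s + 1 by omega, Finset.sum_range_succ' _ (min r s + 1),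
        Finset.smul_sum, add_comm]
      congr 1
      · refine Finset.sum_congr rfl fun i _ => ?_
        rw [smul_smul, ← pow_succ', show r + 1 + (s + 1) - 2 * (i + 1) = r + s - 2 * i by omega]
      · rw [pow_zero, one_smul]
        congr 2
        omega

theorem sum_divisors_mul_of_coprime {x y : ℕ} (h : x.Coprime y) {B : Type*} [AddCommMonoid B]
    (f : ℕ → B) :
    ∑ d ∈ (x * y).divisors, f d = ∑ i ∈ x.divisors, ∑ j ∈ y.divisors, f (i * j) := by
  rw [Nat.divisors_mul, Finset.mul_def, Finset.sum_image, Finset.sum_product]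
  intro u hu v hv huv
  exact h.mul_injOn_divisors hu hv huv

/-- The multiplication formula for Hecke operators, one of which has index prime to `N`. -/
theorem hecke_mul (h1 : T 1 = 1)
    (hmul : ∀ m n, m ≠ 0 → n ≠ 0 → m.Coprime n → T (m * n) = T m * T n)
    (hT : ∀ p, p.Prime → ¬ p ∣ N → ∀ k,
      T (p ^ (k + 1)) * T p = T (p ^ (k + 2)) + p • T (p ^ k)) (n : ℕ) :
    ∀ M, n ≠ 0 → M ≠ 0 → n.Coprime N →
      T M * T n = ∑ d ∈ (M.gcd n).divisors, d • T (M * n / d ^ 2) := by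
  induction n using Nat.strong_induction_on with
  | _ n ih =>
    intro M hn hM hnN
    by_cases hn1 : n = 1
    · subst hn1; simp [h1]
    -- split off the part of both indices at a prime `p ∣ n`
    obtain ⟨p, hp, hpn⟩ := Nat.exists_prime_and_dvd hn1
    have hpN : ¬ p ∣ N := fun h => Nat.not_coprime_of_dvd_of_dvd hp.one_lt hpn h hnN
    obtain ⟨s, n', hn', rfl⟩ := Nat.exists_eq_pow_mul_and_not_dvd hn p hp.ne_one
    obtain ⟨r, M', hM', rfl⟩ := Nat.exists_eq_pow_mul_and_not_dvd hM p hp.ne_one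
    have hn'0 : n' ≠ 0 := right_ne_zero_of_mul hn
    have hM'0 : M' ≠ 0 := right_ne_zero_of_mul hM
    have hp0 : ∀ k, p ^ k ≠ 0 := fun k => pow_ne_zero k hp.ne_zero
    have hcop : ∀ {x : ℕ}, ¬ p ∣ x → ∀ k, (p ^ k).Coprime x := fun h k =>
      Nat.Coprime.pow_left k ((Nat.Prime.coprime_iff_not_dvd hp).2 h)
    have hs : s ≠ 0 := by
      rintro rfl
      rw [pow_zero, one_mul] at hpn
      exact hn' hpn
    have hlt : n' < p ^ s * n' := lt_mul_of_one_lt_left (Nat.pos_of_ne_zero hn'0)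
      (Nat.one_lt_pow hs hp.one_lt)
    have ih' := ih n' hlt M' hn'0 hM'0 (Nat.Coprime.coprime_dvd_left (dvd_mul_left _ _) hnN)
    have hcomm : ∀ k, T M' * T (p ^ k) = T (p ^ k) * T M' := fun k => by
      rw [← hmul _ _ hM'0 (hp0 k) (hcop hM' k).symm, ← hmul _ _ (hp0 k) hM'0 (hcop hM' k),
        mul_comm]
    have hgcd : (p ^ r * M').gcd (p ^ s * n') = p ^ min r s * M'.gcd n' := by
      rw [Nat.Coprime.gcd_mul _ (hcop hn' s)]
      congr 1
      · rw [Nat.Coprime.gcd_mul_right_cancel _ (hcop hM' s).symm]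
        rcases le_total r s with h | h
        · rw [min_eq_left h, Nat.gcd_eq_left (pow_dvd_pow p h)]
        · rw [min_eq_right h, Nat.gcd_eq_right (pow_dvd_pow p h)]
      · rw [Nat.Coprime.gcd_mul_left_cancel _ (hcop hn' r)]
    have hcopgcd : (p ^ min r s).Coprime (M'.gcd n') :=
      Nat.Coprime.coprime_dvd_right (Nat.gcd_dvd_left _ _) (hcop hM' _)
    rw [hgcd, sum_divisors_mul_of_coprime hcopgcd, Nat.sum_divisors_prime_pow hp,
      hmul _ _ (hp0 r) hM'0 (hcop hM' r), hmul _ _ (hp0 s) hn'0 (hcop hn' s), ← hcomm r, mul_assoc,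
      ← mul_assoc (T (p ^ r)), hecke_pow_mul_pow h1 (hT p hp hpN), Finset.sum_mul,
      Finset.mul_sum]
    refine Finset.sum_congr rfl fun i hi => ?_
    have hi' : 2 * i ≤ r + s := by
      rw [Finset.mem_range] at hi
      omega
    rw [smul_mul_assoc, mul_smul_comm, ← mul_assoc, hcomm, mul_assoc, ih', Finset.mul_sum,
      Finset.smul_sum]
    refine Finset.sum_congr rfl fun d hd => ?_
    have hdd := Nat.dvd_of_mem_divisors hd
    obtain ⟨c, hc⟩ : d ^ 2 ∣ M' * n' := by
      rw [sq]
      exact mul_dvd_mul (hdd.trans (Nat.gcd_dvd_left _ _)) (hdd.trans (Nat.gcd_dvd_right _ _))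
    have hd0 : 0 < d := Nat.pos_of_mem_divisors hd
    have hc0 : c ≠ 0 := by
      rintro rfl
      exact mul_ne_zero hM'0 hn'0 (by rw [hc, mul_zero])
    have hpc : ¬ p ∣ c := fun h => by
      rcases hp.dvd_mul.1 (hc ▸ (h.mul_left (d ^ 2)) : p ∣ M' * n') with h | h
      · exact hM' h
      · exact hn' h
    have hdiv1 : M' * n' / d ^ 2 = c := by
      rw [hc, Nat.mul_div_cancel_left _ (pow_pos hd0 2)]
    have hdiv2 : p ^ r * M' * (p ^ s * n') / (p ^ i * d) ^ 2 = p ^ (r + s - 2 * i) * c := by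
      refine Nat.div_eq_of_eq_mul_left (pow_pos (mul_pos (Nat.pos_of_ne_zero (hp0 i)) hd0) 2) ?_
      have hpp : p ^ r * p ^ s = p ^ (r + s - 2 * i) * (p ^ i) ^ 2 := by
        rw [← pow_mul, ← pow_add, ← pow_add]
        congr 1
        omega
      calc p ^ r * M' * (p ^ s * n') = (p ^ r * p ^ s) * (M' * n') := by ring
        _ = _ := by rw [hpp, hc]; ring
    rw [hdiv1, hdiv2, hmul _ _ (hp0 _) hc0 (hcop hpc _), mul_smul_comm, smul_smul]

theorem hecke_commute (h1 : T 1 = 1)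
    (hmul : ∀ m n, m ≠ 0 → n ≠ 0 → m.Coprime n → T (m * n) = T m * T n)
    (hT : ∀ p, p.Prime → ¬ p ∣ N → ∀ k,
      T (p ^ (k + 1)) * T p = T (p ^ (k + 2)) + p • T (p ^ k)) {M : ℕ} (hM : M ≠ 0) (n : ℕ) :
    n ≠ 0 → n.Coprime N → Commute (T M) (T n) := by
  have hcop : ∀ m n, m ≠ 0 → n ≠ 0 → m.Coprime n → Commute (T m) (T n) := fun m n hm hn h => by
    rw [Commute, SemiconjBy, ← hmul m n hm hn h, ← hmul n m hn hm h.symm, mul_comm]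
  induction n using Nat.recOnPosPrimePosCoprime with
  | zero => exact fun h => absurd rfl h
  | one => intro _ _; rw [h1]; exact Commute.one_right _
  | prime_pow p s hp hs =>
    intro _ hpN
    have hpN' : ¬ p ∣ N := (Nat.Prime.coprime_iff_not_dvd hp).1
      (Nat.Coprime.coprime_dvd_left (dvd_pow_self p hs.ne') hpN)
    obtain ⟨r, M', hM', rfl⟩ := Nat.exists_eq_pow_mul_and_not_dvd hM p hp.ne_one
    have hM'0 : M' ≠ 0 := right_ne_zero_of_mul hM
    have hp0 : ∀ k, p ^ k ≠ 0 := fun k => pow_ne_zero k hp.ne_zero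
    have hc : ∀ k, (p ^ k).Coprime M' := fun k =>
      Nat.Coprime.pow_left k ((Nat.Prime.coprime_iff_not_dvd hp).2 hM')
    rw [hmul _ _ (hp0 r) hM'0 (hc r)]
    refine Commute.mul_left ?_ (hcop _ _ hM'0 (hp0 s) (hc s).symm)
    rw [Commute, SemiconjBy, hecke_pow_mul_pow h1 (hT p hp hpN'),
      hecke_pow_mul_pow h1 (hT p hp hpN'), min_comm, add_comm r s]
  | coprime x y hx hy hxy ihx ihy =>
    intro _ h
    have hx0 : x ≠ 0 := by omega
    have hy0 : y ≠ 0 := by omega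
    rw [hmul x y hx0 hy0 hxy]
    exact (ihx hx0 (Nat.Coprime.coprime_dvd_left (dvd_mul_right _ _) h)).mul_right
      (ihy hy0 (Nat.Coprime.coprime_dvd_left (dvd_mul_left _ _) h))

end HeckeAlgebra

section HeckeDegree

variable {R V : Type*} [CommRing R] [AddCommGroup V] [Module R V] {T : ℕ → Module.End R V} {N : ℕ}

/-- A linear form which is multiplied by `p + 1` under `T p` for the primes `p` not dividing `N`
is multiplied by the sum of the divisors of `n` under `T n`, for `n` prime to `N`. -/
theorem hecke_degree (h1 : T 1 = 1)
    (hmul : ∀ m n, m ≠ 0 → n ≠ 0 → m.Coprime n → T (m * n) = T m * T n)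
    (hT : ∀ p, p.Prime → ¬ p ∣ N → ∀ k,
      T (p ^ (k + 1)) * T p = T (p ^ (k + 2)) + p • T (p ^ k)) (f : V →ₗ[R] R)
    (hf : ∀ p, p.Prime → ¬ p ∣ N → ∀ v, f (T p v) = (p + 1) * f v) (n : ℕ) :
    n ≠ 0 → n.Coprime N → ∀ v, f (T n v) = (∑ d ∈ n.divisors, d : ℕ) * f v := by
  induction n using Nat.recOnPosPrimePosCoprime with
  | zero => exact fun h => absurd rfl h
  | one => intro _ _ v; simp [h1]
  | prime_pow p s hp hs =>
    intro hps hpN v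
    have hpN' : ¬ p ∣ N := (Nat.Prime.coprime_iff_not_dvd hp).1
      (Nat.Coprime.coprime_dvd_left (dvd_pow_self p hs.ne') hpN)
    clear hs hps hpN
    rw [Nat.sum_divisors_prime_pow hp]
    induction s using Nat.strong_induction_on generalizing v with
    | _ s ih =>
      match s with
      | 0 => simp [h1]
      | 1 => simp [hf p hp hpN', Finset.sum_range_succ, add_comm]
      | s + 2 =>
        have h2 := congrArg f (LinearMap.congr_fun (hT p hp hpN' s) v)
        rw [Module.End.mul_apply, ih (s + 1) (by omega), hf p hp hpN', LinearMap.add_apply, map_add,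
          LinearMap.smul_apply, map_nsmul, ih s (by omega), nsmul_eq_mul] at h2
        rw [← sub_eq_iff_eq_add.2 h2, Finset.sum_range_succ _ (s + 2),
          Finset.sum_range_succ _ (s + 1)]
        push_cast
        ring
  | coprime x y hx hy hxy ihx ihy =>
    intro _ h v
    have hx0 : x ≠ 0 := by omega
    have hy0 : y ≠ 0 := by omega
    rw [hmul x y hx0 hy0 hxy, Module.End.mul_apply,
      ihx hx0 (Nat.Coprime.coprime_dvd_left (dvd_mul_right _ _) h),
      ihy hy0 (Nat.Coprime.coprime_dvd_left (dvd_mul_left _ _) h), Nat.Coprime.sum_divisors_mul hxy]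
    push_cast
    ring

end HeckeDegree

/-! ### The height pairing and the Hecke operators -/

section Pairing

variable {a b : ℚ} {O : Subalgebra ℤ (Quat a b)}

/-- The height pairing as a bilinear map. -/
noncomputable def pairingL (O : Subalgebra ℤ (Quat a b)) : MR O →ₗ[ℝ] MR O →ₗ[ℝ] ℝ :=
  Finsupp.linearCombination ℝ fun c => Finsupp.linearCombination ℝ fun d => classPairing c d

/-- The degree as a linear form. -/
noncomputable def degL (O : Subalgebra ℤ (Quat a b)) : MR O →ₗ[ℝ] ℝ :=
  Finsupp.linearCombination ℝ fun _ => 1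

theorem pairing_eq (v w : MR O) : pairing v w = pairingL O v w := by
  simp only [pairing, pairingL, Finsupp.linearCombination_apply, Finsupp.sum, LinearMap.sum_apply,
    LinearMap.smul_apply, smul_eq_mul, Finset.mul_sum]
  exact Finset.sum_congr rfl fun c _ => Finset.sum_congr rfl fun d _ => by ring

theorem deg_eq (v : MR O) : deg v = degL O v := by
  simp [deg, degL, Finsupp.linearCombination_apply]

theorem pairingL_single (c d : ClassSet O) :
    pairingL O (Finsupp.single c 1) (Finsupp.single d 1) = classPairing c d := by
  simp [pairingL]

theorem toMR_eq_sum (w : M O) : toMR w = w.sum fun d k => (k : ℝ) • Finsupp.single d (1 : ℝ) := by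
  rw [toMR]
  induction w using Finsupp.induction_linear with
  | zero => simp
  | add v w hv hw =>
    rw [Finsupp.mapRange_add (fun x y => Int.cast_add x y), hv, hw, Finsupp.sum_add_index']
    · simp
    · intro d k l; push_cast; rw [add_smul]
  | single d k => simp

theorem toMR_add (v w : M O) : toMR (v + w) = toMR v + toMR w :=
  Finsupp.mapRange_add (fun x y => Int.cast_add x y) v w

/-- The inclusion of `M(O)` in `M_ℝ(O)` as an additive map. -/
noncomputable def toMRHom (O : Subalgebra ℤ (Quat a b)) : M O →+ MR O where
  toFun := toMR
  map_zero' := Finsupp.mapRange_zero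
  map_add' := toMR_add

theorem toMR_single (d : ClassSet O) : toMR (Finsupp.single d 1 : M O) = Finsupp.single d 1 := by
  simp [toMR]

theorem bilinear_eq_sum (β : MR O →ₗ[ℝ] MR O →ₗ[ℝ] ℝ) (v : MR O) (w : M O) :
    β v (toMR w) = v.sum fun c r => w.sum fun d k =>
      r * k * β (Finsupp.single c 1) (Finsupp.single d 1) := by
  have hv : v = v.sum fun c r => r • Finsupp.single c (1 : ℝ) := by
    conv_lhs => rw [← Finsupp.sum_single v]
    simp
  conv_lhs => rw [hv, toMR_eq_sum]
  simp only [Finsupp.sum, map_sum, LinearMap.sum_apply, map_smul, LinearMap.smul_apply,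
    smul_eq_mul, Finset.mul_sum]
  rw [Finset.sum_comm]
  exact Finset.sum_congr rfl fun c _ => Finset.sum_congr rfl fun d _ => by ring

theorem classPairing_comm (c d : ClassSet O) : classPairing c d = classPairing d c := by
  induction c using Quotient.inductionOn with
  | h 𝔞 =>
  induction d using Quotient.inductionOn with
  | h 𝔟 =>
  have key : ∀ (𝔞 𝔟 : LeftIdeal O) (x : (Quat a b)ˣ), 𝔞.rmul x = 𝔟 → 𝔟.rmul x⁻¹ = 𝔞 := by
    rintro 𝔞 _ x rfl
    rw [LeftIdeal.rmul_rmul, mul_inv_cancel, LeftIdeal.rmul_one]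
  exact congrArg (fun n : ℕ => (n : ℝ) / 2) (Nat.card_congr
    { toFun := fun x => ⟨x.1⁻¹, key 𝔞 𝔟 _ x.2⟩
      invFun := fun x => ⟨x.1⁻¹, key 𝔟 𝔞 _ x.2⟩
      left_inv := fun x => Subtype.ext (inv_inv _)
      right_inv := fun x => Subtype.ext (inv_inv _) })

theorem pairingL_comm (v w : MR O) : pairingL O v w = pairingL O w v := by
  have : pairingL O = (pairingL O).flip := by
    refine Finsupp.lhom_ext' fun c => LinearMap.ext_ring (Finsupp.lhom_ext' fun d =>
      LinearMap.ext_ring ?_)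
    change pairingL O (Finsupp.single c 1) (Finsupp.single d 1) =
      pairingL O (Finsupp.single d 1) (Finsupp.single c 1)
    rw [pairingL_single, pairingL_single, classPairing_comm]
  conv_lhs => rw [this]
  rfl

variable (ha : a < 0) (hb : b < 0) (hO : (Subalgebra.toSubmodule O).IsLattice ℚ)
include ha hb hO

theorem rmul_mem_heckeSet_iff {m : ℕ} (𝔞 𝔟 : LeftIdeal O) (x : (Quat a b)ˣ) :
    𝔞.rmul x ∈ heckeSet m 𝔟 ↔ (x : Quat a b) ∈ colon 𝔞.1 𝔟.1 ∧
      nrd (x : Quat a b) = m * latticeNorm (colon 𝔞.1 𝔟.1) := by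
  refine and_congr ?_ ?_
  · constructor
    · exact fun h r hr => h ⟨r, hr, rfl⟩
    · rintro h _ ⟨r, hr, rfl⟩
      exact h r hr
  · change latticeNorm (rmul 𝔞.1 x) = _ ↔ _
    have := 𝔞.2.norm_pos ha hb
    rw [latticeNorm_rmul, abs_of_pos (nrd_unit_pos ha hb x), latticeNorm_colon ha hb hO 𝔞.2 𝔟.2,
      ← mul_div_assoc, eq_div_iff this.ne']

theorem card_rmul_mem_heckeSet {m : ℕ} (hm : m ≠ 0) (𝔞 𝔟 : LeftIdeal O) :
    Nat.card {x : (Quat a b)ˣ // 𝔞.rmul x ∈ heckeSet m 𝔟} = reprNum (colon 𝔞.1 𝔟.1) m := by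
  have hpos := latticeNorm_pos ha hb (isLattice_colon ha hb 𝔞.2.1 𝔟.2.1).fg
    (ne_bot_of_isLattice (isLattice_colon ha hb 𝔞.2.1 𝔟.2.1))
  refine Nat.card_eq_of_bijective (fun x => ⟨⟨(x.1 : Quat a b),
    ((rmul_mem_heckeSet_iff ha hb hO 𝔞 𝔟 x.1).1 x.2).1⟩,
    ((rmul_mem_heckeSet_iff ha hb hO 𝔞 𝔟 x.1).1 x.2).2⟩) ⟨fun x y h => ?_, fun x => ?_⟩
  · exact Subtype.ext (Units.ext (congrArg (fun z => ((z.1 : colon 𝔞.1 𝔟.1) : Quat a b)) h))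
  · have hx0 : ((x.1 : colon 𝔞.1 𝔟.1) : Quat a b) ≠ 0 := by
      intro h
      have h1 := x.2
      rw [h, nrd_zero] at h1
      exact mul_ne_zero (Nat.cast_ne_zero.2 hm) hpos.ne' h1.symm
    obtain ⟨u, hu⟩ := exists_unit_eq ha hb hx0
    refine ⟨⟨u, (rmul_mem_heckeSet_iff ha hb hO 𝔞 𝔟 u).2 ?_⟩, ?_⟩
    · rw [hu]
      exact ⟨x.1.2, x.2⟩
    · exact Subtype.ext (Subtype.ext hu)

theorem finite_rmul_mem_heckeSet {m : ℕ} (𝔞 𝔟 : LeftIdeal O) :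
    Finite {x : (Quat a b)ˣ // 𝔞.rmul x ∈ heckeSet m 𝔟} := by
  have := finite_nrd_eq ha hb (isLattice_colon ha hb 𝔞.2.1 𝔟.2.1) m
  refine Finite.of_injective (fun x => (⟨⟨(x.1 : Quat a b),
    ((rmul_mem_heckeSet_iff ha hb hO 𝔞 𝔟 x.1).1 x.2).1⟩,
    ((rmul_mem_heckeSet_iff ha hb hO 𝔞 𝔟 x.1).1 x.2).2⟩ :
      {x : colon 𝔞.1 𝔟.1 // nrd (x : Quat a b) = m * latticeNorm (colon 𝔞.1 𝔟.1)}))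
    fun x y h => ?_
  exact Subtype.ext (Units.ext (congrArg (fun z => ((z.1 : colon 𝔞.1 𝔟.1) : Quat a b)) h))

/-- `⟨[𝔞], t_m [𝔟]⟩` is half the number of vectors of norm `m` in `𝔞⁻¹ 𝔟`: the solutions `x` of
`𝔞 x ∈ T_m(𝔟)`. -/
theorem pairingL_hecke_single {m : ℕ} (hm : m ≠ 0) (𝔞 𝔟 : LeftIdeal O) :
    pairingL O (Finsupp.single (cls 𝔞) 1) (hecke ℝ m (Finsupp.single (cls 𝔟) 1)) =
      reprNum (colon 𝔞.1 𝔟.1) m / 2 := by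
  classical
  rw [hecke_single ha hb hO ℝ hm, map_sum, ← card_rmul_mem_heckeSet ha hb hO hm]
  have := finite_rmul_mem_heckeSet ha hb hO (m := m) 𝔞 𝔟
  have : Fintype {x : (Quat a b)ˣ // 𝔞.rmul x ∈ heckeSet m 𝔟} := Fintype.ofFinite _
  rw [Nat.card_eq_fintype_card, ← Finset.card_univ,
    Finset.card_eq_sum_card_fiberwise (f := fun x => 𝔞.rmul x.1)
      (t := heckeFinset ha hb hO hm 𝔟) fun x _ => (mem_heckeFinset ha hb hO hm).2 x.2,
    Nat.cast_sum, Finset.sum_div]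
  refine Finset.sum_congr rfl fun 𝔠 h𝔠 => ?_
  rw [mem_heckeFinset] at h𝔠
  rw [pairingL_single]
  refine congrArg (fun n : ℕ => (n : ℝ) / 2) ?_
  rw [← Fintype.card_subtype, ← Nat.card_eq_fintype_card]
  exact Nat.card_congr
    { toFun := fun x => ⟨⟨x.1, by rw [x.2]; exact h𝔠⟩, x.2⟩
      invFun := fun x => ⟨x.1.1, x.2⟩
      left_inv := fun x => rfl
      right_inv := fun x => rfl }

theorem reprNum_colon_comm {m : ℕ} (𝔞 𝔟 : LeftIdeal O) :
    reprNum (colon 𝔞.1 𝔟.1) m = reprNum (colon 𝔟.1 𝔞.1) m := by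
  have key : ∀ 𝔞 𝔟 : LeftIdeal O, ∀ x : Quat a b, x ∈ colon 𝔞.1 𝔟.1 →
      nrd x = m * latticeNorm (colon 𝔞.1 𝔟.1) →
      nrd ((latticeNorm (colon 𝔞.1 𝔟.1))⁻¹ • star x) = m * latticeNorm (colon 𝔟.1 𝔞.1) := by
    intro 𝔞 𝔟 x hx h
    have h1 := 𝔞.2.norm_pos ha hb
    have h2 := 𝔟.2.norm_pos ha hb
    rw [nrd_smul, nrd_star, h, latticeNorm_colon ha hb hO 𝔞.2 𝔟.2,
      latticeNorm_colon ha hb hO 𝔟.2 𝔞.2]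
    field_simp
  have inv : ∀ 𝔞 𝔟 : LeftIdeal O, ∀ x : Quat a b,
      (latticeNorm (colon 𝔟.1 𝔞.1))⁻¹ • star ((latticeNorm (colon 𝔞.1 𝔟.1))⁻¹ • star x) = x := by
    intro 𝔞 𝔟 x
    have h1 := 𝔞.2.norm_pos ha hb
    have h2 := 𝔟.2.norm_pos ha hb
    rw [star_smul, star_star, star_trivial, smul_smul, latticeNorm_colon ha hb hO 𝔞.2 𝔟.2,
      latticeNorm_colon ha hb hO 𝔟.2 𝔞.2]
    have : (latticeNorm 𝔞.1 / latticeNorm 𝔟.1)⁻¹ * (latticeNorm 𝔟.1 / latticeNorm 𝔞.1)⁻¹ = 1 := by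
      field_simp
    rw [this, one_smul]
  exact Nat.card_congr
    { toFun := fun x => ⟨⟨_, smul_star_mem_colon ha hb hO 𝔞.2 𝔟.2 x.1.2⟩, key 𝔞 𝔟 _ x.1.2 x.2⟩
      invFun := fun x => ⟨⟨_, smul_star_mem_colon ha hb hO 𝔟.2 𝔞.2 x.1.2⟩, key 𝔟 𝔞 _ x.1.2 x.2⟩
      left_inv := fun x => Subtype.ext (Subtype.ext (inv 𝔞 𝔟 _))
      right_inv := fun x => Subtype.ext (Subtype.ext (inv 𝔟 𝔞 _)) }

/-- The Hecke operators are self-adjoint for the height pairing. -/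
theorem pairingL_hecke {n : ℕ} (hn : n ≠ 0) (v w : MR O) :
    pairingL O (hecke ℝ n v) w = pairingL O v (hecke ℝ n w) := by
  have : pairingL O ∘ₗ hecke ℝ n = (pairingL O).compl₂ (hecke ℝ n) := by
    refine hecke_ext ℝ fun 𝔞 => hecke_ext ℝ fun 𝔟 => ?_
    rw [LinearMap.comp_apply, LinearMap.compl₂_apply, pairingL_comm,
      pairingL_hecke_single ha hb hO hn, pairingL_hecke_single ha hb hO hn,
      reprNum_colon_comm ha hb hO]
  exact LinearMap.congr_fun (LinearMap.congr_fun this v) w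

theorem toMR_hecke {n : ℕ} (hn : n ≠ 0) (w : M O) :
    toMR (hecke ℤ n w) = hecke ℝ n (toMR w) := by
  have : (toMRHom O).comp (hecke ℤ n).toAddMonoidHom =
      ((hecke ℝ n : MR O →ₗ[ℝ] MR O).toAddMonoidHom).comp (toMRHom O) := by
    refine Finsupp.addHom_ext' fun c => AddMonoidHom.ext_int ?_
    induction c using Quotient.inductionOn with
    | h 𝔞 =>
    change toMRHom O (hecke ℤ n (Finsupp.single (cls 𝔞) 1)) =
      hecke ℝ n (toMR (Finsupp.single (cls 𝔞) 1))
    rw [toMR_single, hecke_single ha hb hO ℤ hn, hecke_single ha hb hO ℝ hn, map_sum]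
    exact Finset.sum_congr rfl fun 𝔟 _ => toMR_single _
  exact DFunLike.congr_fun this w

/-- `⟨[𝔞], [𝔟]⟩` is an integer since `x` and `-x` occur together. -/
theorem exists_int_classPairing (c d : ClassSet O) : ∃ k : ℤ, classPairing c d = k := by
  induction c using Quotient.inductionOn with
  | h 𝔞 =>
  induction d using Quotient.inductionOn with
  | h 𝔟 =>
  have hfin : Finite {x : (Quat a b)ˣ // 𝔞.rmul x = 𝔟} := by
    have := finite_rmul_mem_heckeSet ha hb hO (m := 1) 𝔞 𝔟
    refine Finite.of_equiv _ (Equiv.subtypeEquivRight (p := fun x => 𝔞.rmul x ∈ heckeSet 1 𝔟)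
      fun x => ?_)
    rw [heckeSet_one ha hb hO, Set.mem_singleton_iff]
  have : Fintype {x : (Quat a b)ˣ // 𝔞.rmul x = 𝔟} := Fintype.ofFinite _
  have hneg : ∀ x : (Quat a b)ˣ, 𝔞.rmul (-x) = 𝔞.rmul x := by
    intro x
    refine Subtype.ext (Submodule.ext fun z => ?_)
    change z ∈ rmul 𝔞.1 (-x) ↔ z ∈ rmul 𝔞.1 x
    rw [mem_rmul, mem_rmul, inv_neg, Units.val_neg, mul_neg, Submodule.neg_mem_iff]
  have h2 : (Fintype.card {x : (Quat a b)ˣ // 𝔞.rmul x = 𝔟} : ZMod 2) = 0 := by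
    rw [← Finset.card_univ, Finset.card_eq_sum_ones, Nat.cast_sum]
    refine Finset.sum_involution (fun x _ => ⟨-x.1, (hneg x.1).trans x.2⟩) ?_ ?_ ?_ ?_
    · intro x _; decide
    · intro x _ _ h
      have h1 : -((x.1 : (Quat a b)ˣ) : Quat a b) = x.1 := by
        rw [← Units.val_neg]
        exact congrArg (fun y => ((y.1 : (Quat a b)ˣ) : Quat a b)) h
      have h3 : (2 : ℚ) • ((x.1 : (Quat a b)ˣ) : Quat a b) = 0 := by
        rw [two_smul]
        nth_rewrite 1 [← h1]
        exact neg_add_cancel _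
      exact x.1.ne_zero ((smul_eq_zero.1 h3).resolve_left two_ne_zero)
    · intro x _; exact Finset.mem_univ _
    · intro x _; exact Subtype.ext (neg_neg _)
  obtain ⟨k, hk⟩ := (ZMod.natCast_eq_zero_iff _ 2).1 h2
  refine ⟨k, ?_⟩
  change ((Nat.card {x : (Quat a b)ˣ // 𝔞.rmul x = 𝔟} : ℕ) : ℝ) / 2 = _
  rw [Nat.card_eq_fintype_card, hk]
  push_cast
  ring

theorem toMR_mem_Mdual (v : M O) : toMR v ∈ Mdual O := by
  intro w
  rw [pairing_eq, toMR_eq_sum v, toMR_eq_sum w]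
  simp only [Finsupp.sum, map_sum, LinearMap.sum_apply, map_smul, LinearMap.smul_apply,
    smul_eq_mul, pairingL_single]
  choose k hk using exists_int_classPairing ha hb hO
  simp only [hk]
  exact ⟨∑ d ∈ w.support, w d * ∑ c ∈ v.support, v c * k c d, by push_cast; rfl⟩

/-- The height pairing is positive definite: distinct classes are orthogonal. -/
theorem pairingL_self_pos {v : M O} (hv : v ≠ 0) : 0 < pairingL O (toMR v) (toMR v) := by
  -- distinct classes are orthogonal, and each class has positive square
  have hne : ∀ c d : ClassSet O, c ≠ d → classPairing c d = 0 := by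
    intro c d
    induction c using Quotient.inductionOn with
    | h 𝔞 =>
    induction d using Quotient.inductionOn with
    | h 𝔟 =>
    intro h
    have : IsEmpty {x : (Quat a b)ˣ // 𝔞.rmul x = 𝔟} := ⟨fun x => h (Quotient.sound ⟨x.1, x.2⟩)⟩
    change ((Nat.card {x : (Quat a b)ˣ // 𝔞.rmul x = 𝔟} : ℕ) : ℝ) / 2 = 0
    simp
  have hpos : ∀ c : ClassSet O, 0 < classPairing c c := by
    intro c
    induction c using Quotient.inductionOn with
    | h 𝔞 =>
    have hfin : Finite {x : (Quat a b)ˣ // 𝔞.rmul x = 𝔞} := by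
      have := finite_rmul_mem_heckeSet ha hb hO (m := 1) 𝔞 𝔞
      refine Finite.of_equiv _ (Equiv.subtypeEquivRight (p := fun x => 𝔞.rmul x ∈ heckeSet 1 𝔞)
        fun x => ?_)
      rw [heckeSet_one ha hb hO, Set.mem_singleton_iff]
    have : Nonempty {x : (Quat a b)ˣ // 𝔞.rmul x = 𝔞} := ⟨⟨1, 𝔞.rmul_one⟩⟩
    change 0 < ((Nat.card {x : (Quat a b)ˣ // 𝔞.rmul x = 𝔞} : ℕ) : ℝ) / 2
    have := Nat.card_pos (α := {x : (Quat a b)ˣ // 𝔞.rmul x = 𝔞})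
    positivity
  rw [bilinear_eq_sum]
  have hsupp : (toMR v).support = v.support :=
    Finsupp.support_mapRange_of_injective Int.cast_zero v Int.cast_injective
  have hval : ∀ c, toMR v c = v c := fun c => Finsupp.mapRange_apply
  rw [Finsupp.sum, hsupp]
  refine Finset.sum_pos (fun c hc => ?_) (Finsupp.support_nonempty_iff.2 hv)
  rw [Finsupp.sum, Finset.sum_eq_single c, hval, pairingL_single]
  · have : (v c : ℝ) ≠ 0 := by exact_mod_cast Finsupp.mem_support_iff.1 hc
    exact mul_pos (mul_self_pos.2 this) (hpos c)
  · intro d _ hdc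
    rw [pairingL_single, hne c d hdc.symm, mul_zero]
  · exact fun h => absurd hc h

end Pairing

/-! ### Hecke operators on `q`-series -/

section HeckeSeries

open UpperHalfPlane

/-- Averaging over the translates `(e τ + j) / d` keeps the exponents divisible by `d`. -/
theorem sum_exp_translates {d : ℕ} (hd : d ≠ 0) (e m : ℕ) (τ : ℍ) :
    ∑ j ∈ Finset.range d,
      Complex.exp (2 * Real.pi * Complex.I * m * (((e : ℂ) * (τ : ℂ) + j) / d)) =
      if d ∣ m then d * qPow ((e * (m / d) : ℕ) : ℚ) τ else 0 := by
  have hd' : (d : ℂ) ≠ 0 := Nat.cast_ne_zero.2 hd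
  set ζ := Complex.exp (2 * Real.pi * Complex.I / d) with hζ
  have hprim : IsPrimitiveRoot ζ d := Complex.isPrimitiveRoot_exp d hd
  -- the dependence on `j` is the power `(ζ ^ m) ^ j` of a root of unity
  have hterm : ∀ j ∈ Finset.range d,
      Complex.exp (2 * Real.pi * Complex.I * m * (((e : ℂ) * (τ : ℂ) + j) / d)) =
      Complex.exp (2 * Real.pi * Complex.I * m * ((e : ℂ) * (τ : ℂ) / d)) * (ζ ^ m) ^ j := by
    intro j _
    rw [hζ, ← Complex.exp_nat_mul, ← Complex.exp_nat_mul, ← Complex.exp_add]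
    congr 1
    field_simp
  rw [Finset.sum_congr rfl hterm, ← Finset.mul_sum]
  split_ifs with h
  · obtain ⟨k, rfl⟩ := h
    have h1 : ζ ^ (d * k) = 1 := by rw [pow_mul, hprim.pow_eq_one, one_pow]
    simp only [h1, one_pow, Finset.sum_const, Finset.card_range, nsmul_eq_mul, mul_one]
    rw [mul_comm, Nat.mul_div_cancel_left k (Nat.pos_of_ne_zero hd), qPow]
    congr 2
    push_cast
    field_simp
  · have h1 : ζ ^ m ≠ 1 := fun h' => h ((hprim.pow_eq_one_iff_dvd m).1 h')
    have h2 : (ζ ^ m) ^ d = 1 := by rw [← pow_mul, mul_comm, pow_mul, hprim.pow_eq_one, one_pow]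
    rw [geom_sum_eq h1, h2, sub_self, zero_div, mul_zero]

/-- The summand of `T(n)` with `a d = n` (here `e = a`), as a `q`-series. -/
theorem hasSum_translates {f : ℍ → ℂ} {c : ℕ → ℂ}
    (hf : ∀ τ, HasSum (fun m : ℕ => c m * qPow m τ) (f τ)) {d e : ℕ} (hd : d ≠ 0) (he : e ≠ 0)
    (τ : ℍ) :
    HasSum (fun m : ℕ => (if e ∣ m then (e : ℂ) * c (m / e * d) else 0) * qPow m τ)
      ((e : ℂ) / d * ∑ j ∈ Finset.range d,
        f (ofComplex (((e : ℂ) * (τ : ℂ) + j) / d))) := by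
  have hd' : (d : ℂ) ≠ 0 := Nat.cast_ne_zero.2 hd
  have him : ∀ j : ℕ, 0 < ((((e : ℂ) * (τ : ℂ) + j) / d)).im := by
    intro j
    have h1 : (((e : ℂ) * (τ : ℂ) + j) / d).im = e * τ.im / d := by
      rw [Complex.div_natCast_im]
      simp
    rw [h1]
    have := τ.im_pos
    positivity
  have h1 := hasSum_sum (s := Finset.range d) fun j _ =>
    hf (ofComplex (((e : ℂ) * (τ : ℂ) + j) / d))
  have h2 : ∀ m : ℕ, ∑ j ∈ Finset.range d,
      c m * qPow m (ofComplex (((e : ℂ) * (τ : ℂ) + j) / d)) =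
      if d ∣ m then c m * (d * qPow ((e * (m / d) : ℕ) : ℚ) τ) else 0 := by
    intro m
    rw [← Finset.mul_sum, ← mul_ite_zero, ← sum_exp_translates hd]
    congr 1
    refine Finset.sum_congr rfl fun j _ => ?_
    rw [qPow, ofComplex_apply_of_im_pos (him j), Rat.cast_natCast]
  simp only [h2] at h1
  have hinj : ∀ k : ℕ, k ≠ 0 → Function.Injective fun m : ℕ => k * m := fun k hk x y h =>
    Nat.eq_of_mul_eq_mul_left (Nat.pos_of_ne_zero hk) h
  -- substitute `m = d m'`, and on the other side `m = e m'`
  rw [← (hinj d hd).hasSum_iff fun m hm => if_neg fun ⟨k, hk⟩ => hm ⟨k, hk.symm⟩] at h1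
  have h3 := h1.mul_left ((e : ℂ) / d)
  rw [← (hinj e he).hasSum_iff]
  · refine HasSum.congr_fun h3 fun m => ?_
    simp only [Function.comp_apply, dvd_mul_right, if_true,
      Nat.mul_div_cancel_left m (Nat.pos_of_ne_zero hd),
      Nat.mul_div_cancel_left m (Nat.pos_of_ne_zero he)]
    rw [mul_comm m d, Nat.cast_mul]
    field_simp
  · intro m hm
    rw [if_neg fun ⟨k, hk⟩ => hm ⟨k, hk.symm⟩, zero_mul]

/-- The action of `T(n)` on the coefficients of a `q`-series, for `n` prime to the level. -/
theorem hasSum_heckeT {N n : ℕ} (hn : n ≠ 0) (hnN : n.Coprime N) {f : ℍ → ℂ} {c : ℕ → ℂ}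
    (hf : ∀ τ, HasSum (fun m : ℕ => c m * qPow m τ) (f τ)) (τ : ℍ) :
    HasSum (fun m : ℕ => (∑ e ∈ (m.gcd n).divisors, (e : ℂ) * c (m * n / e ^ 2)) * qPow m τ)
      (heckeT N n f τ) := by
  have h1 := hasSum_sum (s := n.divisors) fun d hd =>
    hasSum_translates hf (Nat.pos_of_mem_divisors hd).ne'
      (Nat.div_pos (Nat.divisor_le hd) (Nat.pos_of_mem_divisors hd)).ne' τ (e := n / d)
  have h2 : heckeT N n f τ = ∑ d ∈ n.divisors, ((n / d : ℕ) : ℂ) / d * ∑ j ∈ Finset.range d,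
      f (ofComplex ((((n / d : ℕ) : ℂ) * (τ : ℂ) + j) / d)) := by
    rw [heckeT, Finset.filter_true_of_mem]
    · refine Finset.sum_congr rfl fun d hd => ?_
      have hd0 : (d : ℂ) ≠ 0 := Nat.cast_ne_zero.2 (Nat.pos_of_mem_divisors hd).ne'
      rw [Nat.cast_div (Nat.dvd_of_mem_divisors hd) hd0]
      congr 1
      field_simp
    · exact fun d hd => hnN.coprime_dvd_left (Nat.div_dvd_of_dvd (Nat.dvd_of_mem_divisors hd))
  rw [h2]
  convert h1 using 2 with m
  rw [← Finset.sum_mul]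
  congr 1
  have h3 : ∀ d ∈ n.divisors,
      (if n / d ∣ m then ((n / d : ℕ) : ℂ) * c (m / (n / d) * d) else 0) =
      (fun e => if e ∣ m then (e : ℂ) * c (m / e * (n / e)) else 0) (n / d) := by
    intro d hd
    simp only [Nat.div_div_self (Nat.dvd_of_mem_divisors hd) hn]
  rw [Finset.sum_congr rfl h3, Nat.sum_div_divisors n
    fun e => if e ∣ m then (e : ℂ) * c (m / e * (n / e)) else 0, ← Finset.sum_filter]
  have h4 : (m.gcd n).divisors = {e ∈ n.divisors | e ∣ m} := by
    ext e
    simp [Nat.dvd_gcd_iff, hn, and_comm]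
  rw [h4]
  refine Finset.sum_congr rfl fun e he => ?_
  rw [Finset.mem_filter, Nat.mem_divisors] at he
  rw [Nat.div_mul_div_comm he.2 he.1.1, sq]

/-- A `q`-series with a nonzero coefficient does not vanish identically. -/
theorem ne_zero_of_hasSum {f : ℍ → ℂ} {c : ℕ → ℂ}
    (hf : ∀ τ, HasSum (fun m : ℕ => c m * qPow m τ) (f τ)) {m : ℕ} (hm : c m ≠ 0) : f ≠ 0 := by
  intro h
  have hq : ∀ (c : ℂ) (m : ℕ) (τ : ℍ),
      c • Function.Periodic.qParam 1 τ ^ m = c * qPow m τ := by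
    intro c m τ
    rw [smul_eq_mul, Function.Periodic.qParam, ← Complex.exp_nat_mul, qPow]
    congr 2
    push_cast
    ring
  have h0 : cuspFunction 1 f = 0 := by
    rw [h]
    simpa [cuspFunction, Function.Periodic.cuspFunction]
      using! (tendsto_const_nhds.mono_left nhdsWithin_le_nhds).limUnder_eq
  have han : AnalyticAt ℂ (cuspFunction 1 f) 0 := by
    rw [h0]
    exact analyticAt_const
  have hf' : ∀ τ : ℍ, HasSum (fun k : ℕ => c k • Function.Periodic.qParam 1 τ ^ k) (f τ) := by
    intro τ
    simp only [hq]
    exact hf τ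
  have h1 := (hasFPowerSeriesOnBall_cuspFunction Real.zero_lt_one han hf').hasFPowerSeriesAt
  rw [h0] at h1
  have h2 := congr_arg (FormalMultilinearSeries.coeff · m) h1.eq_zero
  rw [FormalMultilinearSeries.coeff_ofScalars] at h2
  exact hm h2

end HeckeSeries

/-! ### The series `φ(v, w)` -/

section Phi

variable {a b : ℚ} {O : Subalgebra ℤ (Quat a b)}

/-- The `m`-th coefficient of `φ` as a bilinear form on `M_ℝ(O)`. -/
noncomputable def phiForm (O : Subalgebra ℤ (Quat a b)) (m : ℕ) : MR O →ₗ[ℝ] MR O →ₗ[ℝ] ℝ :=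
  if m = 0 then (degL O).smulRight ((1 / 2 : ℝ) • degL O) else (pairingL O).compl₂ (hecke ℝ m)

theorem phiForm_zero (v w : MR O) : phiForm O 0 v w = degL O v * degL O w / 2 := by
  simp only [phiForm, if_true, LinearMap.smulRight_apply, LinearMap.smul_apply, smul_eq_mul]
  ring

theorem phiForm_of_ne_zero {m : ℕ} (hm : m ≠ 0) (v w : MR O) :
    phiForm O m v w = pairingL O v (hecke ℝ m w) := by
  rw [phiForm, if_neg hm, LinearMap.compl₂_apply]

variable (ha : a < 0) (hb : b < 0) (hO : (Subalgebra.toSubmodule O).IsLattice ℚ)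
include ha hb hO

theorem phiCoeff_eq (v : MR O) (w : M O) (m : ℕ) : phiCoeff v w m = phiForm O m v (toMR w) := by
  rw [phiCoeff]
  split_ifs with hm
  · rw [hm, phiForm_zero, deg_eq, deg_eq]
  · rw [phiForm_of_ne_zero hm, pairing_eq, toMR_hecke ha hb hO hm]

theorem phiForm_single (m : ℕ) (𝔞 𝔟 : LeftIdeal O) :
    phiForm O m (Finsupp.single (cls 𝔞) 1) (Finsupp.single (cls 𝔟) 1) =
      reprNum (colon 𝔞.1 𝔟.1) m / 2 := by
  rcases eq_or_ne m 0 with rfl | hm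
  · rw [phiForm_zero, reprNum_zero ha hb]
    simp [degL]
  · rw [phiForm_of_ne_zero hm, pairingL_hecke_single ha hb hO hm]

/-- Both sides are bilinear, so the expansion of `φ(v, w)` in theta series follows from the case of
two ideal classes. -/
theorem hasSum_phi_theta {rep : ClassSet O → LeftIdeal O} (hrep : ∀ c, cls (rep c) = c) (v : MR O)
    (w : M O) (τ : UpperHalfPlane) :
    HasSum (fun m : ℕ => (phiCoeff v w m : ℂ) * qPow m τ)
      (v.sum fun c r => w.sum fun d k =>
        (r : ℂ) * (k : ℂ) * (1 / 2 * theta (colon (rep c).1 (rep d).1) τ)) := by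
  have h1 : ∀ c d, HasSum (fun m : ℕ => ((v c : ℝ) : ℂ) * ((w d : ℤ) : ℂ) *
      ((1 / 2) * ((reprNum (colon (rep c).1 (rep d).1) m : ℂ) * qPow m τ)))
      ((v c : ℂ) * (w d : ℂ) * (1 / 2 * theta (colon (rep c).1 (rep d).1) τ)) := fun c d =>
    ((hasSum_theta ha hb (isLattice_colon ha hb (rep c).2.1 (rep d).2.1) τ).mul_left _).mul_left _
  refine HasSum.congr_fun
    (hasSum_sum fun c (_ : c ∈ v.support) => hasSum_sum fun d (_ : d ∈ w.support) => h1 c d)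
    fun m => ?_
  rw [phiCoeff_eq ha hb hO, bilinear_eq_sum]
  simp only [Finsupp.sum]
  push_cast
  simp only [Finset.sum_mul]
  refine Finset.sum_congr rfl fun c _ => Finset.sum_congr rfl fun d _ => ?_
  have h2 := phiForm_single ha hb hO m (rep c) (rep d)
  rw [hrep, hrep] at h2
  rw [h2]
  push_cast
  ring

theorem hasSum_phi (v : MR O) (w : M O) (τ : UpperHalfPlane) :
    HasSum (fun m : ℕ => (phiCoeff v w m : ℂ) * qPow m τ) (phi v w τ) :=
  (hasSum_phi_theta ha hb hO (rep := Quotient.out) Quotient.out_eq v w τ).summable.hasSum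

theorem phi_eq_sum_theta {rep : ClassSet O → LeftIdeal O} (hrep : ∀ c, cls (rep c) = c) (v : MR O)
    (w : M O) (τ : UpperHalfPlane) :
    phi v w τ = v.sum fun c r => w.sum fun d k =>
      (r : ℂ) * (k : ℂ) * (1 / 2 * theta (colon (rep c).1 (rep d).1) τ) :=
  (hasSum_phi_theta ha hb hO hrep v w τ).tsum_eq

theorem phi_single (𝔞 𝔟 : LeftIdeal O) (τ : UpperHalfPlane) :
    phi (Finsupp.single (cls 𝔞) 1) (Finsupp.single (cls 𝔟) 1) τ =
      1 / 2 * theta (colon 𝔞.1 𝔟.1) τ := by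
  refine HasSum.tsum_eq (HasSum.congr_fun
    ((hasSum_theta ha hb (isLattice_colon ha hb 𝔞.2.1 𝔟.2.1) τ).mul_left (1 / 2)) fun m => ?_)
  rw [phiCoeff_eq ha hb hO, toMR_single, phiForm_single ha hb hO]
  push_cast
  ring

theorem exists_modularForm_phi {N : ℕ} (hN0 : 0 < N)
    (hN : ∀ x ∈ dualLattice (Subalgebra.toSubmodule O), ∃ k : ℤ, N * nrd x = k) (v : MR O)
    (w : M O) : ∃ f : ModularForm (Gamma0GL N) 2, (f : UpperHalfPlane → ℂ) = phi v w := by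
  choose f hf using fun 𝔞 𝔟 : LeftIdeal O => exists_modularForm_theta ha hb hO hN0 hN 𝔞.2 𝔟.2
  refine ⟨∑ c ∈ v.support, ∑ d ∈ w.support,
    ((v c : ℂ) * (w d : ℂ) * (1 / 2)) • f (Quotient.out c) (Quotient.out d), ?_⟩
  have hsum : ∀ {ι : Type} (s : Finset ι) (g : ι → ModularForm (Gamma0GL N) 2),
      ((∑ i ∈ s, g i : ModularForm (Gamma0GL N) 2) : UpperHalfPlane → ℂ) =
        ∑ i ∈ s, (g i : UpperHalfPlane → ℂ) := fun s g =>
    map_sum (AddMonoidHom.mk' (fun f : ModularForm (Gamma0GL N) 2 => (f : UpperHalfPlane → ℂ))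
      FunLike.coe_add) g s
  ext τ
  rw [phi_eq_sum_theta ha hb hO (rep := Quotient.out) Quotient.out_eq]
  simp only [hsum, Finset.sum_apply, FunLike.coe_smul, Pi.smul_apply, hf, smul_eq_mul,
    Finsupp.sum]
  exact Finset.sum_congr rfl fun c _ => Finset.sum_congr rfl fun d _ => by ring

end Phi

/-! ### Compatibility with the Hecke operators -/

section PhiHecke

variable {a b : ℚ} {O : Subalgebra ℤ (Quat a b)} {N : ℕ} (ha : a < 0) (hb : b < 0)
  (hO : (Subalgebra.toSubmodule O).IsLattice ℚ)
include ha hb hO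

theorem hecke_mem_Mdual {n : ℕ} (hn : n ≠ 0) {v : MR O} (hv : v ∈ Mdual O) :
    hecke ℝ n v ∈ Mdual O := by
  intro w
  obtain ⟨k, hk⟩ := hv (hecke ℤ n w)
  refine ⟨k, ?_⟩
  rw [← hk, pairing_eq, pairing_eq, pairingL_hecke ha hb hO hn, toMR_hecke ha hb hO hn]

/-- The first coefficient of `φ(v, v)` is `⟨v, v⟩ > 0`. -/
theorem phi_ne_zero {v : M O} (hv : v ≠ 0) : phi (toMR v) v ≠ 0 := by
  refine ne_zero_of_hasSum (c := fun m => (phiCoeff (toMR v) v m : ℂ))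
    (hasSum_phi ha hb hO (toMR v) v) (m := 1) (Complex.ofReal_ne_zero.2 ?_)
  rw [phiCoeff_eq ha hb hO, phiForm_of_ne_zero one_ne_zero, hecke_one ha hb hO]
  exact (pairingL_self_pos ha hb hO hv).ne'

variable (hN : ∀ x ∈ dualLattice (Subalgebra.toSubmodule O), ∃ k : ℤ, N * nrd x = k)
include hN

theorem hecke_mul_hecke {n m : ℕ} (hn : n ≠ 0) (hm : m ≠ 0) (hnN : n.Coprime N) :
    (hecke ℝ m * hecke ℝ n : Module.End ℝ (MR O)) =
      ∑ d ∈ (m.gcd n).divisors, d • hecke ℝ (m * n / d ^ 2) :=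
  hecke_mul (T := fun m => (hecke ℝ m : Module.End ℝ (MR O))) (hecke_one ha hb hO ℝ)
    (fun _ _ h1 h2 h3 => hecke_mul_of_coprime ha hb hO ℝ h1 h2 h3)
    (fun p hp hpN k => by
      have : Fact p.Prime := ⟨hp⟩
      exact hecke_prime_pow ha hb hO ℝ hN hpN k) n m hn hm hnN

theorem hecke_commute_hecke {n m : ℕ} (hn : n ≠ 0) (hm : m ≠ 0) (hnN : n.Coprime N) :
    Commute (hecke ℝ m : Module.End ℝ (MR O)) (hecke ℝ n) :=
  hecke_commute (T := fun m => (hecke ℝ m : Module.End ℝ (MR O))) (hecke_one ha hb hO ℝ)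
    (fun _ _ h1 h2 h3 => hecke_mul_of_coprime ha hb hO ℝ h1 h2 h3)
    (fun p hp hpN k => by
      have : Fact p.Prime := ⟨hp⟩
      exact hecke_prime_pow ha hb hO ℝ hN hpN k) hm n hn hnN

/-- For `n` prime to the level, every ideal contains `σ₁(n)` ideals of relative norm `n`. -/
theorem degL_hecke {n : ℕ} (hn : n ≠ 0) (hnN : n.Coprime N) (v : MR O) :
    degL O (hecke ℝ n v) = (∑ d ∈ n.divisors, d : ℕ) * degL O v := by
  refine hecke_degree (T := fun m => (hecke ℝ m : Module.End ℝ (MR O))) (hecke_one ha hb hO ℝ)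
    (fun _ _ h1 h2 h3 => hecke_mul_of_coprime ha hb hO ℝ h1 h2 h3)
    (fun p hp hpN k => by
      have : Fact p.Prime := ⟨hp⟩
      exact hecke_prime_pow ha hb hO ℝ hN hpN k) (degL O) (fun p hp hpN v => ?_) n hn hnN v
  have : Fact p.Prime := ⟨hp⟩
  have h : degL O ∘ₗ hecke ℝ p = ((p : ℝ) + 1) • degL O := by
    refine hecke_ext ℝ fun 𝔞 => ?_
    rw [LinearMap.comp_apply, hecke_single ha hb hO ℝ hp.ne_zero, map_sum]
    simp [degL, card_heckeFinset_prime ha hb hO hN hpN]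
  exact LinearMap.congr_fun h v

theorem phi_hecke {n : ℕ} (hn : n ≠ 0) (hnN : n.Coprime N) (v : MR O) (w : M O) :
    phi (hecke ℝ n v) w = phi v (hecke ℤ n w) := by
  ext τ
  refine tsum_congr fun m => ?_
  congr 2
  rw [phiCoeff_eq ha hb hO, phiCoeff_eq ha hb hO, toMR_hecke ha hb hO hn]
  rcases eq_or_ne m 0 with rfl | hm
  · rw [phiForm_zero, phiForm_zero, degL_hecke ha hb hO hN hn hnN,
      degL_hecke ha hb hO hN hn hnN]
    ring
  · rw [phiForm_of_ne_zero hm, phiForm_of_ne_zero hm, pairingL_hecke ha hb hO hn]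
    congr 1
    exact LinearMap.congr_fun (hecke_commute_hecke ha hb hO hN hn hm hnN).eq.symm (toMR w)

/-- The action of `T(n)` on `q`-expansions matches the multiplication rule of the `t_m`. -/
theorem heckeT_phi {n : ℕ} (hn : n ≠ 0) (hnN : n.Coprime N) (v : MR O) (w : M O) :
    heckeT N n (phi v w) = phi v (hecke ℤ n w) := by
  ext τ
  refine ((HasSum.congr_fun (hasSum_heckeT hn hnN (c := fun m => (phiCoeff v w m : ℂ))
    (hasSum_phi ha hb hO v w) τ) fun m => ?_).tsum_eq).symm
  congr 1
  rw [phiCoeff_eq ha hb hO, toMR_hecke ha hb hO hn]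
  simp only [phiCoeff_eq ha hb hO]
  rcases eq_or_ne m 0 with rfl | hm
  · simp only [Nat.gcd_zero_left, zero_mul, Nat.zero_div, phiForm_zero]
    rw [degL_hecke ha hb hO hN hn hnN, ← Finset.sum_mul]
    push_cast
    ring
  · rw [phiForm_of_ne_zero hm]
    have h := LinearMap.congr_fun (hecke_mul_hecke ha hb hO hN hn hm hnN) (toMR w)
    rw [Module.End.mul_apply] at h
    rw [h, LinearMap.sum_apply, map_sum, Complex.ofReal_sum]
    refine Finset.sum_congr rfl fun e he => ?_
    have hgcd := Nat.dvd_of_mem_divisors he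
    have hdvd : e ^ 2 ∣ m * n := by
      rw [sq]
      exact mul_dvd_mul (hgcd.trans (Nat.gcd_dvd_left m n)) (hgcd.trans (Nat.gcd_dvd_right m n))
    have h0 : m * n / e ^ 2 ≠ 0 :=
      (Nat.div_pos (Nat.le_of_dvd (Nat.pos_of_ne_zero (mul_ne_zero hm hn)) hdvd)
        (pow_pos (Nat.pos_of_mem_divisors he) 2)).ne'
    rw [phiForm_of_ne_zero h0, LinearMap.smul_apply, map_nsmul, nsmul_eq_mul]
    push_cast
    rfl

end PhiHecke

end QuatTheta

theorem mainTheorem4 (a b : ℚ) (ha : a < 0) (hb : b < 0)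
    (O : Subalgebra ℤ (Quat a b)) (hO : (Subalgebra.toSubmodule O).IsLattice ℚ) :
    ∃ N D : ℕ, 0 < N ∧ 0 < D ∧ (N : ℚ) = level O ∧ (D : ℝ) = disc (Subalgebra.toSubmodule O) ∧
      -- the series converges and is a modular form of weight 2 for `Γ₀(N)`
      (∀ v ∈ Mdual O, ∀ w : M O,
        (∀ τ : UpperHalfPlane, Summable fun m : ℕ => (phiCoeff v w m : ℂ) * qPow m τ) ∧
        ∃ f : ModularForm (Gamma0GL N) 2, (f : UpperHalfPlane → ℂ) = phi v w) ∧
      -- on classes it is half the theta series of the quaternary lattice `𝔞⁻¹ 𝔟`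
      (∀ 𝔞 𝔟 : LeftIdeal O, ∀ τ : UpperHalfPlane,
        (Summable fun x : (invLattice 𝔞.1 * 𝔟.1 : Submodule ℤ (Quat a b)) =>
          qPow (nrd (x : Quat a b) / latticeNorm (invLattice 𝔞.1 * 𝔟.1)) τ) ∧
        phi (Finsupp.single (cls 𝔞) 1) (Finsupp.single (cls 𝔟) 1) τ =
          1 / 2 * theta (invLattice 𝔞.1 * 𝔟.1) τ) ∧
      -- in general it is the corresponding linear combination of these theta series
      (∀ rep : ClassSet O → LeftIdeal O, (∀ c, cls (rep c) = c) →
        ∀ v ∈ Mdual O, ∀ w : M O, ∀ τ : UpperHalfPlane,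
          phi v w τ = v.sum fun c r => w.sum fun d k =>
            (r : ℂ) * (k : ℂ) * (1 / 2 * theta (invLattice (rep c).1 * (rep d).1) τ)) ∧
      -- compatibility with the Hecke operators prime to the discriminant
      (∀ v ∈ Mdual O, ∀ w : M O, ∀ n : ℕ, 1 ≤ n → n.Coprime D →
        hecke ℝ n v ∈ Mdual O ∧
        heckeT N n (phi v w) = phi (hecke ℝ n v) w ∧
        phi (hecke ℝ n v) w = phi v (hecke ℤ n w)) ∧
      -- `M(O)` lies in the dual lattice, and eigenvectors give eigenforms
      (∀ v : M O, toMR v ∈ Mdual O) ∧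
      (∀ v : M O, v ≠ 0 → ∀ lam : ℕ → ℝ,
        (∀ n : ℕ, 1 ≤ n → n.Coprime D → hecke ℝ n (toMR v) = lam n • toMR v) →
        phi (toMR v) v ≠ 0 ∧
        ∀ n : ℕ, 1 ≤ n → n.Coprime D →
          heckeT N n (phi (toMR v) v) = fun τ => (lam n : ℂ) * phi (toMR v) v τ) := by
  obtain ⟨N, D, hN0, hD0, hlevel, hdisc, hND, hN⟩ := exists_level_disc ha hb hO
  -- every prime dividing the level divides the discriminant
  have hcop : ∀ n : ℕ, n.Coprime D → n.Coprime N := fun n h =>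
    (Nat.Coprime.pow_right 4 h).coprime_dvd_right hND
  refine ⟨N, D, hN0, hD0, hlevel, hdisc, fun v _ w => ⟨fun τ => (hasSum_phi ha hb hO v w τ).summable,
    exists_modularForm_phi ha hb hO hN0 hN v w⟩, fun 𝔞 𝔟 τ => ?_, fun rep hrep v _ w τ => ?_,
    fun v hv w n hn hnD => ?_, toMR_mem_Mdual ha hb hO, fun v hv lam hlam =>
    ⟨phi_ne_zero ha hb hO hv, fun n hn hnD => ?_⟩⟩
  · rw [invLattice_mul_eq_colon ha hb hO 𝔞.2 𝔟.2]
    exact ⟨summable_theta ha hb (isLattice_colon ha hb 𝔞.2.1 𝔟.2.1) τ, phi_single ha hb hO 𝔞 𝔟 τ⟩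
  · simp only [invLattice_mul_eq_colon ha hb hO (rep _).2 (rep _).2]
    exact phi_eq_sum_theta ha hb hO hrep v w τ
  · have hn0 := Nat.one_le_iff_ne_zero.1 hn
    have h := phi_hecke ha hb hO hN hn0 (hcop n hnD) v w
    exact ⟨hecke_mem_Mdual ha hb hO hn0 hv,
      (heckeT_phi ha hb hO hN hn0 (hcop n hnD) v w).trans h.symm, h⟩
  · have hn0 := Nat.one_le_iff_ne_zero.1 hn
    rw [heckeT_phi ha hb hO hN hn0 (hcop n hnD), ← phi_hecke ha hb hO hN hn0 (hcop n hnD),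
      hlam n hn hnD]
    ext τ
    rw [phi, phi, ← tsum_mul_left]
    refine tsum_congr fun m => ?_
    rw [phiCoeff_eq ha hb hO, phiCoeff_eq ha hb hO, map_smul, LinearMap.smul_apply, smul_eq_mul]
    push_cast
    ring
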